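/- **Setting.** All norms are Euclidean, $v_+$ (or $[v]_+$) is the componentwise nonnegative part (and $[s]_+=\max\{s,0\}$ for numbers), $\lceil s\rceil_+=\max\{\lceil s\rceil,0\}$. For $\phi:\mathbb R^d\to\mathbb R\cup\{\infty\}$ the subdifferential at $x\in\mathrm{dom}\,\phi$ is $\partial\phi(x)=\{s:\ s^Td\le\phi'(x;d)\ \forall d\}$ with $\phi'(x;d)=\limsup_{x'\to x,\ \phi(x')\to\phi(x),\ t\downarrow0}\ \inf_{d'\to d}\,(\phi(x'+td')-\phi(x'))/t$. A function is $L$-smooth on a set $S$ if it is differentiable at the points of $S$ with $L$-Lipschitz gradient on $S$ (Frobenius norm for maps). Consider $\min f(x,y)$ s.t. $y\in\mathrm{argmin}_z\{\tilde f(x,z):\tilde g(x,z)\le0\}$ with optimal value $f^*$, where $f(x,y)=f_1(x,y)+f_2(x)$, $\tilde f(x,y)=\tilde f_1(x,y)+\tilde f_2(y)$, $f_1,\tilde f_1:\mathbb R^n\times\mathbb R^m\to\mathbb R$, $\tilde g:\mathbb R^n\times\mathbb R^m\to\mathbb R^l$, and $f_2,\tilde f_2$ have values in $\mathbb R\cup\{\infty\}$.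 Let $\mathcal X=\mathrm{dom} f_2$, $\mathcal Y=\mathrm{dom}\tilde f_2$. *Assumption 1.* $f,\tilde f$ are continuous on $\mathcal X\times\mathcal Y$; $f_2,\tilde f_2$ are proper closed convex; $\tilde f_1(x,\cdot)$ is convex for $x\in\mathcal X$; $f_1,\tilde f_1$ are $L_{\nabla f_1}$-, $L_{\nabla\tilde f_1}$-smooth on $\mathcal X\times\mathcal Y$; $\mathcal X,\mathcal Y$ are compact. *Assumption 2.* On $\mathcal X\times\mathcal Y$, $f,\tilde f$ are $L_f$-, $L_{\tilde f}$-Lipschitz and $\tilde g$ is $L_{\nabla\tilde g}$-smooth and $L_{\tilde g}$-Lipschitz; for $x\in\mathcal X$ each $\tilde g_i(x,\cdot)$ is convex; there are $G>0$ and $\hat z_x\in\mathcal Y$ ($x\in\mathcal X$) with $-\tilde g_i(x,\hat z_x)\ge G$ for all $i$ and all $x\in\mathcal X$. Let $D_{\mathbf x},D_{\mathbf y}$ be the diameters of $\mathcal X,\mathcal Y$; $f_{\rm low},\tilde f_{\rm low}$ the minima and $\tilde f_{\rm hi}$ the maximum of $f,\tilde f$ and $\tilde f$ on $\mathcal X\times\mathcal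 Y$; $\tilde g_{\rm hi}=\max_{\mathcal X\times\mathcal Y}\|\tilde g\|$; $\tilde f^*(x)=\min_z\{\tilde f(x,z):\tilde g(x,z)\le0\}$; $\widetilde P_\mu=\tilde f+\mu\|[\tilde g]_+\|^2$. Assume $D_{\mathbf y}>0$ and that $L_{\nabla f_1},L_{\nabla\tilde f_1},\tilde g_{\rm hi}L_{\nabla\tilde g}+L_{\tilde g}^2$ do not all vanish. **The method.** Given $\varepsilon\in(0,1/4]$, put $\rho=\varepsilon^{-1}$, $\mu=\varepsilon^{-2}$, and let $(x^0,y^0)\in\mathcal X\times\mathcal Y$ satisfy $\widetilde P_\mu(x^0,y^0)\le\min_y\widetilde P_\mu(x^0,y)+\varepsilon$. With $\widetilde L=L_{\nabla f_1}+2\varepsilon^{-1}L_{\nabla\tilde f_1}+4\varepsilon^{-3}(\tilde g_{\rm hi}L_{\nabla\tilde g}+L_{\tilde g}^2)$, apply Method A below to $\min_{x,y}\max_z\, h(x,y,z)+p(x,y)-q(z)$, where $h=f_1(x,y)+\rho\tilde f_1(x,y)+\rho\mu\|[\tilde g(x,y)]_+\|^2-\rho\tilde f_1(x,z)-\rho\mu\|[\tilde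 g(x,z)]_+\|^2$, $p=f_2(x)+\rho\tilde f_2(y)$, $q=\rho\tilde f_2(z)$, with $L=\widetilde L$, $D=D_{\mathbf y}$, $\epsilon=\varepsilon$, $\epsilon_0=\varepsilon^{5/2}$, first block started at $(x^0,y^0)$, second block at $y^0$. Its output is $((x_\varepsilon,y_\varepsilon),z_\varepsilon)$. Each $\nabla h$ costs one evaluation of $\nabla f_1$ and two each of $\nabla\tilde f_1$ and $\nabla\tilde g$; $\mathrm{prox}$ of $\gamma p$ costs one $\mathrm{prox}$ of $f_2$ and one of $\tilde f_2$, and $\mathrm{prox}$ of $\gamma q$ one of $\tilde f_2$. *Method A* (for $\min_x\max_y h(x,y)+p(x)-q(y)$, in generic notation; start $(x^0,y^0)$). For $k=0,1,\dots$: apply Method B to $h_k(x,y)=h(x,y)-\epsilon\|y-y^0\|^2/(4D)+L\|x-x^k\|^2$ with $\tau=\epsilon_0/(k+1)$, $\sigma_x=L$, $\sigma_y=\epsilon/(2D)$, $\bar L=3L+\epsilon/(2D)$, $z^0=z_f^0=-\sigma_xx^k$, $y^0=y_f^0=y^k$; call the output $(x^{k+1},y^{k+1})$; stop and return it if $\|x^{k+1}-x^k\|\le\epsilon/(4L)$.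 *Method B* (for $\bar h+p-q$). Put $\hat h=\bar h-\sigma_x\|x\|^2/2+\sigma_y\|y\|^2/2$, $\bar\alpha=\min\{1,\sqrt{8\sigma_y/\sigma_x}\}$, $\eta_z=\sigma_x/2$, $\eta_y=\min\{1/(2\sigma_y),4/(\bar\alpha\sigma_x)\}$, $\beta_t=2/(t+3)$, $\zeta=(2\sqrt5(1+8\bar L/\sigma_x))^{-1}$, $\gamma=8/\sigma_x$, $\hat\zeta=\min\{\sigma_x,\sigma_y\}/\bar L^2$. For $k=0,1,\dots$: (1) $(z_g,y_g)=\bar\alpha(z^k,y^k)+(1-\bar\alpha)(z_f^k,y_f^k)$, $u^{-1}=(-\sigma_x^{-1}z_g,y_g)$, and $a(x,y)=\big(\nabla_x\hat h+\tfrac{\sigma_x}2(x-\sigma_x^{-1}z_g),\ -\nabla_y\hat h+\sigma_yy+\tfrac{\sigma_x}8(y-y_g)\big)$; write $\Pi=(\mathrm{prox}_{\zeta\gamma p},\mathrm{prox}_{\zeta\gamma q})$, $v=u^{-1}-\zeta\gamma a(u^{-1})$, $u^0=\Pi(v)$, $b^0=(v-u^0)/(\zeta\gamma)$, $t=0$.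 (2) While $\gamma\|a(u^t)+b^t\|^2>\gamma^{-1}\|u^t-u^{-1}\|^2$: $c=u^t+\beta_t(u^0-u^t)$, $u^{t+1/2}=c-\zeta\gamma(a(u^t)+b^t)$, $v=c-\zeta\gamma a(u^{t+1/2})$, $u^{t+1}=\Pi(v)$, $b^{t+1}=(v-u^{t+1})/(\zeta\gamma)$, $t\leftarrow t+1$. (3) $(x_f,y_f)=u^t$, $(z_f,w_f)=(\nabla_x\hat h,-\nabla_y\hat h)(u^t)+b^t$ (these are $x_f^{k+1},y_f^{k+1},z_f^{k+1},w_f^{k+1}$), $z^{k+1}=z^k+\eta_z\sigma_x^{-1}(z_f-z^k)-\eta_z(x_f+\sigma_x^{-1}z_f)$, $y^{k+1}=y^k+\eta_y\sigma_y(y_f-y^k)-\eta_y(w_f+\sigma_yy_f)$, $x^{k+1}=-\sigma_x^{-1}z^{k+1}$, $\hat x=\mathrm{prox}_{\hat\zeta p}(x^{k+1}-\hat\zeta\nabla_x\bar h(x^{k+1},y^{k+1}))$, $\hat y=\mathrm{prox}_{\hat\zeta q}(y^{k+1}+\hat\zeta\nabla_y\bar h(x^{k+1},y^{k+1}))$.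 (4) Stop and return $(\hat x,\hat y)$ if $\|\hat\zeta^{-1}(x^{k+1}-\hat x,\hat y-y^{k+1})-(\nabla\bar h(x^{k+1},y^{k+1})-\nabla\bar h(\hat x,\hat y))\|\le\tau$. Since the method also evaluates gradients at points outside $\mathcal X\times\mathcal Y$, assume finally that there is a set $U\supseteq\mathcal X\times\mathcal Y$ containing all points at which it evaluates $\nabla f_1,\nabla\tilde f_1,\nabla\tilde g$ (for instance $U=\mathbb R^n\times\mathbb R^m$) such that $\tilde g$ is differentiable at the points of $U$ and $f_1,\tilde f_1,\|[\tilde g]_+\|^2$ are smooth on $U$ with moduli $L_{\nabla f_1},L_{\nabla\tilde f_1},2(\tilde g_{\rm hi}L_{\nabla\tilde g}+L_{\tilde g}^2)$. **Constants.** $\tilde\alpha=\min\{1,\sqrt{4\varepsilon/(D_{\mathbf y}\widetilde L)}\}$, $\tilde\delta=(2+\tilde\alpha^{-1})(D_{\mathbf x}^2+D_{\mathbf y}^2)\widetilde L+\max\{\varepsilon/D_{\mathbf y},\tilde\alpha\widetilde L/4\}D_{\mathbf y}^2$, $$\widetilde C=\frac{4\max\{\frac1{2\widetilde L},\min\{D_{\mathbf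 y}\varepsilon^{-1},\frac4{\tilde\alpha\widetilde L}\}\}\Big(\tilde\delta+2\tilde\alpha^{-1}\big[f^*-f_{\rm low}+2\varepsilon^{-1}(\tilde f_{\rm hi}-\tilde f_{\rm low})+\varepsilon^{-3}\tilde g_{\rm hi}^2+\tfrac{\varepsilon D_{\mathbf y}}4+\widetilde L(D_{\mathbf x}^2+D_{\mathbf y}^2)\big]\Big)}{\big[(3\widetilde L+\frac{\varepsilon}{2D_{\mathbf y}})^2/\min\{\widetilde L,\frac{\varepsilon}{2D_{\mathbf y}}\}+3\widetilde L+\frac{\varepsilon}{2D_{\mathbf y}}\big]^{-2}\varepsilon^5},$$ $$\widetilde K=\Big\lceil32(1+f(x^0,y^0)-f_{\rm low}+\varepsilon D_{\mathbf y}/4)\widetilde L\varepsilon^{-2}+32\varepsilon^3(1+4D_{\mathbf y}^2\widetilde L^2\varepsilon^{-2})-1\Big\rceil_+,$$ $$\widetilde N=\Big(\Big\lceil96\sqrt2\big(1+(24\widetilde L+4\varepsilon/D_{\mathbf y})\widetilde L^{-1}\big)\Big\rceil+2\Big)\max\Big\{2,\sqrt{D_{\mathbf y}\widetilde L\varepsilon^{-1}}\Big\}\big[(\widetilde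 K+1)(\log\widetilde C)_++\widetilde K+1+2\widetilde K\log(\widetilde K+1)\big],$$ $$R=\max\Big\{\varepsilon\big(1+f(x^0,y^0)-f_{\rm low}+2\varepsilon^5(\widetilde L^{-1}+4D_{\mathbf y}^2\widetilde L\varepsilon^{-2})+D_{\mathbf y}\varepsilon/4\big),\ \varepsilon^2G^{-2}D_{\mathbf y}^2L_{\tilde f}(\varepsilon^2+\varepsilon L_f+L_{\tilde f})/2\Big\}.$$ **Theorem.** The method terminates, and with $\tilde\lambda=2\varepsilon^{-2}[\tilde g(x_\varepsilon,z_\varepsilon)]_+$, $\hat\lambda=2\varepsilon^{-3}[\tilde g(x_\varepsilon,y_\varepsilon)]_+$ its output satisfies - $\mathrm{dist}\big(0,\partial f(x_\varepsilon,y_\varepsilon)+\rho\partial\tilde f(x_\varepsilon,y_\varepsilon)-\rho(\nabla_x\tilde f(x_\varepsilon,z_\varepsilon)+\nabla_x\tilde g(x_\varepsilon,z_\varepsilon)\tilde\lambda;0)+\nabla\tilde g(x_\varepsilon,y_\varepsilon)\hat\lambda\big)\le\varepsilon$; - $\mathrm{dist}\big(0,\rho(\partial_z\tilde f(x_\varepsilon,z_\varepsilon)+\nabla_z\tilde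 g(x_\varepsilon,z_\varepsilon)\tilde\lambda)\big)\le\varepsilon$; - $\|[\tilde g(x_\varepsilon,z_\varepsilon)]_+\|\le\varepsilon^2G^{-1}D_{\mathbf y}(\varepsilon^2+L_{\tilde f})/2$ and $|\langle\tilde\lambda,\tilde g(x_\varepsilon,z_\varepsilon)\rangle|\le\varepsilon^2G^{-2}D_{\mathbf y}^2(\varepsilon^2+L_{\tilde f})^2/2$; - $|\tilde f(x_\varepsilon,y_\varepsilon)-\tilde f^*(x_\varepsilon)|\le R$; - $\|[\tilde g(x_\varepsilon,y_\varepsilon)]_+\|\le\varepsilon^2G^{-1}D_{\mathbf y}(\varepsilon^2+\varepsilon L_f+L_{\tilde f})/2$ and $|\langle\hat\lambda,\tilde g(x_\varepsilon,y_\varepsilon)\rangle|\le\varepsilon G^{-2}D_{\mathbf y}^2(\varepsilon^2+\varepsilon L_f+L_{\tilde f})^2/2$. It performs at most $\widetilde N$ evaluations of each of $\nabla f_1$, $\nabla\tilde f_1$, $\nabla\tilde g$, and of the proximal operators of $f_2$ and $\tilde f_2$. Moreover $\widetilde N=\mathcal O(\varepsilon^{-7}\log\varepsilon^{-1})$ and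 $R=\mathcal O(\varepsilon)$ for $\varepsilon\in(0,1/4]$, with constants that depend on the problem data and moduli only (not on $\varepsilon$, $x^0$, $y^0$). -/

import Mathlib

open scoped Pointwise

noncomputable section

namespace BilevelPenalty

/-! ### Convex analysis: domain, subdifferential, proximal operator -/

/-- The effective domain of an extended real valued function. -/
def dom {H : Type*} (φ : H → EReal) : Set H := {x | φ x < ⊤}

/-- Proper closed convex functions with values in `ℝ ∪ {∞}`. -/
def ProperClosedConvex {H : Type*} [NormedAddCommGroup H] [InnerProductSpace ℝ H]
    (φ : H → EReal) : Prop :=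
  (∀ x, φ x ≠ ⊥) ∧ (dom φ).Nonempty ∧ LowerSemicontinuous φ ∧
    Convex ℝ {p : H × ℝ | φ p.1 ≤ (p.2 : EReal)}

/-- The upper subderivative
`φ'(x; d) = limsup_{x' →_φ x, t ↓ 0} inf_{d' → d} (φ (x' + t d') - φ x') / t`, where
`x' →_φ x` means `x' → x` and `φ x' → φ x`, and `limsup inf_{d' → d}` stands for the supremum over
`δ > 0` of the upper limit of the infimum over the ball `‖d' - d‖ < δ`. -/
def upperSubderiv {H : Type*} [NormedAddCommGroup H] [InnerProductSpace ℝ H]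
    (φ : H → EReal) (x d : H) : EReal :=
  ⨆ δ : {δ : ℝ // 0 < δ},
    Filter.limsup
      (fun p : H × ℝ =>
        ⨅ d' : Metric.ball d δ.1, (φ (p.1 + p.2 • (d' : H)) - φ p.1) / (p.2 : EReal))
      ((nhds x ⊓ Filter.comap φ (nhds (φ x))) ×ˢ nhdsWithin (0 : ℝ) (Set.Ioi 0))

/-- The subdifferential of `φ` at `x` (empty outside the domain). -/
def subdiff {H : Type*} [NormedAddCommGroup H] [InnerProductSpace ℝ H]
    (φ : H → EReal) (x : H) : Set H :=
  {s | x ∈ dom φ ∧ ∀ d : H, ((inner ℝ s d : ℝ) : EReal) ≤ upperSubderiv φ x d}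

/-- `v` is a minimizer of `‖v - x‖² / 2 + γ φ(v)`. -/
def IsProx {H : Type*} [NormedAddCommGroup H] [InnerProductSpace ℝ H]
    (γ : ℝ) (φ : H → EReal) (x v : H) : Prop :=
  ∀ v' : H, ((‖v - x‖ ^ 2 / 2 : ℝ) : EReal) + (γ : EReal) * φ v ≤
    ((‖v' - x‖ ^ 2 / 2 : ℝ) : EReal) + (γ : EReal) * φ v'

open Classical in
/-- The proximal operator `prox_{γ φ}`; for `γ > 0` and `φ` proper closed convex, the minimizer
exists and is unique. -/
def prox {H : Type*} [NormedAddCommGroup H] [InnerProductSpace ℝ H]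
    (γ : ℝ) (φ : H → EReal) (x : H) : H :=
  Classical.epsilon (IsProx γ φ x)

/-- `φ` is differentiable at the points of `S`, with an `L`-Lipschitz gradient on `S`. -/
def SmoothOn {H : Type*} [NormedAddCommGroup H] [InnerProductSpace ℝ H] [CompleteSpace H]
    (L : ℝ) (φ : H → ℝ) (S : Set H) : Prop :=
  (∀ w ∈ S, DifferentiableAt ℝ φ w) ∧
    ∀ w ∈ S, ∀ w' ∈ S, ‖gradient φ w - gradient φ w'‖ ≤ L * ‖w - w'‖

/-! ### The bilevel problem -/

/-- `ℝⁿ` with the Euclidean norm. -/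
abbrev Vec (n : ℕ) := EuclideanSpace ℝ (Fin n)

/-- `ℝⁿ × ℝᵐ` with the Euclidean norm. -/
abbrev Pt (n m : ℕ) := WithLp 2 (Vec n × Vec m)

/-- The stacked vector `(x; y)`. -/
def pt {n m : ℕ} (x : Vec n) (y : Vec m) : Pt n m := WithLp.toLp 2 (x, y)

/-- The componentwise nonnegative part `[v]₊`. -/
def posPart {l : ℕ} (v : Vec l) : Vec l := WithLp.toLp 2 (fun i => max (v i) 0)

/-- The functions of the problem: `f(x,y) = f₁(x,y) + f₂(x)` (upper level),
`f̃(x,y) = f̃₁(x,y) + f̃₂(y)` and `g̃` (lower level objective and constraint map). -/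
structure Problem (n m l : ℕ) where
  f₁ : Pt n m → ℝ
  f₂ : Vec n → EReal
  ft₁ : Pt n m → ℝ
  ft₂ : Vec m → EReal
  gt : Pt n m → Vec l

/-- The moduli in the assumptions: Lipschitz moduli of `∇f₁`, `∇f̃₁`, `f`, `f̃`, `∇g̃`, `g̃`, and the
Slater constant `G`. -/
structure Moduli where
  Lgradf₁ : ℝ
  Lgradft₁ : ℝ
  Lf : ℝ
  Lft : ℝ
  Lgradgt : ℝ
  Lgt : ℝ
  G : ℝ

namespace Problem

/-- `𝒳 = dom f₂`. -/
def X {n m l : ℕ} (P : Problem n m l) : Set (Vec n) := dom P.f₂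

/-- `𝒴 = dom f̃₂`. -/
def Y {n m l : ℕ} (P : Problem n m l) : Set (Vec m) := dom P.ft₂

/-- `𝒳 × 𝒴`. -/
def XY {n m l : ℕ} (P : Problem n m l) : Set (Pt n m) := {w | w.fst ∈ P.X ∧ w.snd ∈ P.Y}

/-- The upper level objective `f`. -/
def f {n m l : ℕ} (P : Problem n m l) (w : Pt n m) : EReal := (P.f₁ w : EReal) + P.f₂ w.fst

/-- The lower level objective `f̃`. -/
def ft {n m l : ℕ} (P : Problem n m l) (w : Pt n m) : EReal := (P.ft₁ w : EReal) + P.ft₂ w.snd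

/-- The real value of `f`, meaningful on `𝒳 × 𝒴`. -/
def fR {n m l : ℕ} (P : Problem n m l) (w : Pt n m) : ℝ := (P.f w).toReal

/-- The real value of `f̃`, meaningful on `𝒳 × 𝒴`. -/
def ftR {n m l : ℕ} (P : Problem n m l) (w : Pt n m) : ℝ := (P.ft w).toReal

/-- `∇g̃ᵢ(w)`. -/
def gradgt {n m l : ℕ} (P : Problem n m l) (w : Pt n m) (i : Fin l) : Pt n m :=
  gradient (fun w' => P.gt w' i) w

/-- `∇g̃(w) λ = ∑ᵢ λᵢ ∇g̃ᵢ(w)`; its two blocks are `∇ₓg̃(w) λ` and `∇_y g̃(w) λ`. -/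
def gradgtMul {n m l : ℕ} (P : Problem n m l) (w : Pt n m) (lam : Vec l) : Pt n m :=
  ∑ i, lam i • P.gradgt w i

/-- Feasibility for the lower level constraint `g̃(x,z) ≤ 0`. -/
def Feasible {n m l : ℕ} (P : Problem n m l) (x : Vec n) (z : Vec m) : Prop :=
  ∀ i, P.gt (pt x z) i ≤ 0

/-- The lower level solution set `argmin_z {f̃(x,z) | g̃(x,z) ≤ 0}`. -/
def lowerSol {n m l : ℕ} (P : Problem n m l) (x : Vec n) : Set (Vec m) :=
  {y | P.Feasible x y ∧ ∀ z, P.Feasible x z → P.ft (pt x y) ≤ P.ft (pt x z)}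

/-- The lower level value function `f̃*(x) = min_z {f̃(x,z) | g̃(x,z) ≤ 0}`. -/
def ftStar {n m l : ℕ} (P : Problem n m l) (x : Vec n) : ℝ :=
  (⨅ z : {z : Vec m // P.Feasible x z}, P.ft (pt x z.1)).toReal

/-- The optimal value `f*` of the bilevel problem. -/
def fStar {n m l : ℕ} (P : Problem n m l) : ℝ :=
  (⨅ w : {w : Pt n m // w.snd ∈ P.lowerSol w.fst}, P.f w.1).toReal

/-- `D_x`, the diameter of `𝒳`. -/
def Dx {n m l : ℕ} (P : Problem n m l) : ℝ := Metric.diam P.X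

/-- `D_y`, the diameter of `𝒴`. -/
def Dy {n m l : ℕ} (P : Problem n m l) : ℝ := Metric.diam P.Y

/-- `f_low = min f` on `𝒳 × 𝒴`. -/
def fLow {n m l : ℕ} (P : Problem n m l) : ℝ := sInf (P.fR '' P.XY)

/-- `f̃_low = min f̃` on `𝒳 × 𝒴`. -/
def ftLow {n m l : ℕ} (P : Problem n m l) : ℝ := sInf (P.ftR '' P.XY)

/-- `f̃_hi = max f̃` on `𝒳 × 𝒴`. -/
def ftHi {n m l : ℕ} (P : Problem n m l) : ℝ := sSup (P.ftR '' P.XY)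

/-- `g̃_hi = max ‖g̃‖` on `𝒳 × 𝒴`. -/
def gtHi {n m l : ℕ} (P : Problem n m l) : ℝ := sSup ((fun w => ‖P.gt w‖) '' P.XY)

/-- The lower level penalty function `P̃_μ = f̃ + μ ‖[g̃]₊‖²` (real value, meaningful on `𝒳 × 𝒴`). -/
def penalty {n m l : ℕ} (P : Problem n m l) (μ : ℝ) (w : Pt n m) : ℝ :=
  P.ftR w + μ * ‖posPart (P.gt w)‖ ^ 2

/-- First assumption: structure, continuity, convexity and smoothness of `f` and `f̃`, and
compactness of the domains. -/
structure Assumption1 {n m l : ℕ} (P : Problem n m l) (c : Moduli) : Prop where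
  f₂_convex : ProperClosedConvex P.f₂
  ft₂_convex : ProperClosedConvex P.ft₂
  f_cont : ContinuousOn P.f P.XY
  ft_cont : ContinuousOn P.ft P.XY
  ft₁_convex : ∀ x ∈ P.X, ConvexOn ℝ Set.univ (fun y => P.ft₁ (pt x y))
  f₁_smooth : SmoothOn c.Lgradf₁ P.f₁ P.XY
  ft₁_smooth : SmoothOn c.Lgradft₁ P.ft₁ P.XY
  X_compact : IsCompact P.X
  Y_compact : IsCompact P.Y

/-- Second assumption: Lipschitz continuity of `f`, `f̃`, smoothness (in the Frobenius norm) and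
Lipschitz continuity of `g̃`, convexity of `g̃ᵢ(x,·)`, and the uniform Slater condition with
constant `G`. -/
structure Assumption2 {n m l : ℕ} (P : Problem n m l) (c : Moduli) : Prop where
  f_lip : ∀ w ∈ P.XY, ∀ w' ∈ P.XY, |P.fR w - P.fR w'| ≤ c.Lf * ‖w - w'‖
  ft_lip : ∀ w ∈ P.XY, ∀ w' ∈ P.XY, |P.ftR w - P.ftR w'| ≤ c.Lft * ‖w - w'‖
  gt_diff : ∀ w ∈ P.XY, DifferentiableAt ℝ P.gt w
  gt_smooth : ∀ w ∈ P.XY, ∀ w' ∈ P.XY,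
    Real.sqrt (∑ i, ‖P.gradgt w i - P.gradgt w' i‖ ^ 2) ≤ c.Lgradgt * ‖w - w'‖
  gt_lip : ∀ w ∈ P.XY, ∀ w' ∈ P.XY, ‖P.gt w - P.gt w'‖ ≤ c.Lgt * ‖w - w'‖
  gt_convex : ∀ x ∈ P.X, ∀ i, ConvexOn ℝ Set.univ (fun y => P.gt (pt x y) i)
  G_pos : 0 < c.G
  slater : ∃ zhat : Vec n → Vec m, ∀ x ∈ P.X, zhat x ∈ P.Y ∧ ∀ i, c.G ≤ -P.gt (pt x (zhat x)) i

/-- `U` contains `𝒳 × 𝒴`, and on `U` the functions `f₁`, `f̃₁` and `‖[g̃]₊‖²` are smooth with the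
moduli `L_{∇f₁}`, `L_{∇f̃₁}` and `2 (g̃_hi L_{∇g̃} + L_g̃²)`
(recall `∇(‖[g̃]₊‖²) = 2 ∇g̃ [g̃]₊`). -/
structure SmoothRegion {n m l : ℕ} (P : Problem n m l) (c : Moduli) (U : Set (Pt n m)) : Prop where
  subset : P.XY ⊆ U
  f₁_smooth : SmoothOn c.Lgradf₁ P.f₁ U
  ft₁_smooth : SmoothOn c.Lgradft₁ P.ft₁ U
  gt_diff : ∀ w ∈ U, DifferentiableAt ℝ P.gt w
  penalty_smooth : ∀ w ∈ U, ∀ w' ∈ U,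
    ‖P.gradgtMul w (posPart (P.gt w)) - P.gradgtMul w' (posPart (P.gt w'))‖ ≤
      (P.gtHi * c.Lgradgt + c.Lgt ^ 2) * ‖w - w'‖

end Problem

/-! ### The first-order method for `min_x max_y h(x,y) + p(x) - q(y)`

Oracle calls are recorded in a list, so that they can be counted. -/

/-- A computation that records its oracle calls (of type `Q`). -/
abbrev Comp (Q α : Type) := StateM (List Q) α

/-- Oracles of the minimax problem: the two partial gradients of `h`, and
`prox_{γ p}`, `prox_{γ q}`. -/
structure MinimaxOracle (Q V W : Type) where
  grad : V → W → Comp Q (V × W)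
  proxP : ℝ → V → Comp Q V
  proxQ : ℝ → W → Comp Q W

/-- Parameters of the method: `L = L_{∇h}`, `D = D_q`, the accuracies `ε` and `ε₀`, and the initial
point. -/
structure MinimaxParams (V W : Type) where
  L : ℝ
  D : ℝ
  eps : ℝ
  eps₀ : ℝ
  xinit : V
  yinit : W

namespace MinimaxParams

variable {V W : Type}

/-- `σ_x`. -/
def σx (A : MinimaxParams V W) : ℝ := A.L
/-- `σ_y`. -/
def σy (A : MinimaxParams V W) : ℝ := A.eps / (2 * A.D)
/-- `L_{∇h̄}`. -/
def Lbar (A : MinimaxParams V W) : ℝ := 3 * A.L + A.eps / (2 * A.D)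
/-- `ᾱ`. -/
def αbar (A : MinimaxParams V W) : ℝ := min 1 (Real.sqrt (8 * A.σy / A.σx))
/-- `η_z`. -/
def ηz (A : MinimaxParams V W) : ℝ := A.σx / 2
/-- `η_y`. -/
def ηy (A : MinimaxParams V W) : ℝ := min (1 / (2 * A.σy)) (4 / (A.αbar * A.σx))
/-- `ζ`. -/
def ζ (A : MinimaxParams V W) : ℝ := (2 * Real.sqrt 5 * (1 + 8 * A.Lbar / A.σx))⁻¹
/-- `γ_x = γ_y`. -/
def γ (A : MinimaxParams V W) : ℝ := 8 / A.σx
/-- `ζ̂`. -/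
def ζhat (A : MinimaxParams V W) : ℝ := min A.σx A.σy / A.Lbar ^ 2

end MinimaxParams

/-- State of the outer loop: the counter `k` and the iterate `(x^k, y^k)`. -/
structure OuterState (V W : Type) where
  k : ℕ
  x : V
  y : W

/-- State of the middle loop (iterations of the strongly-convex-strongly-concave solver). -/
structure MidState (V W : Type) where
  z : V
  y : W
  zf : V
  yf : W

/-- State of the innermost while loop: `(z_g, y_g)`, the points with superscripts `-1`, `0` and `t`,
the vectors `b^{k,t}`, and the stored gradient `∇ĥ(x^{k,t}, y^{k,t})`. -/
structure InnerState (V W : Type) where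
  zg : V
  yg : W
  xm : V
  ym : W
  x0 : V
  y0 : W
  t : ℕ
  x : V
  y : W
  bx : V
  bY : W
  gx : V
  gy : W

/-- Where the method is: at the head of the middle loop, at the head of the while loop, or
terminated with output `(x, y)`. -/
inductive Config (V W : Type) where
  | mid (o : OuterState V W) (s : MidState V W)
  | inner (o : OuterState V W) (s : MidState V W) (i : InnerState V W)
  | halted (x : V) (y : W)

section Method

variable {Q V W : Type} [NormedAddCommGroup V] [InnerProductSpace ℝ V]
  [NormedAddCommGroup W] [InnerProductSpace ℝ W]

/-- The gradient of `h_k(x,y) = h(x,y) - ε ‖y - y⁰‖² / (4 D_q) + L_{∇h} ‖x - x^k‖²`. -/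
def gradHbar (O : MinimaxOracle Q V W) (A : MinimaxParams V W) (o : OuterState V W)
    (x : V) (y : W) : Comp Q (V × W) := do
  let g ← O.grad x y
  return (g.1 + (2 * A.L) • (x - o.x), g.2 - (A.eps / (2 * A.D)) • (y - A.yinit))

/-- The gradient of `ĥ(x,y) = h̄(x,y) - σ_x ‖x‖² / 2 + σ_y ‖y‖² / 2`, with `h̄ = h_k`. -/
def gradHhat (O : MinimaxOracle Q V W) (A : MinimaxParams V W) (o : OuterState V W)
    (x : V) (y : W) : Comp Q (V × W) := do
  let g ← gradHbar O A o x y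
  return (g.1 - A.σx • x, g.2 + A.σy • y)

/-- `a^k_x` at a point `x` where `∇ₓĥ` has the value `gx`. -/
def aX (A : MinimaxParams V W) (zg x gx : V) : V :=
  gx + (A.σx / 2) • (x - A.σx⁻¹ • zg)

/-- `a^k_y` at a point `y` where `∇_yĥ` has the value `gy`. -/
def aY (A : MinimaxParams V W) (yg y gy : W) : W :=
  -gy + A.σy • y + (A.σx / 8) • (y - yg)

/-- Lines before the while loop. -/
def innerInit (O : MinimaxOracle Q V W) (A : MinimaxParams V W) (o : OuterState V W)
    (s : MidState V W) : Comp Q (InnerState V W) := do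
  let zg := A.αbar • s.z + (1 - A.αbar) • s.zf
  let yg := A.αbar • s.y + (1 - A.αbar) • s.yf
  let xm := -(A.σx⁻¹ • zg)
  let ym := yg
  let g ← gradHhat O A o xm ym
  let ux := xm - (A.ζ * A.γ) • aX A zg xm g.1
  let uy := ym - (A.ζ * A.γ) • aY A yg ym g.2
  let x0 ← O.proxP (A.ζ * A.γ) ux
  let y0 ← O.proxQ (A.ζ * A.γ) uy
  let g0 ← gradHhat O A o x0 y0
  return { zg := zg, yg := yg, xm := xm, ym := ym, x0 := x0, y0 := y0, t := 0, x := x0, y := y0,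
           bx := (A.ζ * A.γ)⁻¹ • (ux - x0), bY := (A.ζ * A.γ)⁻¹ • (uy - y0),
           gx := g0.1, gy := g0.2 }

/-- The condition of the while loop. -/
def innerGuard (A : MinimaxParams V W) (i : InnerState V W) : Prop :=
  A.γ⁻¹ * ‖i.x - i.xm‖ ^ 2 + A.γ⁻¹ * ‖i.y - i.ym‖ ^ 2 <
    A.γ * ‖aX A i.zg i.x i.gx + i.bx‖ ^ 2 + A.γ * ‖aY A i.yg i.y i.gy + i.bY‖ ^ 2

/-- The body of the while loop. -/
def innerStep (O : MinimaxOracle Q V W) (A : MinimaxParams V W) (o : OuterState V W)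
    (i : InnerState V W) : Comp Q (InnerState V W) := do
  let β : ℝ := 2 / ((i.t : ℝ) + 3)
  let cx := i.x + β • (i.x0 - i.x)
  let cy := i.y + β • (i.y0 - i.y)
  let xh := cx - (A.ζ * A.γ) • (aX A i.zg i.x i.gx + i.bx)
  let yh := cy - (A.ζ * A.γ) • (aY A i.yg i.y i.gy + i.bY)
  let gh ← gradHhat O A o xh yh
  let ux := cx - (A.ζ * A.γ) • aX A i.zg xh gh.1
  let uy := cy - (A.ζ * A.γ) • aY A i.yg yh gh.2
  let x' ← O.proxP (A.ζ * A.γ) ux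
  let y' ← O.proxQ (A.ζ * A.γ) uy
  let g' ← gradHhat O A o x' y'
  return { i with
    t := i.t + 1, x := x', y := y',
    bx := (A.ζ * A.γ)⁻¹ • (ux - x'), bY := (A.ζ * A.γ)⁻¹ • (uy - y'),
    gx := g'.1, gy := g'.2 }

/-- Start of a call of the strongly-convex-strongly-concave solver: `z⁰ = z_f⁰ = -σ_x x^k`,
`y⁰ = y_f⁰ = y^k`. -/
def midInit (A : MinimaxParams V W) (o : OuterState V W) : Config V W :=
  Config.mid o { z := -(A.σx • o.x), y := o.y, zf := -(A.σx • o.x), yf := o.y }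

open Classical in
/-- Lines after the while loop, the termination test of the solver with tolerance
`ε_k = ε₀ / (k + 1)`, and, if it is passed, the termination test of the outer loop. -/
def midFinish (O : MinimaxOracle Q V W) (A : MinimaxParams V W) (o : OuterState V W)
    (s : MidState V W) (i : InnerState V W) : Comp Q (Config V W) := do
  let xf := i.x
  let yf := i.y
  let zf := i.gx + i.bx
  let wf := -i.gy + i.bY
  let z' := s.z + (A.ηz * A.σx⁻¹) • (zf - s.z) - A.ηz • (xf + A.σx⁻¹ • zf)
  let y' := s.y + (A.ηy * A.σy) • (yf - s.y) - A.ηy • (wf + A.σy • yf)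
  let x' := -(A.σx⁻¹ • z')
  let g ← gradHbar O A o x' y'
  let xhat ← O.proxP A.ζhat (x' - A.ζhat • g.1)
  let yhat ← O.proxQ A.ζhat (y' + A.ζhat • g.2)
  let ghat ← gradHbar O A o xhat yhat
  let rx := A.ζhat⁻¹ • (x' - xhat) - (g.1 - ghat.1)
  let ry := A.ζhat⁻¹ • (yhat - y') - (g.2 - ghat.2)
  if Real.sqrt (‖rx‖ ^ 2 + ‖ry‖ ^ 2) ≤ A.eps₀ / ((o.k : ℝ) + 1) then
    if ‖xhat - o.x‖ ≤ A.eps / (4 * A.L) then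
      return Config.halted xhat yhat
    else
      return midInit A { k := o.k + 1, x := xhat, y := yhat }
  else
    return Config.mid o { z := z', y := y', zf := zf, yf := yf }

open Classical in
/-- One step of the method. -/
def step (O : MinimaxOracle Q V W) (A : MinimaxParams V W) :
    Config V W → Comp Q (Config V W)
  | Config.mid o s => do
      let i ← innerInit O A o s
      return Config.inner o s i
  | Config.inner o s i =>
      if innerGuard A i then do
        let i' ← innerStep O A o i
        return Config.inner o s i'
      else midFinish O A o s i
  | Config.halted x y => return Config.halted x y

/-- The configuration after `j` steps, with the list of the oracle calls made so far. -/
def run (O : MinimaxOracle Q V W) (A : MinimaxParams V W) (j : ℕ) : Config V W × List Q :=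
  (fun c : Config V W × List Q => (step O A c.1).run c.2)^[j]
    (midInit A { k := 0, x := A.xinit, y := A.yinit }, [])

end Method

/-! ### The penalty method for the bilevel problem -/

/-- Oracle calls: `∇f₁`, `∇f̃₁`, `∇g̃` at a point, and `prox_{γ f₂}`, `prox_{γ f̃₂}`. -/
inductive Query (n m : ℕ) where
  | gradf₁ (w : Pt n m)
  | gradft₁ (w : Pt n m)
  | gradgt (w : Pt n m)
  | proxf₂ (γ : ℝ) (x : Vec n)
  | proxft₂ (γ : ℝ) (y : Vec m)

namespace Query

/-- The number of evaluations of `∇f₁`. -/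
def numGradf₁ {n m : ℕ} (q : List (Query n m)) : ℕ :=
  q.countP (fun e => match e with | gradf₁ _ => true | _ => false)

/-- The number of evaluations of `∇f̃₁`. -/
def numGradft₁ {n m : ℕ} (q : List (Query n m)) : ℕ :=
  q.countP (fun e => match e with | gradft₁ _ => true | _ => false)

/-- The number of evaluations of `∇g̃`. -/
def numGradgt {n m : ℕ} (q : List (Query n m)) : ℕ :=
  q.countP (fun e => match e with | gradgt _ => true | _ => false)

/-- The number of evaluations of the proximal operator of `f₂`. -/
def numProxf₂ {n m : ℕ} (q : List (Query n m)) : ℕ :=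
  q.countP (fun e => match e with | proxf₂ _ _ => true | _ => false)

/-- The number of evaluations of the proximal operator of `f̃₂`. -/
def numProxft₂ {n m : ℕ} (q : List (Query n m)) : ℕ :=
  q.countP (fun e => match e with | proxft₂ _ _ => true | _ => false)

/-- A gradient evaluation takes place at a point of `U` (no condition on proximal operators). -/
def GradIn {n m : ℕ} (U : Set (Pt n m)) : Query n m → Prop
  | gradf₁ w => w ∈ U
  | gradft₁ w => w ∈ U
  | gradgt w => w ∈ U
  | proxf₂ _ _ => True
  | proxft₂ _ _ => True

end Query

namespace Problem

/-- Record an oracle call. -/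
def tick {n m : ℕ} (q : Query n m) : Comp (Query n m) Unit := modify (fun tr => q :: tr)

/-- Evaluate `∇f₁`. -/
def callGradf₁ {n m l : ℕ} (P : Problem n m l) (w : Pt n m) : Comp (Query n m) (Pt n m) := do
  tick (Query.gradf₁ w)
  return gradient P.f₁ w

/-- Evaluate `∇f̃₁`. -/
def callGradft₁ {n m l : ℕ} (P : Problem n m l) (w : Pt n m) : Comp (Query n m) (Pt n m) := do
  tick (Query.gradft₁ w)
  return gradient P.ft₁ w

/-- Evaluate `∇g̃` once and form `∇g̃(w) [g̃(w)]₊`. -/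
def callGradgt {n m l : ℕ} (P : Problem n m l) (w : Pt n m) : Comp (Query n m) (Pt n m) := do
  tick (Query.gradgt w)
  return P.gradgtMul w (posPart (P.gt w))

/-- Evaluate `prox_{γ f₂}`. -/
def callProxf₂ {n m l : ℕ} (P : Problem n m l) (γ : ℝ) (x : Vec n) :
    Comp (Query n m) (Vec n) := do
  tick (Query.proxf₂ γ x)
  return prox γ P.f₂ x

/-- Evaluate `prox_{γ f̃₂}`. -/
def callProxft₂ {n m l : ℕ} (P : Problem n m l) (γ : ℝ) (y : Vec m) :
    Comp (Query n m) (Vec m) := do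
  tick (Query.proxft₂ γ y)
  return prox γ P.ft₂ y

/-- The oracles of the minimax problem `min_{x,y} max_z h(x,y,z) + p(x,y) - q(z)` with
`h(x,y,z) = f₁(x,y) + ρ f̃₁(x,y) + ρμ ‖[g̃(x,y)]₊‖² - ρ f̃₁(x,z) - ρμ ‖[g̃(x,z)]₊‖²`,
`p(x,y) = f₂(x) + ρ f̃₂(y)` and `q(z) = ρ f̃₂(z)`, in terms of those of the bilevel problem. -/
def oracle {n m l : ℕ} (P : Problem n m l) (ρ μ : ℝ) :
    MinimaxOracle (Query n m) (Pt n m) (Vec m) where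
  grad w z := do
    let w' := pt w.fst z
    let a ← P.callGradf₁ w
    let b ← P.callGradft₁ w
    let c ← P.callGradgt w
    let b' ← P.callGradft₁ w'
    let c' ← P.callGradgt w'
    return (a + ρ • b + (2 * ρ * μ) • c - pt (ρ • b'.fst + (2 * ρ * μ) • c'.fst) 0,
      -(ρ • b'.snd) - (2 * ρ * μ) • c'.snd)
  proxP γ w := do
    let x ← P.callProxf₂ γ w.fst
    let y ← P.callProxft₂ (γ * ρ) w.snd
    return pt x y
  proxQ γ z := P.callProxft₂ (γ * ρ) z

/-- `L̃ = L_{∇f₁} + 2 ε⁻¹ L_{∇f̃₁} + 4 ε⁻³ (g̃_hi L_{∇g̃} + L_g̃²)`. -/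
def Ltilde {n m l : ℕ} (P : Problem n m l) (c : Moduli) (ε : ℝ) : ℝ :=
  c.Lgradf₁ + 2 * ε⁻¹ * c.Lgradft₁ + 4 * (ε ^ 3)⁻¹ * (P.gtHi * c.Lgradgt + c.Lgt ^ 2)

/-- The parameters of the minimax method in the penalty method: `L_{∇h} = L̃`, `D_q = D_y`,
accuracies `ε` and `ε₀ = ε^{5/2}`, initial point `((x⁰,y⁰), y⁰)`. -/
def params {n m l : ℕ} (P : Problem n m l) (c : Moduli) (ε : ℝ) (x₀ : Vec n) (y₀ : Vec m) :
    MinimaxParams (Pt n m) (Vec m) where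
  L := P.Ltilde c ε
  D := P.Dy
  eps := ε
  eps₀ := ε ^ (5 / 2 : ℝ)
  xinit := pt x₀ y₀
  yinit := y₀

/-- The penalty method with `ρ = ε⁻¹`, `μ = ε⁻²`: configuration and oracle calls after `j` steps. -/
def penaltyRun {n m l : ℕ} (P : Problem n m l) (c : Moduli) (ε : ℝ) (x₀ : Vec n) (y₀ : Vec m)
    (j : ℕ) : Config (Pt n m) (Vec m) × List (Query n m) :=
  run (P.oracle ε⁻¹ (ε ^ 2)⁻¹) (P.params c ε x₀ y₀) j

/-! ### The complexity bound -/

/-- `α̃`. -/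
def αtilde {n m l : ℕ} (P : Problem n m l) (c : Moduli) (ε : ℝ) : ℝ :=
  min 1 (Real.sqrt (4 * ε / (P.Dy * P.Ltilde c ε)))

/-- `δ̃`. -/
def δtilde {n m l : ℕ} (P : Problem n m l) (c : Moduli) (ε : ℝ) : ℝ :=
  (2 + (P.αtilde c ε)⁻¹) * (P.Dx ^ 2 + P.Dy ^ 2) * P.Ltilde c ε +
    max (ε / P.Dy) (P.αtilde c ε * P.Ltilde c ε / 4) * P.Dy ^ 2

/-- `C̃`. -/
def Ctilde {n m l : ℕ} (P : Problem n m l) (c : Moduli) (ε : ℝ) : ℝ :=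
  4 * max (1 / (2 * P.Ltilde c ε)) (min (P.Dy * ε⁻¹) (4 / (P.αtilde c ε * P.Ltilde c ε))) /
      ((((3 * P.Ltilde c ε + ε / (2 * P.Dy)) ^ 2 / min (P.Ltilde c ε) (ε / (2 * P.Dy)) +
        3 * P.Ltilde c ε + ε / (2 * P.Dy)) ^ 2)⁻¹ * ε ^ 5) *
    (P.δtilde c ε + 2 * (P.αtilde c ε)⁻¹ *
      (P.fStar - P.fLow + 2 * ε⁻¹ * (P.ftHi - P.ftLow) + (ε ^ 3)⁻¹ * P.gtHi ^ 2 + ε * P.Dy / 4 +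
        P.Ltilde c ε * (P.Dx ^ 2 + P.Dy ^ 2)))

/-- `K̃`. -/
def Ktilde {n m l : ℕ} (P : Problem n m l) (c : Moduli) (ε : ℝ) (x₀ : Vec n) (y₀ : Vec m) : ℕ :=
  ⌈32 * (1 + P.fR (pt x₀ y₀) - P.fLow + ε * P.Dy / 4) * P.Ltilde c ε * (ε ^ 2)⁻¹ +
    32 * ε ^ 3 * (1 + 4 * P.Dy ^ 2 * P.Ltilde c ε ^ 2 * (ε ^ 2)⁻¹) - 1⌉₊

/-- `Ñ`. -/
def Ntilde {n m l : ℕ} (P : Problem n m l) (c : Moduli) (ε : ℝ) (x₀ : Vec n) (y₀ : Vec m) : ℝ :=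
  ((⌈96 * Real.sqrt 2 *
      (1 + (24 * P.Ltilde c ε + 4 * ε / P.Dy) * (P.Ltilde c ε)⁻¹)⌉₊ : ℝ) + 2) *
    max 2 (Real.sqrt (P.Dy * P.Ltilde c ε * ε⁻¹)) *
    (((P.Ktilde c ε x₀ y₀ : ℝ) + 1) * max (Real.log (P.Ctilde c ε)) 0 +
      (P.Ktilde c ε x₀ y₀ : ℝ) + 1 +
      2 * (P.Ktilde c ε x₀ y₀ : ℝ) * Real.log ((P.Ktilde c ε x₀ y₀ : ℝ) + 1))

/-- The bound on `|f̃(x_ε,y_ε) - f̃*(x_ε)|`. -/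
def valueGap {n m l : ℕ} (P : Problem n m l) (c : Moduli) (ε : ℝ) (x₀ : Vec n) (y₀ : Vec m) : ℝ :=
  max
    (ε * (1 + P.fR (pt x₀ y₀) - P.fLow +
      2 * ε ^ 5 * ((P.Ltilde c ε)⁻¹ + 4 * P.Dy ^ 2 * P.Ltilde c ε * (ε ^ 2)⁻¹) + P.Dy * ε / 4))
    (ε ^ 2 * (c.G ^ 2)⁻¹ * P.Dy ^ 2 * c.Lft * (ε ^ 2 + ε * c.Lf + c.Lft) / 2)

/-! ### Stationarity residual sets -/

/-- `∂f(x,y) + ρ ∂f̃(x,y) - ρ (∇ₓf̃(x,z) + ∇ₓg̃(x,z) λ̃; 0) + ∇g̃(x,y) λ̂`; as `f̃₂` does not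
depend on `x`, `∇ₓf̃ = ∇ₓf̃₁`. -/
def statSetXY {n m l : ℕ} (P : Problem n m l) (ρ : ℝ) (x : Vec n) (y z : Vec m)
    (lt lh : Vec l) : Set (Pt n m) :=
  subdiff P.f (pt x y) + ρ • subdiff P.ft (pt x y) +
    {-(ρ • pt ((gradient P.ft₁ (pt x z)).fst + (P.gradgtMul (pt x z) lt).fst) 0) +
      P.gradgtMul (pt x y) lh}

/-- `ρ (∂_z f̃(x,z) + ∇_z g̃(x,z) λ̃)`. -/
def statSetZ {n m l : ℕ} (P : Problem n m l) (ρ : ℝ) (x : Vec n) (z : Vec m) (lt : Vec l) :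
    Set (Vec m) :=
  ρ • (subdiff (fun z' => P.ft (pt x z')) z + {(P.gradgtMul (pt x z) lt).snd})

end Problem

end BilevelPenalty

end

/-!
The penalty method applies a first-order minimax solver to
`min_{x,y} max_z f(x,y) + ρ (P̃_μ(x,y) - P̃_μ(x,z))`, where `P̃_μ = f̃ + μ ‖[g̃]₊‖²` penalizes the
lower level constraint. The proof splits into an analysis of the solver on an abstract minimax problem
and a translation of approximate stationarity of that problem into the optimality conditions of the
bilevel problem.

*Solver.* The objective `h + p - q` is `L`-weakly convex in the first block, concave in the second,
and has an `L`-Lipschitz gradient field. Subtracting `ε ‖y - y⁰‖² / (4D)` and adding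
`L ‖x - x^k‖²` makes it strongly convex and strongly concave.

* The innermost loop is an anchored (Halpern type) extragradient iteration for a strongly monotone
  inclusion; `anchored_step` and `anchored_residual_le` give a residual of order `1 / t`, so that the
  loop guard fails after at most `30 κ` steps, where `κ` is the condition number `MinimaxParams.κ`; it
  stays bounded since `σ_x = L` is comparable to the Lipschitz modulus.
* The middle loop is an accelerated dual proximal point iteration. `accelerated_block` and
  `accelerated_step` show that a quadratic potential centred at the saddle point contracts by the
  factor `1 - ᾱ / 2`; `MidInv.step` records this for the algorithm, and `residual_le` converts the
  potential into the residual of the termination test. Hence `mid_loop` gives a linear rate with a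
  logarithmic number of iterations.
* The outer loop is an inexact proximal point method for the primal function
  `x ↦ max_y (h - ε ‖y - y⁰‖² / (4D) + p - q)`. While it does not stop, `ApproxSaddle.descent` makes
  the primal function decrease by a fixed amount, up to summable errors, so that
  `minimax_method_terminates` bounds the number of outer iterations.

*Translation.* `Problem.minimax_regular` verifies the hypotheses on the solver, with modulus `L̃`:
weak convexity follows from the Lipschitz gradient by a Taylor bound, concavity from convexity of
`f̃₁(x,·)` and `‖[g̃(x,·)]₊‖²`. In `Problem.minimax_bounds` the upper value of the minimax objective
is bounded by the optimal value of the bilevel problem, since the penalty terms cancel up to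
`f̃_hi - f̃_low` at bilevel feasible points. At the output, the residuals are elements of the
stationarity sets because a gradient plus a convex subgradient is a subgradient
(`gradient_add_mem_subdiff`). The multipliers `2μ [g̃]₊` are bounded by moving towards the Slater
point (`Problem.posPart_gt_le`), which gives feasibility and complementarity; and the lower level gap
is bounded above by the primal function value and below by moving to a feasible point
(`Problem.ftStar_le_add`).

The orders of the bounds are read off their formulas by a calculus of polynomial orders in `ε⁻¹`
(`Problem.OrderLE`), with `L̃ = O(ε⁻³)` and `L̃⁻¹ = O(1)`.
-/

set_option linter.unusedSectionVars false

noncomputable section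

namespace BilevelPenalty

/-! ### Monotone inclusions in a Hilbert space -/

section Hilbert

variable {E : Type*} [NormedAddCommGroup E] [InnerProductSpace ℝ E]

/-- `b` is a subgradient at `u ∈ S` of the convex function that equals `φ` on `S` and `∞` off `S`. -/
def IsSubgrad (S : Set E) (φ : E → ℝ) (u b : E) : Prop :=
  u ∈ S ∧ ∀ x ∈ S, φ u + inner ℝ b (x - u) ≤ φ x

theorem IsSubgrad.mono {S : Set E} {φ : E → ℝ} {u b u' b' : E} (h : IsSubgrad S φ u b)
    (h' : IsSubgrad S φ u' b') : 0 ≤ inner ℝ (b - b') (u - u') := by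
  have h1 := h.2 u' h'.1
  have h2 := h'.2 u h.1
  rw [inner_sub_left]
  have : inner ℝ b (u' - u) = - inner ℝ b (u - u') := by rw [← inner_neg_right, neg_sub]
  linarith

/-- A resolvent is nonexpansive, in the squared form. -/
theorem IsSubgrad.norm_sub_le {S : Set E} {φ : E → ℝ} {s : ℝ} (hs : 0 < s) {u u' v v' : E}
    (h : IsSubgrad S φ u (s⁻¹ • (v - u))) (h' : IsSubgrad S φ u' (s⁻¹ • (v' - u'))) :
    ‖u - u'‖ ≤ ‖v - v'‖ := by
  have h1 := h.mono h'
  rw [← smul_sub, inner_smul_left] at h1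
  have h2 : 0 ≤ inner ℝ (v - u - (v' - u')) (u - u') := by
    have : 0 < s⁻¹ := inv_pos.2 hs
    exact nonneg_of_mul_nonneg_right (by simpa using h1) this
  have h3 : v - u - (v' - u') = (v - v') - (u - u') := by abel
  rw [h3, inner_sub_left, real_inner_self_eq_norm_sq] at h2
  have h4 := real_inner_le_norm (v - v') (u - u')
  by_contra! h5
  nlinarith [norm_nonneg (v - v'), norm_nonneg (u - u')]

/-- One step of the anchored extragradient method does not increase the potential
`s (t + 1) (t + 2)² ‖r‖² / 4 + (t + 1) (t + 2) ⟪r, u - u₀⟫`; here `r`, `r'` are the residuals at `u`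
and at the new point `u'`, and `w` is the residual used for the step. -/
theorem anchored_step {s t : ℝ} (hs : 0 < s) (ht : 0 ≤ t) {u u₀ r w r' u' : E}
    (hu' : u' = u + (2 / (t + 3)) • (u₀ - u) - s • w)
    (hmono : 0 ≤ inner ℝ (r' - r) (u' - u))
    (hlip : ‖r' - w‖ ^ 2 ≤ 1 / 20 * ‖w - r‖ ^ 2) :
    s * (t + 2) * (t + 3) ^ 2 / 4 * ‖r'‖ ^ 2 + (t + 2) * (t + 3) * inner ℝ r' (u' - u₀) ≤
      s * (t + 1) * (t + 2) ^ 2 / 4 * ‖r‖ ^ 2 + (t + 1) * (t + 2) * inner ℝ r (u - u₀) := by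
  obtain ⟨d, rfl⟩ : ∃ d, u = u₀ + d := ⟨u - u₀, by abel⟩
  have e1 : u' - (u₀ + d) = -((2 / (t + 3)) • d) - s • w := by
    rw [hu', show u₀ - (u₀ + d) = -d by abel, smul_neg]; abel
  have e2 : u' - u₀ = d - (2 / (t + 3)) • d - s • w := by
    rw [hu', show u₀ - (u₀ + d) = -d by abel, smul_neg]; abel
  have hsq := sq_nonneg ‖(19 * (t + 3)) • w - (19 * t + 17) • r‖
  rw [e1] at hmono
  rw [e2, show u₀ + d - u₀ = d by abel]
  rw [@norm_sub_sq_real, @norm_sub_sq_real] at hlip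
  rw [@norm_sub_sq_real, norm_smul, norm_smul, mul_pow, mul_pow, Real.norm_eq_abs,
    Real.norm_eq_abs, sq_abs, sq_abs] at hsq
  simp only [inner_sub_left, inner_sub_right, inner_neg_right, real_inner_smul_right,
    real_inner_smul_left] at hmono hsq ⊢
  rw [real_inner_comm w r] at *
  have h3 : 0 < t + 3 := by linarith
  set rd := inner ℝ r d
  set rd' := inner ℝ r' d
  set rw' := inner ℝ r' w
  set rw0 := inner ℝ r w
  have hm := mul_nonneg (by positivity : 0 ≤ (t + 1) * (t + 2) * (t + 3) / 2) hmono
  have hl := mul_nonneg (by positivity : 0 ≤ s * (t + 2) * (t + 3) ^ 2 / 4) (sub_nonneg.2 hlip)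
  have hq := mul_nonneg (by positivity : 0 ≤ s * (t + 2) / 1520) hsq
  have hr : 0 ≤ s / 4 * (t + 2) * (t + 15 / 19) * ‖r‖ ^ 2 := by positivity
  refine sub_nonneg.1 (le_of_le_of_eq (add_nonneg (add_nonneg hm hl) (add_nonneg hq hr)) ?_)
  field_simp
  ring

/-- The potential of the anchored method keeps the residual of size `O(1 / t)`; as soon as
`t + 1 ≥ 6.7 / ζ`, the residual `ρ` (scaled so that the operator is strongly monotone with
modulus `1`) is dominated by the distance to the starting point `um` of the proximal step. The factor
`1.225` bounds `1 + 1 / (2 √5)`, the Lipschitz modulus of a forward step. -/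
theorem anchored_residual_le {ζ t : ℝ} (hζ : 0 < ζ) (hζ' : ζ ≤ 1 / 100) (ht : 6.7 ≤ ζ * (t + 1))
    {u u₀ um us ρ ρ₀ : E}
    (hpot : ζ * (t + 1) * (t + 2) ^ 2 / 4 * ‖ρ‖ ^ 2 + (t + 1) * (t + 2) * inner ℝ ρ (u - u₀) ≤
      ζ * ‖ρ₀‖ ^ 2)
    (h₀ : ‖u₀ - us‖ ≤ 1.225 * ‖um - us‖) (hρ₀ : ζ * ‖ρ₀‖ ≤ 1.225 * ‖um - u₀‖)
    (hmono : ‖u - us‖ ^ 2 ≤ inner ℝ ρ (u - us)) :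
    ‖ρ‖ ≤ ‖u - um‖ := by
  by_contra! hlt
  set R := ‖um - us‖
  set e := ‖u - us‖
  set x := ‖ρ‖
  have he : 0 ≤ e := norm_nonneg _
  have hR0 : 0 ≤ R := norm_nonneg _
  have hx : 0 < x := lt_of_le_of_lt (norm_nonneg _) hlt
  have hR : R ≤ e + x := by
    have := norm_sub_le_norm_sub_add_norm_sub um u us
    rw [norm_sub_rev um u] at this
    linarith
  have hex : e ≤ x := by
    have := real_inner_le_norm ρ (u - us)
    by_contra! h
    nlinarith
  have hu0 : ‖um - u₀‖ ≤ 2.225 * R := by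
    have := norm_sub_le_norm_sub_add_norm_sub um us u₀
    rw [norm_sub_rev us u₀] at this
    linarith
  have hq : e ^ 2 - x * (1.225 * R) ≤ inner ℝ ρ (u - u₀) := by
    have h1 : u - u₀ = (u - us) - (u₀ - us) := by abel
    have h2 := real_inner_le_norm ρ (u₀ - us)
    have h3 : x * ‖u₀ - us‖ ≤ x * (1.225 * R) := by gcongr
    rw [h1, inner_sub_right]; linarith
  have ht1 : 0 < t + 1 := by
    by_contra! h
    nlinarith
  have hρ2 : (ζ * ‖ρ₀‖) ^ 2 ≤ 7.43 * R ^ 2 := by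
    have : ζ * ‖ρ₀‖ ≤ 2.7257 * R := by linarith
    calc (ζ * ‖ρ₀‖) ^ 2 ≤ (2.7257 * R) ^ 2 := by gcongr
      _ = 2.7257 ^ 2 * R ^ 2 := by ring
      _ ≤ 7.43 * R ^ 2 := by gcongr; norm_num
  have ht2 : 0 < t + 2 := by linarith
  -- divide the potential inequality by `(t + 1) (t + 2)`
  have hζt : (44.89 : ℝ) ≤ (ζ * (t + 1)) * (ζ * (t + 2)) := by
    calc (44.89 : ℝ) = 6.7 * 6.7 := by norm_num
      _ ≤ (ζ * (t + 1)) * (ζ * (t + 2)) := by gcongr; linarith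
  have hlast : ζ * ‖ρ₀‖ ^ 2 ≤ (t + 1) * (t + 2) * (0.0017 * R ^ 2) := by
    have h1 : ζ * (ζ * ‖ρ₀‖ ^ 2) ≤ 7.43 * R ^ 2 := by linarith [hρ2, mul_pow ζ ‖ρ₀‖ 2]
    have h2 : 7.43 * R ^ 2 ≤ ζ * ((t + 1) * (t + 2) * (0.0017 * R ^ 2)) := by
      have h3 : ζ * (44.89) ≤ ζ * ((ζ * (t + 1)) * (ζ * (t + 2))) := by gcongr
      have h4 : (4489 : ℝ) ≤ ζ * ((t + 1) * (t + 2)) := by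
        have h5 : 0 < ζ * ((t + 1) * (t + 2)) := by positivity
        have : ζ * (ζ * ((t + 1) * (t + 2))) ≤ 1 / 100 * (ζ * ((t + 1) * (t + 2))) := by gcongr
        linarith
      calc 7.43 * R ^ 2 ≤ 4489 * (0.0017 * R ^ 2) := by linarith [sq_nonneg R]
        _ ≤ ζ * ((t + 1) * (t + 2)) * (0.0017 * R ^ 2) := by gcongr
        _ = ζ * ((t + 1) * (t + 2) * (0.0017 * R ^ 2)) := by ring
    exact le_of_mul_le_mul_left (h1.trans h2) hζ
  have hmain : ζ * (t + 2) / 4 * x ^ 2 + (e ^ 2 - x * (1.225 * R)) ≤ 0.0017 * R ^ 2 := by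
    have h1 : (t + 1) * (t + 2) * (ζ * (t + 2) / 4 * x ^ 2 + (e ^ 2 - x * (1.225 * R))) ≤
        (t + 1) * (t + 2) * (0.0017 * R ^ 2) := by
      have h2 : (t + 1) * (t + 2) * (e ^ 2 - x * (1.225 * R)) ≤
          (t + 1) * (t + 2) * inner ℝ ρ (u - u₀) := by gcongr
      have h3 : (t + 1) * (t + 2) * (ζ * (t + 2) / 4 * x ^ 2) =
          ζ * (t + 1) * (t + 2) ^ 2 / 4 * x ^ 2 := by ring
      linarith [mul_add ((t + 1) * (t + 2)) (ζ * (t + 2) / 4 * x ^ 2) (e ^ 2 - x * (1.225 * R))]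
    exact le_of_mul_le_mul_left h1 (by positivity)
  have h7 : 1.675 * x ^ 2 ≤ ζ * (t + 2) / 4 * x ^ 2 := by
    gcongr; linarith
  have h8 : R ^ 2 ≤ 4 * x ^ 2 := by
    calc R ^ 2 ≤ (2 * x) ^ 2 := by gcongr; linarith
      _ = 4 * x ^ 2 := by ring
  have h9 : x * R ≤ x * (e + x) := by gcongr
  -- `6.7 / 4 = 1.675` exceeds the `1.225 + 0.6125 ^ 2 + 4 * 0.0017` needed to complete the square
  nlinarith [sq_nonneg (e - 0.6125 * x)]

/-- A strongly monotone Lipschitz operator plus the subdifferential of a convex function with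
everywhere defined resolvents has a zero, by Banach's fixed point theorem. -/
theorem exists_zero_of_stronglyMonotone {S : Set E} (hS : IsComplete S) (hne : S.Nonempty)
    {φ : E → ℝ} {J : ℝ → E → E}
    (hJ : ∀ s > 0, ∀ v, IsSubgrad S φ (J s v) (s⁻¹ • (v - J s v)))
    {F : E → E} {m ℓ : ℝ} (hm : 0 < m) (hℓ : 0 < ℓ)
    (hmono : ∀ u ∈ S, ∀ u' ∈ S, m * ‖u - u'‖ ^ 2 ≤ inner ℝ (F u - F u') (u - u'))
    (hlip : ∀ u ∈ S, ∀ u' ∈ S, ‖F u - F u'‖ ≤ ℓ * ‖u - u'‖) :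
    ∃ u, IsSubgrad S φ u (-F u) := by
  set s : ℝ := m / (ℓ ^ 2 + m ^ 2) with hs
  have hs0 : 0 < s := by positivity
  set T : E → E := fun u => J s (u - s • F u) with hT
  have hmaps : Set.MapsTo T S S := fun u _ => (hJ s hs0 _).1
  set k : ℝ := Real.sqrt (1 - s * m) with hk
  have hsm : 0 < s * m := by positivity
  have hsm1 : s * m ≤ 1 := by
    rw [hs, div_mul_eq_mul_div, div_le_one (by positivity)]; nlinarith [sq_nonneg ℓ]
  have hk1 : k < 1 := by
    rw [hk, Real.sqrt_lt' one_pos]; linarith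
  have hTl : ∀ u ∈ S, ∀ u' ∈ S, ‖T u - T u'‖ ≤ k * ‖u - u'‖ := by
    intro u hu u' hu'
    refine ((hJ s hs0 _).norm_sub_le hs0 (hJ s hs0 _)).trans ?_
    refine le_of_sq_le_sq ?_ (by positivity)
    rw [show u - s • F u - (u' - s • F u') = (u - u') - s • (F u - F u') by
      rw [smul_sub]; abel, @norm_sub_sq_real, norm_smul, mul_pow, mul_pow, hk,
      Real.sq_sqrt (by linarith), real_inner_smul_right, real_inner_comm, Real.norm_eq_abs,
      sq_abs]
    have h1 := hmono u hu u' hu'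
    have h2 : ‖F u - F u'‖ ^ 2 ≤ ℓ ^ 2 * ‖u - u'‖ ^ 2 := by
      rw [← mul_pow]; exact pow_le_pow_left₀ (norm_nonneg _) (hlip u hu u' hu') 2
    have h3 : s * ℓ ^ 2 ≤ m := by
      rw [hs, div_mul_eq_mul_div, div_le_iff₀ (by positivity)]; nlinarith [pow_pos hm 3]
    have h4 : s ^ 2 * ‖F u - F u'‖ ^ 2 ≤ s * m * ‖u - u'‖ ^ 2 :=
      calc s ^ 2 * ‖F u - F u'‖ ^ 2 ≤ s ^ 2 * (ℓ ^ 2 * ‖u - u'‖ ^ 2) := by gcongr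
        _ = s * (s * ℓ ^ 2) * ‖u - u'‖ ^ 2 := by ring
        _ ≤ s * m * ‖u - u'‖ ^ 2 := by gcongr
    have h5 := mul_le_mul_of_nonneg_left h1 hs0.le
    nlinarith
  have hc : ContractingWith ⟨k, Real.sqrt_nonneg _⟩ (hmaps.restrict T S S) := by
    refine ⟨by exact_mod_cast hk1, LipschitzWith.of_dist_le_mul fun u u' => ?_⟩
    have := hTl u u.2 u' u'.2
    rw [← dist_eq_norm, ← dist_eq_norm] at this
    exact this
  obtain ⟨x, hx⟩ := hne
  obtain ⟨u, -, hu, -⟩ := hc.exists_fixedPoint' hS hmaps hx (edist_ne_top _ _)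
  refine ⟨u, ?_⟩
  have h1 := hJ s hs0 (u - s • F u)
  have h2 : J s (u - s • F u) = u := hu
  rw [h2, show u - s • F u - u = -(s • F u) by abel, smul_neg, inv_smul_smul₀ hs0.ne'] at h1
  exact h1

end Hilbert

/-! ### One step of the accelerated proximal point method -/

section Accelerated

variable {V W : Type*} [NormedAddCommGroup V] [InnerProductSpace ℝ V]
  [NormedAddCommGroup W] [InnerProductSpace ℝ W]

/-- The distance part of the potential of the accelerated method, in one block of variables: `zg` is
the extrapolated point, `Z` the result of the proximal step and `g` a gradient at `Z`. -/
theorem accelerated_block {η τ α : ℝ} (hη : 0 < η) (hτ : 0 < τ) (hητ : η * τ ≤ 1 / 2) (hα : 0 < α)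
    {z zf Z g zs z' zg : V} (hz' : z' = z + (η * τ) • (Z - z) - η • g)
    (hzg : zg = α • z + (1 - α) • zf) :
    η⁻¹ * ‖z' - zs‖ ^ 2 ≤ (η⁻¹ - τ) * ‖z - zs‖ ^ 2 + τ * ‖Z - zs‖ ^ 2 - 2 * inner ℝ g (Z - zs)
      - 2 * ((1 - α) / α) * inner ℝ g (Z - zf) + 2 / α * inner ℝ g (Z - zg)
      + 2 * η * ‖g‖ ^ 2 := by
  -- translate everything by `zs`
  obtain ⟨a, rfl⟩ : ∃ a, z = zs + a := ⟨z - zs, by abel⟩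
  obtain ⟨b, rfl⟩ : ∃ b, Z = zs + a + b := ⟨Z - (zs + a), by abel⟩
  obtain ⟨f, rfl⟩ : ∃ f, zf = zs + a + f := ⟨zf - (zs + a), by abel⟩
  have e1 : z' - zs = a + ((η * τ) • b - η • g) := by
    rw [hz', show zs + a + b - (zs + a) = b by abel]; abel
  have e2 : zs + a + b - zg = b - (1 - α) • f := by
    rw [hzg]; module
  rw [e1, e2, show zs + a - zs = a by abel, show zs + a + b - zs = a + b by abel,
    show zs + a + b - (zs + a + f) = b - f by abel, norm_add_sq_real a,
    norm_sub_sq_real ((η * τ) • b), norm_add_sq_real a b]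
  have hs : 0 ≤ ‖(η * τ) • b + η • g‖ ^ 2 := sq_nonneg _
  rw [@norm_add_sq_real] at hs
  simp only [inner_add_right, inner_sub_right, real_inner_smul_right,
    real_inner_smul_left, norm_smul, Real.norm_eq_abs, mul_pow, sq_abs] at hs ⊢
  rw [real_inner_comm g b, real_inner_comm g a] at *
  set ga := inner ℝ g a
  set gb := inner ℝ g b
  set gf := inner ℝ g f
  set ab := inner ℝ a b
  have h1 : 0 ≤ (1 - 2 * (η * τ)) * (τ * ‖b‖ ^ 2) := by
    have : 0 ≤ 1 - 2 * (η * τ) := by linarith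
    positivity
  have h2 := mul_nonneg (inv_pos.2 hη).le hs
  refine sub_nonneg.1 (le_of_le_of_eq (add_nonneg h1 h2) ?_)
  field_simp
  ring

/-- Contraction of the potential of the accelerated method by the factor `1 - α / 2`. Here
`gz = Xf + σ⁻¹ Z` and `gy` are the partial gradients of the convex function `Φ` at `(Z, Yf)`, and
`hstar` is the accuracy of the proximal step. -/
theorem accelerated_step {σ σy α ηy : ℝ} (hσ : 0 < σ) (hσy : 0 < σy) (hα : 0 < α) (hα1 : α ≤ 1)
    (hηy : 0 < ηy) (hηy1 : ηy * σy ≤ 1 / 2) (hηy2 : ηy * (α * σ) ≤ 4) (hηy3 : α / 2 ≤ ηy * σy)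
    {z zf Z gz zs z' zg : V} {y yf Yf gy ys y' yg : W} {Φf Φp Φs : ℝ}
    (hz' : z' = z + (σ / 2 * σ⁻¹) • (Z - z) - (σ / 2) • gz) (hzg : zg = α • z + (1 - α) • zf)
    (hy' : y' = y + (ηy * σy) • (Yf - y) - ηy • gy) (hyg : yg = α • y + (1 - α) • yf)
    (hstar : inner ℝ gz (Z - zg) + inner ℝ gy (Yf - yg) ≤
      -(σ / 2 * ‖gz‖ ^ 2) - 4 / σ * ‖gy‖ ^ 2)
    (hf : Φp + inner ℝ gz (zf - Z) + inner ℝ gy (yf - Yf) ≤ Φf)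
    (hs : Φp + inner ℝ gz (zs - Z) + inner ℝ gy (ys - Yf) + σ⁻¹ / 2 * ‖Z - zs‖ ^ 2 +
      σy / 2 * ‖Yf - ys‖ ^ 2 ≤ Φs)
    (hfs : Φs ≤ Φf) :
    2 / σ * ‖z' - zs‖ ^ 2 + ηy⁻¹ * ‖y' - ys‖ ^ 2 + 2 / α * (Φp - Φs) ≤
      (1 - α / 2) * (2 / σ * ‖z - zs‖ ^ 2 + ηy⁻¹ * ‖y - ys‖ ^ 2 + 2 / α * (Φf - Φs)) := by
  have hb1 := accelerated_block (η := σ / 2) (by positivity) (inv_pos.2 hσ)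
    (by field_simp; norm_num) hα (zs := zs) hz' hzg
  have hb2 := accelerated_block hηy hσy hηy1 hα (zs := ys) hy' hyg
  have n1 : inner ℝ gz (zs - Z) = -inner ℝ gz (Z - zs) := by rw [← inner_neg_right, neg_sub]
  have n2 : inner ℝ gz (zf - Z) = -inner ℝ gz (Z - zf) := by rw [← inner_neg_right, neg_sub]
  have n3 : inner ℝ gy (ys - Yf) = -inner ℝ gy (Yf - ys) := by rw [← inner_neg_right, neg_sub]
  have n4 : inner ℝ gy (yf - Yf) = -inner ℝ gy (Yf - yf) := by rw [← inner_neg_right, neg_sub]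
  rw [n1, n3] at hs
  rw [n2, n4] at hf
  have hc : 0 ≤ 2 * ((1 - α) / α) := by
    have : 0 ≤ 1 - α := by linarith
    positivity
  have m1 := mul_le_mul_of_nonneg_left hf hc
  have m2 := mul_le_mul_of_nonneg_left hstar (by positivity : 0 ≤ 2 / α)
  have e1 : (σ / 2)⁻¹ = 2 / σ := inv_div _ _
  rw [e1] at hb1
  -- the gradient terms are absorbed by the accuracy of the proximal step
  have g1 : 2 * (σ / 2) * ‖gz‖ ^ 2 ≤ 2 / α * (σ / 2 * ‖gz‖ ^ 2) := by
    have : 1 ≤ 1 / α := by rw [le_div_iff₀ hα]; linarith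
    calc 2 * (σ / 2) * ‖gz‖ ^ 2 = 1 * (σ * ‖gz‖ ^ 2) := by ring
      _ ≤ 1 / α * (σ * ‖gz‖ ^ 2) := by gcongr
      _ = _ := by ring
  have g2 : 2 * ηy * ‖gy‖ ^ 2 ≤ 2 / α * (4 / σ * ‖gy‖ ^ 2) := by
    have : ηy ≤ 4 / (α * σ) := by rw [le_div_iff₀ (by positivity)]; linarith
    calc 2 * ηy * ‖gy‖ ^ 2 ≤ 2 * (4 / (α * σ)) * ‖gy‖ ^ 2 := by gcongr
      _ = _ := by field_simp
  have d1 : (2 / σ - σ⁻¹) * ‖z - zs‖ ^ 2 ≤ (1 - α / 2) * (2 / σ * ‖z - zs‖ ^ 2) := by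
    have : (1 - α / 2) * (2 / σ * ‖z - zs‖ ^ 2) - (2 / σ - σ⁻¹) * ‖z - zs‖ ^ 2 =
      (1 - α) * (σ⁻¹ * ‖z - zs‖ ^ 2) := by field_simp; ring
    have h0 : 0 ≤ (1 - α) * (σ⁻¹ * ‖z - zs‖ ^ 2) := by
      have : 0 ≤ 1 - α := by linarith
      positivity
    linarith
  have d2 : (ηy⁻¹ - σy) * ‖y - ys‖ ^ 2 ≤ (1 - α / 2) * (ηy⁻¹ * ‖y - ys‖ ^ 2) := by
    have : (1 - α / 2) * (ηy⁻¹ * ‖y - ys‖ ^ 2) - (ηy⁻¹ - σy) * ‖y - ys‖ ^ 2 =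
      (ηy * σy - α / 2) * (ηy⁻¹ * ‖y - ys‖ ^ 2) := by field_simp; ring
    have h0 : 0 ≤ (ηy * σy - α / 2) * (ηy⁻¹ * ‖y - ys‖ ^ 2) := by
      have : 0 ≤ ηy * σy - α / 2 := by linarith
      positivity
    linarith
  have d3 : 2 * ((1 - α) / α) * (Φf - Φs) ≤ (1 - α / 2) * (2 / α * (Φf - Φs)) := by
    have : (1 - α / 2) * (2 / α * (Φf - Φs)) - 2 * ((1 - α) / α) * (Φf - Φs) = Φf - Φs := by
      field_simp; ring
    linarith
  have e2 : 2 / α * (Φp - Φs) = 2 * (Φp - Φs) + 2 * ((1 - α) / α) * (Φp - Φs) := by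
    field_simp; ring
  rw [e2]
  nlinarith

/-- The stopping rule of the inner loop, in terms of the gradients `gz = Xf + σ⁻¹ Z` and `gy`. -/
theorem proximal_accuracy {σ : ℝ} (hσ : 0 < σ) {zg Z Xf : V} {yg Yf gy : W}
    (h : 8 / σ * ‖Z + (σ / 2) • (Xf - σ⁻¹ • zg)‖ ^ 2 + 8 / σ * ‖gy + (σ / 8) • (Yf - yg)‖ ^ 2 ≤
      (8 / σ)⁻¹ * ‖Xf - -(σ⁻¹ • zg)‖ ^ 2 + (8 / σ)⁻¹ * ‖Yf - yg‖ ^ 2) :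
    inner ℝ (Xf + σ⁻¹ • Z) (Z - zg) + inner ℝ gy (Yf - yg) ≤
      -(σ / 2 * ‖Xf + σ⁻¹ • Z‖ ^ 2) - 4 / σ * ‖gy‖ ^ 2 := by
  obtain ⟨d, rfl⟩ : ∃ d, Z = zg + d := ⟨Z - zg, by abel⟩
  obtain ⟨e, rfl⟩ : ∃ e, Yf = yg + e := ⟨Yf - yg, by abel⟩
  obtain ⟨g, rfl⟩ : ∃ g, Xf = g - σ⁻¹ • (zg + d) := ⟨Xf + σ⁻¹ • (zg + d), by abel⟩
  have e1 : zg + d + (σ / 2) • (g - σ⁻¹ • (zg + d) - σ⁻¹ • zg) =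
      (1 / 2 : ℝ) • d + (σ / 2) • g := by
    have : σ / 2 * σ⁻¹ = 1 / 2 := by field_simp
    simp only [smul_sub, smul_smul, smul_add, this]
    module
  have e2 : g - σ⁻¹ • (zg + d) - -(σ⁻¹ • zg) = g - σ⁻¹ • d := by rw [smul_add]; abel
  rw [e1, e2, show yg + e - yg = e by abel] at h
  rw [show g - σ⁻¹ • (zg + d) + σ⁻¹ • (zg + d) = g by abel, show zg + d - zg = d by abel,
    show yg + e - yg = e by abel]
  have hs : 0 ≤ ‖(3 : ℝ) • g + (5 * σ⁻¹) • d‖ ^ 2 := sq_nonneg _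
  rw [@norm_add_sq_real, @norm_add_sq_real, @norm_sub_sq_real] at h
  rw [@norm_add_sq_real] at hs
  simp only [real_inner_smul_right, real_inner_smul_left, norm_smul, Real.norm_eq_abs, mul_pow,
    sq_abs] at h hs
  rw [real_inner_comm g d] at h
  have hs' := mul_nonneg hσ.le hs
  have hg : 0 ≤ σ * ‖g‖ ^ 2 := by positivity
  have h1 : 0 ≤ (8 / σ)⁻¹ * (‖g‖ ^ 2 - 2 * (σ⁻¹ * inner ℝ g d) + σ⁻¹ ^ 2 * ‖d‖ ^ 2) +
      (8 / σ)⁻¹ * ‖e‖ ^ 2 - _ := sub_nonneg.2 h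
  refine sub_nonneg.1 (le_of_le_of_eq (add_nonneg (mul_nonneg (by norm_num : (0 : ℝ) ≤ 1 / 2) h1)
    (add_nonneg (mul_nonneg (by norm_num : (0 : ℝ) ≤ 3 / 80) hs')
    (mul_nonneg (by norm_num : (0 : ℝ) ≤ 1 / 10) hg))) ?_)
  field_simp
  ring

end Accelerated

/-! ### The regularized minimax problems -/

section Pair

variable {V W : Type*} [NormedAddCommGroup V] [InnerProductSpace ℝ V]
  [NormedAddCommGroup W] [InnerProductSpace ℝ W]

/-- The pair `(x; y)` in the Hilbert space `V × W`. -/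
def pair (x : V) (y : W) : WithLp 2 (V × W) := WithLp.toLp 2 (x, y)

@[simp] theorem pair_fst (x : V) (y : W) : (pair x y).fst = x := rfl
@[simp] theorem pair_snd (x : V) (y : W) : (pair x y).snd = y := rfl
theorem pair_sub (x x' : V) (y y' : W) : pair x y - pair x' y' = pair (x - x') (y - y') := rfl
theorem pair_add (x x' : V) (y y' : W) : pair x y + pair x' y' = pair (x + x') (y + y') := rfl
theorem smul_pair (c : ℝ) (x : V) (y : W) : c • pair x y = pair (c • x) (c • y) := rfl

theorem norm_pair_sq (x : V) (y : W) : ‖pair x y‖ ^ 2 = ‖x‖ ^ 2 + ‖y‖ ^ 2 :=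
  WithLp.prod_norm_sq_eq_of_L2 _

theorem inner_pair (x x' : V) (y y' : W) :
    inner ℝ (pair x y) (pair x' y') = inner ℝ x x' + inner ℝ y y' :=
  WithLp.prod_inner_apply _ _

theorem norm_pair_smul_le {c d C : ℝ} (hc : 0 ≤ c) (hd : 0 ≤ d) (hcC : c ≤ C) (hdC : d ≤ C)
    (x : V) (y : W) : ‖pair (c • x) (d • y)‖ ≤ C * ‖pair x y‖ := by
  refine le_of_sq_le_sq ?_ (mul_nonneg (hc.trans hcC) (norm_nonneg _))
  rw [mul_pow, norm_pair_sq, norm_pair_sq, norm_smul, norm_smul, mul_pow, mul_pow,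
    Real.norm_eq_abs, Real.norm_eq_abs, sq_abs, sq_abs, mul_add]
  gcongr

/-- The product of two sets, in the Hilbert space `V × W`. -/
def prodSet (X : Set V) (Y : Set W) : Set (WithLp 2 (V × W)) := {u | u.fst ∈ X ∧ u.snd ∈ Y}

theorem IsSubgrad.pair {X : Set V} {Y : Set W} {p : V → ℝ} {q : W → ℝ} {x bx : V} {y bY : W}
    (hx : IsSubgrad X p x bx) (hy : IsSubgrad Y q y bY) :
    IsSubgrad (prodSet X Y) (fun u => p u.fst + q u.snd) (pair x y) (pair bx bY) := by
  refine ⟨⟨hx.1, hy.1⟩, fun u hu => ?_⟩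
  have h1 := hx.2 _ hu.1
  have h2 := hy.2 _ hu.2
  have h3 : u - BilevelPenalty.pair x y = BilevelPenalty.pair (u.fst - x) (u.snd - y) := rfl
  simp only [h3, inner_pair, pair_fst, pair_snd]
  linarith

theorem IsSubgrad.fst {X : Set V} {Y : Set W} {p : V → ℝ} {q : W → ℝ} {u b : WithLp 2 (V × W)}
    (h : IsSubgrad (prodSet X Y) (fun u => p u.fst + q u.snd) u b) :
    IsSubgrad X p u.fst b.fst := by
  refine ⟨h.1.1, fun x hx => ?_⟩
  have h1 := h.2 (BilevelPenalty.pair x u.snd) ⟨hx, h.1.2⟩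
  have h3 : BilevelPenalty.pair x u.snd - u = BilevelPenalty.pair (x - u.fst) (u.snd - u.snd) := rfl
  have h4 : b = BilevelPenalty.pair b.fst b.snd := rfl
  rw [h3, h4, inner_pair, sub_self, inner_zero_right] at h1
  simp only [pair_fst, pair_snd] at h1
  linarith

theorem IsSubgrad.snd {X : Set V} {Y : Set W} {p : V → ℝ} {q : W → ℝ} {u b : WithLp 2 (V × W)}
    (h : IsSubgrad (prodSet X Y) (fun u => p u.fst + q u.snd) u b) :
    IsSubgrad Y q u.snd b.snd := by
  refine ⟨h.1.2, fun y hy => ?_⟩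
  have h1 := h.2 (BilevelPenalty.pair u.fst y) ⟨h.1.1, hy⟩
  have h3 : BilevelPenalty.pair u.fst y - u = BilevelPenalty.pair (u.fst - u.fst) (y - u.snd) := rfl
  have h4 : b = BilevelPenalty.pair b.fst b.snd := rfl
  rw [h3, h4, inner_pair, sub_self, inner_zero_right] at h1
  simp only [pair_fst, pair_snd] at h1
  linarith

end Pair

/-- The data of a minimax problem `min_x max_y h(x,y) + p(x) - q(y)`: the domains `X`, `Y` of `p`,
`q`, the real values of `p`, `q` there, the partial gradients of `h`, the proximal maps of `p`, `q`,
and a set `Ω` of points at which the gradient is known to be Lipschitz. -/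
structure MinimaxProblem (V W : Type) where
  X : Set V
  Y : Set W
  p : V → ℝ
  q : W → ℝ
  h : V → W → ℝ
  gx : V → W → V
  gy : V → W → W
  proxP : ℝ → V → V
  proxQ : ℝ → W → W
  Ω : Set (WithLp 2 (V × W))

section Problem

variable {V W : Type} [NormedAddCommGroup V] [InnerProductSpace ℝ V]
  [NormedAddCommGroup W] [InnerProductSpace ℝ W]

/-- Nonconvex-concave minimax problems with `L`-Lipschitz gradients: `h` is `L`-weakly convex in `x`
and concave in `y` on the domain, and the proximal maps satisfy their optimality conditions. -/
structure MinimaxProblem.Regular (M : MinimaxProblem V W) (L : ℝ) : Prop where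
  complete : IsComplete (prodSet M.X M.Y)
  subset : prodSet M.X M.Y ⊆ M.Ω
  proxP : ∀ s > 0, ∀ v, IsSubgrad M.X M.p (M.proxP s v) (s⁻¹ • (v - M.proxP s v))
  proxQ : ∀ s > 0, ∀ v, IsSubgrad M.Y M.q (M.proxQ s v) (s⁻¹ • (v - M.proxQ s v))
  weakConvex : ∀ x ∈ M.X, ∀ x' ∈ M.X, ∀ y ∈ M.Y,
    M.h x y + inner ℝ (M.gx x y) (x' - x) - L / 2 * ‖x' - x‖ ^ 2 ≤ M.h x' y
  concave : ∀ x ∈ M.X, ∀ y ∈ M.Y, ∀ y' ∈ M.Y, M.h x y' ≤ M.h x y + inner ℝ (M.gy x y) (y' - y)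
  lipschitz : ∀ u ∈ M.Ω, ∀ u' ∈ M.Ω,
    ‖pair (M.gx u.fst u.snd) (-M.gy u.fst u.snd) -
      pair (M.gx u'.fst u'.snd) (-M.gy u'.fst u'.snd)‖ ≤ L * ‖u - u'‖

/-- The parameters of the method are positive. -/
structure MinimaxParams.Positive (A : MinimaxParams V W) : Prop where
  L : 0 < A.L
  D : 0 < A.D
  eps : 0 < A.eps
  eps₀ : 0 < A.eps₀

namespace MinimaxProblem

variable (M : MinimaxProblem V W) (A : MinimaxParams V W) (o : OuterState V W)

/-- The partial gradient in `x` of `h_k`. -/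
def gbX (x : V) (y : W) : V := M.gx x y + (2 * A.L) • (x - o.x)

/-- The partial gradient in `y` of `h_k`. -/
def gbY (x : V) (y : W) : W := M.gy x y - (A.eps / (2 * A.D)) • (y - A.yinit)

/-- The objective `h_k + p - q` of the regularized minimax problem. -/
def Hbar (x : V) (y : W) : ℝ :=
  M.h x y - A.eps / (4 * A.D) * ‖y - A.yinit‖ ^ 2 + A.L * ‖x - o.x‖ ^ 2 + M.p x - M.q y

/-- The objective `h - ε ‖y - y⁰‖² / (4 D) + p - q` of the perturbed minimax problem. -/
def Heps (x : V) (y : W) : ℝ :=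
  M.h x y - A.eps / (4 * A.D) * ‖y - A.yinit‖ ^ 2 + M.p x - M.q y

/-- The operator `(∇ₓ h_k, -∇_y h_k)`. -/
def opB (u : WithLp 2 (V × W)) : WithLp 2 (V × W) :=
  pair (M.gbX A o u.fst u.snd) (-M.gbY A u.fst u.snd)

/-- The operator `(a_x, a_y)` of the proximal subproblem centred at `(zg, yg)`. -/
def opA (zg : V) (yg : W) (u : WithLp 2 (V × W)) : WithLp 2 (V × W) :=
  pair (aX A zg u.fst (M.gbX A o u.fst u.snd - A.σx • u.fst))
    (aY A yg u.snd (M.gbY A u.fst u.snd + A.σy • u.snd))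

variable {M A o}

theorem Hbar_convex (hM : M.Regular A.L) {x x' bx : V} {y : W} (hx : IsSubgrad M.X M.p x bx)
    (hx' : x' ∈ M.X) (hy : y ∈ M.Y) :
    M.Hbar A o x y + inner ℝ (bx + M.gbX A o x y) (x' - x) + A.L / 2 * ‖x' - x‖ ^ 2 ≤
      M.Hbar A o x' y := by
  have h1 := hM.weakConvex x hx.1 x' hx' y hy
  have h2 := hx.2 x' hx'
  have h3 : ‖x' - o.x‖ ^ 2 =
      ‖x' - x‖ ^ 2 + 2 * inner ℝ (x - o.x) (x' - x) + ‖x - o.x‖ ^ 2 := by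
    rw [show x' - o.x = (x' - x) + (x - o.x) by abel, norm_add_sq_real, real_inner_comm]
  simp only [Hbar, gbX, inner_add_left, real_inner_smul_left, h3]
  linarith

theorem Hbar_concave (hM : M.Regular A.L) (hA : A.Positive) {x : V} {y y' bY : W} (hx : x ∈ M.X)
    (hy : IsSubgrad M.Y M.q y bY) (hy' : y' ∈ M.Y) :
    M.Hbar A o x y' ≤ M.Hbar A o x y - inner ℝ (bY - M.gbY A x y) (y' - y) -
      A.σy / 2 * ‖y' - y‖ ^ 2 := by
  have h1 := hM.concave x hx y hy.1 y' hy'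
  have h2 := hy.2 y' hy'
  have h3 : ‖y' - A.yinit‖ ^ 2 =
      ‖y' - y‖ ^ 2 + 2 * inner ℝ (y - A.yinit) (y' - y) + ‖y - A.yinit‖ ^ 2 := by
    rw [show y' - A.yinit = (y' - y) + (y - A.yinit) by abel, norm_add_sq_real, real_inner_comm]
  have h4 : A.eps / (4 * A.D) = A.σy / 2 := by
    have := hA.D.ne'
    rw [MinimaxParams.σy]; field_simp; norm_num
  have h5 : A.eps / (2 * A.D) = A.σy := rfl
  simp only [Hbar, gbY, inner_sub_left, real_inner_smul_left, h3, h4, h5]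
  linarith

theorem opB_monotone (hM : M.Regular A.L) (u u' : WithLp 2 (V × W))
    (hu : u ∈ prodSet M.X M.Y) (hu' : u' ∈ prodSet M.X M.Y) :
    A.L * ‖u.fst - u'.fst‖ ^ 2 + A.σy * ‖u.snd - u'.snd‖ ^ 2 ≤
      inner ℝ (M.opB A o u - M.opB A o u') (u - u') := by
  have h1 := hM.weakConvex _ hu.1 _ hu'.1 _ hu.2
  have h2 := hM.weakConvex _ hu'.1 _ hu.1 _ hu'.2
  have h3 := hM.concave _ hu.1 _ hu.2 _ hu'.2
  have h4 := hM.concave _ hu'.1 _ hu'.2 _ hu.2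
  have e : u - u' = pair (u.fst - u'.fst) (u.snd - u'.snd) := rfl
  rw [opB, opB, pair_sub, e, inner_pair]
  rw [show u'.fst - u.fst = -(u.fst - u'.fst) by abel, inner_neg_right, norm_neg] at h1
  rw [show u'.snd - u.snd = -(u.snd - u'.snd) by abel, inner_neg_right] at h3
  have e1 : M.gbX A o u.fst u.snd - M.gbX A o u'.fst u'.snd =
      M.gx u.fst u.snd - M.gx u'.fst u'.snd + (2 * A.L) • (u.fst - u'.fst) := by
    simp only [gbX]; module
  have e2 : -M.gbY A u.fst u.snd - -M.gbY A u'.fst u'.snd =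
      M.gy u'.fst u'.snd - M.gy u.fst u.snd + A.σy • (u.snd - u'.snd) := by
    simp only [gbY, MinimaxParams.σy]; module
  rw [e1, e2]
  simp only [inner_add_left, inner_sub_left (M.gx _ _), inner_sub_left (M.gy _ _),
    real_inner_smul_left, real_inner_self_eq_norm_sq]
  linarith

theorem opB_sub_le (hM : M.Regular A.L) (hA : A.Positive) (u u' : WithLp 2 (V × W))
    (hu : u ∈ M.Ω) (hu' : u' ∈ M.Ω) :
    ‖M.opB A o u - M.opB A o u'‖ ≤ A.Lbar * ‖u - u'‖ := by
  have hσ : 0 ≤ A.σy := by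
    have := hA.D; have := hA.eps
    rw [MinimaxParams.σy]; positivity
  have hL := hA.L.le
  have e : M.opB A o u - M.opB A o u' =
      (pair (M.gx u.fst u.snd) (-M.gy u.fst u.snd) -
        pair (M.gx u'.fst u'.snd) (-M.gy u'.fst u'.snd)) +
      pair ((2 * A.L) • (u.fst - u'.fst)) (A.σy • (u.snd - u'.snd)) := by
    simp only [opB, pair_sub, pair_add, gbX, gbY, MinimaxParams.σy]
    congr 1 <;> module
  rw [e]
  have h1 := hM.lipschitz u hu u' hu'
  have h2 := norm_pair_smul_le (C := 2 * A.L + A.σy) (by positivity : 0 ≤ 2 * A.L) hσ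
    (by linarith) (by linarith) (u.fst - u'.fst) (u.snd - u'.snd)
  have h3 : ‖pair (u.fst - u'.fst) (u.snd - u'.snd)‖ = ‖u - u'‖ := rfl
  rw [h3] at h2
  refine (norm_add_le _ _).trans ((add_le_add h1 h2).trans (le_of_eq ?_))
  rw [MinimaxParams.Lbar, MinimaxParams.σy]; ring

theorem opA_sub (zg : V) (yg : W) (u u' : WithLp 2 (V × W)) :
    M.opA A o zg yg u - M.opA A o zg yg u' = M.opB A o u - M.opB A o u' +
      pair (-(A.L / 2) • (u.fst - u'.fst)) ((A.L / 8) • (u.snd - u'.snd)) := by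
  simp only [opA, opB, pair_sub, pair_add, aX, aY, MinimaxParams.σx]
  congr 1 <;> module

theorem opA_monotone (hM : M.Regular A.L) (hA : A.Positive) (zg : V) (yg : W)
    (u u' : WithLp 2 (V × W)) (hu : u ∈ prodSet M.X M.Y) (hu' : u' ∈ prodSet M.X M.Y) :
    A.L / 8 * ‖u - u'‖ ^ 2 ≤ inner ℝ (M.opA A o zg yg u - M.opA A o zg yg u') (u - u') := by
  have h1 := opB_monotone (o := o) hM u u' hu hu'
  have e : u - u' = pair (u.fst - u'.fst) (u.snd - u'.snd) := rfl
  have hσ : 0 ≤ A.σy := by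
    have := hA.D; have := hA.eps
    rw [MinimaxParams.σy]; positivity
  have hL := hA.L
  rw [opA_sub, inner_add_left]
  conv_rhs => arg 2; rw [e]
  rw [e, norm_pair_sq, inner_pair, real_inner_smul_left, real_inner_smul_left,
    real_inner_self_eq_norm_sq, real_inner_self_eq_norm_sq, ← e]
  have h2 : 0 ≤ A.L * ‖u.fst - u'.fst‖ ^ 2 := by positivity
  have h3 : 0 ≤ A.σy * ‖u.snd - u'.snd‖ ^ 2 := by positivity
  linarith

theorem opA_sub_le (hM : M.Regular A.L) (hA : A.Positive) (zg : V) (yg : W)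
    (u u' : WithLp 2 (V × W)) (hu : u ∈ M.Ω) (hu' : u' ∈ M.Ω) :
    ‖M.opA A o zg yg u - M.opA A o zg yg u'‖ ≤ (5 / 2 * A.L + A.σy) * ‖u - u'‖ := by
  have hσ : 0 ≤ A.σy := by
    have := hA.D; have := hA.eps
    rw [MinimaxParams.σy]; positivity
  have hL := hA.L.le
  have e : M.opA A o zg yg u - M.opA A o zg yg u' =
      (pair (M.gx u.fst u.snd) (-M.gy u.fst u.snd) -
        pair (M.gx u'.fst u'.snd) (-M.gy u'.fst u'.snd)) +
      pair ((3 / 2 * A.L) • (u.fst - u'.fst)) ((A.σy + A.L / 8) • (u.snd - u'.snd)) := by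
    rw [opA_sub]
    simp only [opB, pair_sub, pair_add, gbX, gbY, MinimaxParams.σy]
    congr 1 <;> module
  rw [e]
  have h1 := hM.lipschitz u hu u' hu'
  have h2 := norm_pair_smul_le (C := 3 / 2 * A.L + A.σy) (by positivity : 0 ≤ 3 / 2 * A.L)
    (by positivity : 0 ≤ A.σy + A.L / 8)
    (by linarith) (by linarith) (u.fst - u'.fst) (u.snd - u'.snd)
  have h3 : ‖pair (u.fst - u'.fst) (u.snd - u'.snd)‖ = ‖u - u'‖ := rfl
  rw [h3] at h2
  refine (norm_add_le _ _).trans ((add_le_add h1 h2).trans (le_of_eq ?_))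
  ring

/-- The resolvent of the subdifferential of `p + q` on the product space. -/
theorem Regular.prox_pair (hM : M.Regular A.L) {s : ℝ} (hs : 0 < s) (x : V) (y : W) :
    IsSubgrad (prodSet M.X M.Y) (fun u => M.p u.fst + M.q u.snd)
      (pair (M.proxP s x) (M.proxQ s y))
      (s⁻¹ • (pair x y - pair (M.proxP s x) (M.proxQ s y))) :=
  (hM.proxP s hs x).pair (hM.proxQ s hs y)

theorem Regular.nonempty (hM : M.Regular A.L) : (prodSet M.X M.Y).Nonempty :=
  ⟨_, (hM.prox_pair one_pos 0 0).1⟩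

/-- The saddle point of the regularized minimax problem. -/
theorem exists_saddle (hM : M.Regular A.L) (hA : A.Positive) :
    ∃ xs ys, IsSubgrad M.X M.p xs (-M.gbX A o xs ys) ∧ IsSubgrad M.Y M.q ys (M.gbY A xs ys) := by
  have hσ : 0 < A.σy := by
    have := hA.D; have := hA.eps
    rw [MinimaxParams.σy]; positivity
  have hL := hA.L
  obtain ⟨u, hu⟩ := exists_zero_of_stronglyMonotone (F := M.opB A o) (m := min A.L A.σy)
    (ℓ := A.Lbar) (φ := fun u => M.p u.fst + M.q u.snd) hM.complete hM.nonempty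
    (J := fun s u => pair (M.proxP s u.fst) (M.proxQ s u.snd))
    (fun s hs v => hM.prox_pair hs v.fst v.snd) (lt_min hL hσ)
    (by have := hA.D; have := hA.eps; rw [MinimaxParams.Lbar]; positivity)
    (fun u hu u' hu' => by
      refine le_trans ?_ (opB_monotone hM u u' hu hu')
      have e : u - u' = pair (u.fst - u'.fst) (u.snd - u'.snd) := rfl
      rw [e, norm_pair_sq, mul_add]
      gcongr
      exacts [min_le_left _ _, min_le_right _ _])
    (fun u hu u' hu' => opB_sub_le hM hA u u' (hM.subset hu) (hM.subset hu'))
  refine ⟨u.fst, u.snd, hu.fst, ?_⟩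
  have h2 : (-M.opB A o u).snd = M.gbY A u.fst u.snd := neg_neg _
  exact h2 ▸ hu.snd

/-- The solution of the proximal subproblem centred at `(zg, yg)`. -/
theorem exists_zero_opA (hM : M.Regular A.L) (hA : A.Positive) (zg : V) (yg : W) :
    ∃ us, IsSubgrad (prodSet M.X M.Y) (fun u => M.p u.fst + M.q u.snd) us
      (-M.opA A o zg yg us) := by
  have hσ : 0 < A.σy := by
    have := hA.D; have := hA.eps
    rw [MinimaxParams.σy]; positivity
  have hL := hA.L
  exact exists_zero_of_stronglyMonotone (m := A.L / 8)
    (ℓ := 5 / 2 * A.L + A.σy) hM.complete hM.nonempty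
    (J := fun s u => pair (M.proxP s u.fst) (M.proxQ s u.snd))
    (fun s hs v => hM.prox_pair hs v.fst v.snd) (by positivity) (by positivity)
    (fun u hu u' hu' => opA_monotone hM hA zg yg u u' hu hu')
    (fun u hu u' hu' => opA_sub_le hM hA zg yg u u' (hM.subset hu) (hM.subset hu'))

end MinimaxProblem
end Problem

/-! ### The inner loop -/

section Inner

variable {Q V W : Type} [NormedAddCommGroup V] [InnerProductSpace ℝ V]
  [NormedAddCommGroup W] [InnerProductSpace ℝ W]

/-- The lists of elementary queries that make up a gradient evaluation and the evaluations of the two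
proximal maps. -/
structure QueryLog (Q V W : Type) where
  grad : V → W → List Q
  proxP : ℝ → V → List Q
  proxQ : ℝ → W → List Q

/-- A kind of query (given by its indicator `c`) is either asked at most twice per gradient and never
by the proximal maps, or never by the gradient and at most once by each proximal map. -/
def QueryLog.Cheap (lg : QueryLog Q V W) (c : Q → Bool) : Prop :=
  (∀ x y s s' x' y', (lg.grad x y).countP c ≤ 2 ∧ (lg.proxP s x').countP c = 0 ∧
    (lg.proxQ s' y').countP c = 0) ∨
  (∀ x y s s' x' y', (lg.grad x y).countP c = 0 ∧ (lg.proxP s x').countP c ≤ 1 ∧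
    (lg.proxQ s' y').countP c ≤ 1)

theorem QueryLog.Cheap.count_le {lg : QueryLog Q V W} {c : Q → Bool} (h : lg.Cheap c)
    (x₁ : V) (y₁ : W) (x₂ : V) (y₂ : W) (s₁ s₂ : ℝ) (x₃ : V) (y₃ : W) (l : ℕ) :
    (lg.grad x₂ y₂).countP c + ((lg.proxQ s₂ y₃).countP c + ((lg.proxP s₁ x₃).countP c +
      ((lg.grad x₁ y₁).countP c + l))) ≤ l + 4 := by
  rcases h with h | h
  · have h1 := h x₁ y₁ s₁ s₂ x₃ y₃
    have h2 := h x₂ y₂ s₁ s₂ x₃ y₃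
    lia
  · have h1 := h x₁ y₁ s₁ s₂ x₃ y₃
    have h2 := h x₂ y₂ s₁ s₂ x₃ y₃
    lia

/-- The oracles of a minimax problem that record the queries given by `lg`. -/
def MinimaxProblem.oracle (M : MinimaxProblem V W) (lg : QueryLog Q V W) : MinimaxOracle Q V W where
  grad x y := fun l => ((M.gx x y, M.gy x y), lg.grad x y ++ l)
  proxP s x := fun l => (M.proxP s x, lg.proxP s x ++ l)
  proxQ s y := fun l => (M.proxQ s y, lg.proxQ s y ++ l)

/-- The condition number that governs the inner loop. -/
def MinimaxParams.κ (A : MinimaxParams V W) : ℝ := 1 + 8 * A.Lbar / A.σx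

variable {A : MinimaxParams V W}

theorem MinimaxParams.Positive.σy_pos (hA : A.Positive) : 0 < A.σy := by
  have := hA.D; have := hA.eps
  rw [MinimaxParams.σy]; positivity

theorem MinimaxParams.Positive.κ_eq (hA : A.Positive) : A.κ = 25 + 8 * A.σy / A.L := by
  have := hA.L.ne'
  rw [MinimaxParams.κ, MinimaxParams.Lbar, MinimaxParams.σx, MinimaxParams.σy]
  field_simp; ring

theorem MinimaxParams.Positive.κ_ge (hA : A.Positive) : 25 ≤ A.κ := by
  have := hA.L; have := hA.σy_pos
  rw [hA.κ_eq]
  have : 0 ≤ 8 * A.σy / A.L := by positivity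
  linarith

theorem MinimaxParams.Positive.γ_pos (hA : A.Positive) : 0 < A.γ := by
  have := hA.L
  rw [MinimaxParams.γ, MinimaxParams.σx]; positivity

theorem MinimaxParams.ζ_eq : A.ζ = (2 * Real.sqrt 5 * A.κ)⁻¹ := rfl

theorem sqrt_five_bounds : 2.236 ≤ Real.sqrt 5 ∧ Real.sqrt 5 ≤ 2.2361 :=
  ⟨Real.le_sqrt_of_sq_le (by norm_num), Real.sqrt_le_iff.2 ⟨by norm_num, by norm_num⟩⟩

theorem MinimaxParams.Positive.ζ_pos (hA : A.Positive) : 0 < A.ζ := by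
  have := hA.κ_ge
  rw [MinimaxParams.ζ_eq]; positivity

theorem MinimaxParams.Positive.ζ_le (hA : A.Positive) : A.ζ ≤ 1 / 100 := by
  have := hA.κ_ge
  have h5 := sqrt_five_bounds.1
  rw [MinimaxParams.ζ_eq, inv_le_comm₀ (by positivity) (by norm_num)]
  nlinarith

theorem MinimaxParams.Positive.le_ζ_mul (hA : A.Positive) {t : ℝ} (ht : 30 * A.κ ≤ t) :
    6.7 ≤ A.ζ * (t + 1) := by
  have := hA.κ_ge
  have h5 := sqrt_five_bounds.2
  rw [MinimaxParams.ζ_eq, ← div_eq_inv_mul, le_div_iff₀ (by positivity)]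
  nlinarith

/-- The step size `ζ γ` times the Lipschitz modulus of the operator of the proximal subproblem. -/
theorem MinimaxParams.Positive.step_sq_le (hA : A.Positive) :
    (A.ζ * A.γ * (5 / 2 * A.L + A.σy)) ^ 2 ≤ 1 / 20 := by
  have hκ := hA.κ_ge
  have hL := hA.L
  have hσ := hA.σy_pos
  have h1 : A.γ * (5 / 2 * A.L + A.σy) ≤ A.κ := by
    rw [hA.κ_eq, MinimaxParams.γ, MinimaxParams.σx]
    have : 8 / A.L * (5 / 2 * A.L + A.σy) = 20 + 8 * A.σy / A.L := by field_simp; ring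
    linarith
  have h0 : 0 ≤ A.γ * (5 / 2 * A.L + A.σy) := by have := hA.γ_pos; positivity
  have h2 : A.ζ * A.γ * (5 / 2 * A.L + A.σy) ≤ (2 * Real.sqrt 5)⁻¹ := by
    rw [mul_assoc, MinimaxParams.ζ_eq, mul_inv, mul_assoc]
    have : A.κ⁻¹ * (A.γ * (5 / 2 * A.L + A.σy)) ≤ 1 := by
      rw [← div_eq_inv_mul, div_le_one (by linarith)]; exact h1
    calc _ ≤ (2 * Real.sqrt 5)⁻¹ * 1 := by gcongr
      _ = _ := mul_one _
  have h3 : 0 ≤ A.ζ * A.γ * (5 / 2 * A.L + A.σy) := by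
    rw [mul_assoc]; have := hA.ζ_pos; positivity
  calc _ ≤ ((2 * Real.sqrt 5)⁻¹) ^ 2 := by gcongr
    _ = 1 / 20 := by
      rw [inv_pow, mul_pow, Real.sq_sqrt (by norm_num)]; norm_num

theorem MinimaxParams.Positive.step_le (hA : A.Positive) :
    A.ζ * A.γ * (5 / 2 * A.L + A.σy) ≤ 0.225 :=
  abs_le_of_sq_le_sq' (hA.step_sq_le.trans (by norm_num)) (by norm_num) |>.2

variable (M : MinimaxProblem V W) (A) (o : OuterState V W)

/-- The residual `a(u^t) + b^t` of the inner loop. -/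
def InnerState.resid (i : InnerState V W) : WithLp 2 (V × W) :=
  pair (aX A i.zg i.x i.gx + i.bx) (aY A i.yg i.y i.gy + i.bY)

/-- The residual `a(u^0) + b^0`, where `u^0` is the forward-backward step from `u^{-1}`. -/
def InnerState.resid₀ (i : InnerState V W) : WithLp 2 (V × W) :=
  M.opA A o i.zg i.yg (pair i.x0 i.y0) + (A.ζ * A.γ)⁻¹ • (pair i.xm i.ym -
    (A.ζ * A.γ) • M.opA A o i.zg i.yg (pair i.xm i.ym) - pair i.x0 i.y0)

/-- The invariants of the inner loop that is started at the middle state `s`. -/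
structure InnerInv (s : MidState V W) (i : InnerState V W) : Prop where
  zg : i.zg = A.αbar • s.z + (1 - A.αbar) • s.zf
  yg : i.yg = A.αbar • s.y + (1 - A.αbar) • s.yf
  xm : i.xm = -(A.σx⁻¹ • i.zg)
  ym : i.ym = i.yg
  mem : pair i.xm i.ym ∈ M.Ω
  sub₀ : IsSubgrad (prodSet M.X M.Y) (fun u => M.p u.fst + M.q u.snd) (pair i.x0 i.y0)
    ((A.ζ * A.γ)⁻¹ • (pair i.xm i.ym -
      (A.ζ * A.γ) • M.opA A o i.zg i.yg (pair i.xm i.ym) - pair i.x0 i.y0))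
  sub : IsSubgrad (prodSet M.X M.Y) (fun u => M.p u.fst + M.q u.snd) (pair i.x i.y)
    (pair i.bx i.bY)
  gx : i.gx = M.gbX A o i.x i.y - A.σx • i.x
  gy : i.gy = M.gbY A i.x i.y + A.σy • i.y
  potential : A.ζ * A.γ * ((i.t : ℝ) + 1) * ((i.t : ℝ) + 2) ^ 2 / 4 * ‖i.resid A‖ ^ 2 +
    ((i.t : ℝ) + 1) * ((i.t : ℝ) + 2) *
      inner ℝ (i.resid A) (pair i.x i.y - pair i.x0 i.y0) ≤ A.ζ * A.γ * ‖i.resid₀ A M o‖ ^ 2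

variable {M A o}

theorem InnerInv.resid_eq {s : MidState V W} {i : InnerState V W} (h : InnerInv A M o s i) :
    i.resid A = M.opA A o i.zg i.yg (pair i.x i.y) + pair i.bx i.bY := by
  rw [InnerState.resid, h.gx, h.gy]; rfl

/-- After `30 κ` steps the inner loop has stopped. -/
theorem InnerInv.not_guard (hM : M.Regular A.L) (hA : A.Positive) {s : MidState V W}
    {i : InnerState V W} (h : InnerInv A M o s i) (ht : 30 * A.κ ≤ i.t) : ¬ innerGuard A i := by
  have hζ := hA.ζ_pos
  have hγ := hA.γ_pos
  have hL := hA.L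
  have hs : 0 < A.ζ * A.γ := by positivity
  have hσ := hA.σy_pos
  obtain ⟨us, hus⟩ := M.exists_zero_opA (o := o) hM hA i.zg i.yg
  have hlip := MinimaxProblem.opA_sub_le (o := o) hM hA i.zg i.yg
  have hle : ‖A.γ • i.resid A‖ ≤ ‖pair i.x i.y - pair i.xm i.ym‖ := by
    refine anchored_residual_le hζ hA.ζ_le (hA.le_ζ_mul ht) (u₀ := pair i.x0 i.y0) (us := us)
      (ρ₀ := A.γ • i.resid₀ A M o) ?_ ?_ ?_ ?_
    · have := mul_le_mul_of_nonneg_left h.potential hγ.le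
      rw [norm_smul, norm_smul, mul_pow, mul_pow, real_inner_smul_left, Real.norm_eq_abs, sq_abs]
      linarith
    · have h1 : IsSubgrad (prodSet M.X M.Y) (fun u => M.p u.fst + M.q u.snd) us
          ((A.ζ * A.γ)⁻¹ • (us - (A.ζ * A.γ) • M.opA A o i.zg i.yg us - us)) := by
        convert hus using 1
        rw [show us - (A.ζ * A.γ) • M.opA A o i.zg i.yg us - us =
          -((A.ζ * A.γ) • M.opA A o i.zg i.yg us) by abel, smul_neg, inv_smul_smul₀ hs.ne']
      refine (h.sub₀.norm_sub_le hs h1).trans ?_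
      rw [show ∀ a b c d : WithLp 2 (V × W), a - b - (c - d) = (a - c) - (b - d) by
        intros; abel, ← smul_sub]
      refine (norm_sub_le _ _).trans ?_
      rw [norm_smul, Real.norm_of_nonneg hs.le]
      have h2 := mul_le_mul_of_nonneg_left (hlip _ _ h.mem (hM.subset hus.1)) hs.le
      have h3 := mul_le_mul_of_nonneg_right hA.step_le (norm_nonneg (pair i.xm i.ym - us))
      linarith
    · rw [norm_smul, ← mul_assoc, Real.norm_of_nonneg hγ.le]
      conv_lhs => rw [← Real.norm_of_nonneg hs.le, ← norm_smul]
      rw [InnerState.resid₀, smul_add, smul_inv_smul₀ hs.ne',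
        show ∀ a b c d : WithLp 2 (V × W), a + (b - c - d) = (b - d) + (a - c) by
        intros; abel, ← smul_sub]
      refine (norm_add_le _ _).trans ?_
      rw [norm_smul, Real.norm_of_nonneg hs.le]
      have h2 := mul_le_mul_of_nonneg_left (hlip _ _ (hM.subset h.sub₀.1) h.mem) hs.le
      rw [norm_sub_rev (pair i.x0 i.y0)] at h2
      have h3 := mul_le_mul_of_nonneg_right hA.step_le
        (norm_nonneg (pair i.xm i.ym - pair i.x0 i.y0))
      linarith
    · have h1 := MinimaxProblem.opA_monotone (o := o) hM hA i.zg i.yg _ _ h.sub.1 hus.1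
      have h2 := h.sub.mono hus
      have h3 : 0 < A.γ * (A.L / 8) ∧ A.γ * (A.L / 8) = 1 := by
        have : A.γ * (A.L / 8) = 1 := by
          rw [MinimaxParams.γ, MinimaxParams.σx]; field_simp
        exact ⟨this ▸ one_pos, this⟩
      rw [real_inner_smul_left, h.resid_eq]
      rw [inner_sub_left, inner_neg_left] at h2
      rw [inner_sub_left] at h1
      have h4 : A.L / 8 * ‖pair i.x i.y - us‖ ^ 2 ≤
          inner ℝ (M.opA A o i.zg i.yg (pair i.x i.y) + pair i.bx i.bY) (pair i.x i.y - us) := by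
        rw [inner_add_left]; linarith
      have h5 := mul_le_mul_of_nonneg_left h4 hγ.le
      rwa [← mul_assoc, h3.2, one_mul] at h5
  rw [innerGuard, not_lt, ← mul_add, ← mul_add, ← norm_pair_sq, ← norm_pair_sq]
  have h1 : ‖pair (aX A i.zg i.x i.gx + i.bx) (aY A i.yg i.y i.gy + i.bY)‖ = ‖i.resid A‖ := rfl
  rw [h1, ← pair_sub]
  rw [norm_smul, Real.norm_of_nonneg hγ.le] at hle
  have h2 := pow_le_pow_left₀ (by positivity) hle 2
  rw [← div_eq_inv_mul, le_div_iff₀ hγ]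
  linarith

variable {lg : QueryLog Q V W} {good : Q → Prop}

theorem innerInit_spec (hM : M.Regular A.L) (hA : A.Positive)
    (hΩ : ∀ x y, (∀ e ∈ lg.grad x y, good e) → pair x y ∈ M.Ω) (s : MidState V W) (l : List Q) :
    ∃ i l', innerInit (M.oracle lg) A o s l = (i, l') ∧
      (∀ c, lg.Cheap c → l'.countP c ≤ l.countP c + 4) ∧
      ((∀ e ∈ l', good e) → InnerInv A M o s i ∧ i.t = 0) := by
  have hs : 0 < A.ζ * A.γ := mul_pos hA.ζ_pos hA.γ_pos
  refine ⟨_, _, rfl, fun c hc => ?_, fun hg => ⟨?_, rfl⟩⟩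
  · simp only [MinimaxProblem.oracle, List.countP_append]
    exact hc.count_le _ _ _ _ _ _ _ _ _
  · have hx := hM.prox_pair hs
    refine ⟨rfl, rfl, rfl, rfl, ?_, hx _ _, ?_, rfl, rfl, ?_⟩
    · refine hΩ _ _ fun e he => hg e ?_
      simp only [MinimaxProblem.oracle, List.mem_append]
      exact .inr (.inr (.inr (.inl he)))
    · exact hx _ _
    · have e : ∀ (a : ℝ) (r v : WithLp 2 (V × W)),
          a * (((0 : ℕ) : ℝ) + 1) * (((0 : ℕ) : ℝ) + 2) ^ 2 / 4 * ‖r‖ ^ 2 +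
            (((0 : ℕ) : ℝ) + 1) * (((0 : ℕ) : ℝ) + 2) * inner ℝ r (v - v) = a * ‖r‖ ^ 2 := by
        intro a r v
        rw [sub_self, inner_zero_right]
        norm_num
      exact (e _ _ _).le

/-- The potential of the inner loop does not increase in one step. -/
theorem potential_step (hM : M.Regular A.L) (hA : A.Positive) (zg : V) (yg : W) (t : ℕ)
    {u b : WithLp 2 (V × W)} (u₀ : WithLp 2 (V × W)) {r : WithLp 2 (V × W)}
    (hb : IsSubgrad (prodSet M.X M.Y) (fun u => M.p u.fst + M.q u.snd) u b)
    (hr : r = M.opA A o zg yg u + b) :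
    let s := A.ζ * A.γ
    let c := u + (2 / ((t : ℝ) + 3)) • (u₀ - u)
    let uh := c - s • r
    let v := c - s • M.opA A o zg yg uh
    let u' := pair (M.proxP s v.fst) (M.proxQ s v.snd)
    let r' := M.opA A o zg yg u' + s⁻¹ • (v - u')
    uh ∈ M.Ω → A.ζ * A.γ * (((t + 1 : ℕ) : ℝ) + 1) * (((t + 1 : ℕ) : ℝ) + 2) ^ 2 / 4 * ‖r'‖ ^ 2 +
      (((t + 1 : ℕ) : ℝ) + 1) * (((t + 1 : ℕ) : ℝ) + 2) * inner ℝ r' (u' - u₀) ≤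
      A.ζ * A.γ * ((t : ℝ) + 1) * ((t : ℝ) + 2) ^ 2 / 4 * ‖r‖ ^ 2 +
      ((t : ℝ) + 1) * ((t : ℝ) + 2) * inner ℝ r (u - u₀) := by
  have hs0 : 0 < A.ζ * A.γ := mul_pos hA.ζ_pos hA.γ_pos
  intro s c uh v u' r' huhΩ
  have hs : 0 < s := hs0
  set b' := s⁻¹ • (v - u') with hb'
  have hsub : IsSubgrad (prodSet M.X M.Y) (fun u => M.p u.fst + M.q u.snd) u' b' :=
    hM.prox_pair hs _ _
  set w := M.opA A o zg yg uh + b' with hw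
  have e1 : u' = u + (2 / ((t : ℝ) + 3)) • (u₀ - u) - s • w := by
    rw [hw, hb', smul_add, smul_inv_smul₀ hs.ne']
    simp only [v, c]; abel
  have key := anchored_step (t := (t : ℝ)) hs (Nat.cast_nonneg _) (r := r) (r' := r') e1 ?_ ?_
  · rw [show ((t + 1 : ℕ) : ℝ) + 1 = t + 2 by push_cast; ring,
      show ((t + 1 : ℕ) : ℝ) + 2 = t + 3 by push_cast; ring]
    exact key
  · have h1 := MinimaxProblem.opA_monotone (o := o) hM hA zg yg _ _ hsub.1 hb.1
    have h2 := hsub.mono hb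
    rw [hr, show r' = M.opA A o zg yg u' + b' from rfl, add_sub_add_comm, inner_add_left]
    have h3 : 0 ≤ A.L / 8 * ‖u' - u‖ ^ 2 := by have := hA.L; positivity
    linarith
  · have h1 := MinimaxProblem.opA_sub_le (o := o) hM hA zg yg _ _ (hM.subset hsub.1) huhΩ
    have h2 : u' - uh = -(s • (w - r)) := by
      rw [e1]; simp only [uh, c]; module
    have h3 : r' - w = M.opA A o zg yg u' - M.opA A o zg yg uh := by
      simp only [r', hw]; abel
    rw [h2, norm_neg, norm_smul, Real.norm_of_nonneg hs.le] at h1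
    rw [h3]
    calc _ ≤ ((5 / 2 * A.L + A.σy) * (s * ‖w - r‖)) ^ 2 := by gcongr
      _ = (s * (5 / 2 * A.L + A.σy)) ^ 2 * ‖w - r‖ ^ 2 := by ring
      _ ≤ 1 / 20 * ‖w - r‖ ^ 2 := by gcongr; exact hA.step_sq_le

/-- The state after one step of the inner loop, written in the product space. -/
def innerNext (A : MinimaxParams V W) (M : MinimaxProblem V W) (o : OuterState V W)
    (i : InnerState V W) : InnerState V W :=
  let s := A.ζ * A.γ
  let c := pair i.x i.y + (2 / ((i.t : ℝ) + 3)) • (pair i.x0 i.y0 - pair i.x i.y)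
  let v := c - s • M.opA A o i.zg i.yg (c - s • i.resid A)
  let u' := pair (M.proxP s v.fst) (M.proxQ s v.snd)
  { i with
    t := i.t + 1, x := u'.fst, y := u'.snd,
    bx := s⁻¹ • (v.fst - u'.fst), bY := s⁻¹ • (v.snd - u'.snd),
    gx := M.gbX A o u'.fst u'.snd - A.σx • u'.fst, gy := M.gbY A u'.fst u'.snd + A.σy • u'.snd }

theorem InnerInv.next (hM : M.Regular A.L) (hA : A.Positive) {s : MidState V W}
    {i : InnerState V W} (hi : InnerInv A M o s i)
    (h : pair i.x i.y + (2 / ((i.t : ℝ) + 3)) • (pair i.x0 i.y0 - pair i.x i.y) -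
      (A.ζ * A.γ) • i.resid A ∈ M.Ω) : InnerInv A M o s (innerNext A M o i) := by
  have hs : 0 < A.ζ * A.γ := mul_pos hA.ζ_pos hA.γ_pos
  have hx := hM.prox_pair hs
  refine ⟨hi.zg, hi.yg, hi.xm, hi.ym, hi.mem, hi.sub₀, hx _ _, rfl, rfl, ?_⟩
  have key := potential_step hM hA i.zg i.yg i.t (pair i.x0 i.y0) hi.sub hi.resid_eq h
  exact key.trans hi.potential

theorem innerStep_spec (hM : M.Regular A.L) (hA : A.Positive)
    (hΩ : ∀ x y, (∀ e ∈ lg.grad x y, good e) → pair x y ∈ M.Ω) (s : MidState V W)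
    {i : InnerState V W} (hi : InnerInv A M o s i) (l : List Q) :
    ∃ i' l', innerStep (M.oracle lg) A o i l = (i', l') ∧
      (∀ c, lg.Cheap c → l'.countP c ≤ l.countP c + 4) ∧
      ((∀ e ∈ l', good e) → InnerInv A M o s i' ∧ i'.t = i.t + 1) := by
  refine ⟨innerNext A M o i, _, rfl, fun c hc => ?_, fun hg => ⟨hi.next hM hA ?_, rfl⟩⟩
  · simp only [MinimaxProblem.oracle, List.countP_append]
    exact hc.count_le _ _ _ _ _ _ _ _ _
  · refine hΩ _ _ fun e he => hg e ?_
    simp only [MinimaxProblem.oracle, List.mem_append]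
    exact .inr (.inr (.inr (.inl he)))

end Inner

/-! ### The strongly-convex-strongly-concave solver -/

section Middle

variable {Q V W : Type} [NormedAddCommGroup V] [InnerProductSpace ℝ V]
  [NormedAddCommGroup W] [InnerProductSpace ℝ W]

variable {A : MinimaxParams V W}

theorem MinimaxParams.Positive.αbar_pos (hA : A.Positive) : 0 < A.αbar := by
  have := hA.σy_pos; have h := hA.L
  rw [MinimaxParams.αbar, MinimaxParams.σx]
  exact lt_min one_pos (Real.sqrt_pos.2 (by positivity))

theorem MinimaxParams.αbar_le_one : A.αbar ≤ 1 := min_le_left _ _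

theorem MinimaxParams.Positive.αbar_sq_mul_le (hA : A.Positive) :
    A.αbar ^ 2 * A.L ≤ 8 * A.σy := by
  have hσ := hA.σy_pos; have h := hA.L
  rw [← le_div_iff₀ h]
  have h1 : A.αbar ≤ Real.sqrt (8 * A.σy / A.L) := min_le_right _ _
  calc A.αbar ^ 2 ≤ (Real.sqrt (8 * A.σy / A.L)) ^ 2 := by
        have := hA.αbar_pos; gcongr
    _ = _ := Real.sq_sqrt (by positivity)

theorem MinimaxParams.Positive.ηy_pos (hA : A.Positive) : 0 < A.ηy := by
  have := hA.σy_pos; have h := hA.L; have := hA.αbar_pos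
  rw [MinimaxParams.ηy, MinimaxParams.σx]
  exact lt_min (by positivity) (by positivity)

theorem MinimaxParams.Positive.ηy_mul_σy_le (hA : A.Positive) : A.ηy * A.σy ≤ 1 / 2 := by
  have := hA.σy_pos
  calc A.ηy * A.σy ≤ 1 / (2 * A.σy) * A.σy := by gcongr; exact min_le_left _ _
    _ = 1 / 2 := by field_simp

theorem MinimaxParams.Positive.ηy_mul_le (hA : A.Positive) : A.ηy * (A.αbar * A.L) ≤ 4 := by
  have h := hA.L; have := hA.αbar_pos
  calc A.ηy * (A.αbar * A.L) ≤ 4 / (A.αbar * A.L) * (A.αbar * A.L) := by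
        gcongr; exact min_le_right _ _
    _ = 4 := by field_simp

theorem MinimaxParams.Positive.αbar_le (hA : A.Positive) : A.αbar / 2 ≤ A.ηy * A.σy := by
  have hσ := hA.σy_pos; have h := hA.L; have hα := hA.αbar_pos
  rw [MinimaxParams.ηy, min_mul_of_nonneg _ _ hσ.le, MinimaxParams.σx]
  refine le_min ?_ ?_
  · have : 1 / (2 * A.σy) * A.σy = 1 / 2 := by field_simp
    rw [this]
    linarith [MinimaxParams.αbar_le_one (A := A)]
  · rw [div_mul_eq_mul_div, le_div_iff₀ (by positivity)]
    linarith [hA.αbar_sq_mul_le]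

theorem MinimaxParams.Positive.Lbar_pos (hA : A.Positive) : 0 < A.Lbar := by
  have := hA.L; have := hA.D; have := hA.eps
  rw [MinimaxParams.Lbar]; positivity

theorem MinimaxParams.Positive.ζhat_pos (hA : A.Positive) : 0 < A.ζhat := by
  have h := hA.Lbar_pos
  have : 0 < min A.σx A.σy := lt_min hA.L hA.σy_pos
  rw [MinimaxParams.ζhat]; positivity

theorem MinimaxParams.Positive.ζhat_mul_le (hA : A.Positive) : A.ζhat * A.Lbar ≤ 1 / 3 := by
  have h := hA.Lbar_pos
  have h1 : min A.σx A.σy ≤ A.L := min_le_left _ _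
  have h2 : 3 * A.L ≤ A.Lbar := by
    have := hA.D; have := hA.eps
    rw [MinimaxParams.Lbar]
    have : 0 < A.eps / (2 * A.D) := by positivity
    linarith
  have : A.ζhat * A.Lbar = min A.σx A.σy / A.Lbar := by
    rw [MinimaxParams.ζhat]; field_simp
  rw [this, div_le_iff₀ h]
  linarith

variable (M : MinimaxProblem V W) (A) (o : OuterState V W)

/-- `(x, y)` is a `τ`-stationary point of the regularized minimax problem. -/
def ApproxSaddle (τ : ℝ) (x : V) (y : W) : Prop :=
  ∃ bx bY, IsSubgrad M.X M.p x bx ∧ IsSubgrad M.Y M.q y bY ∧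
    ‖bx + M.gbX A o x y‖ ^ 2 + ‖bY - M.gbY A x y‖ ^ 2 ≤ τ ^ 2

/-- `(xs, ys)` is the saddle point of the regularized minimax problem. -/
def IsSaddle (xs : V) (ys : W) : Prop :=
  IsSubgrad M.X M.p xs (-M.gbX A o xs ys) ∧ IsSubgrad M.Y M.q ys (M.gbY A xs ys)

/-- The invariant of the solver. The dual objective is
`Φ(z, y) = max_x (L / 2) ‖x + z / σ_x‖² - H_k(x, y)`, with minimizer `(-σ_x xs, ys)` and minimal value
`-H_k(xs, ys)`; the number `Φ` is an upper bound of its value at `(z_f, y_f)`, and `Ψ` bounds the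
potential. -/
def MidInv (xs : V) (ys : W) (s : MidState V W) (Ψ : ℝ) : Prop :=
  s.yf ∈ M.Y ∧ ∃ Φ, (∀ x ∈ M.X, A.L / 2 * ‖x + A.L⁻¹ • s.zf‖ ^ 2 - M.Hbar A o x s.yf ≤ Φ) ∧
    2 / A.L * ‖s.z - -(A.L • xs)‖ ^ 2 + A.ηy⁻¹ * ‖s.y - ys‖ ^ 2 +
      2 / A.αbar * (Φ + M.Hbar A o xs ys) ≤ Ψ

/-- The factor by which the squared termination residual exceeds the potential. -/
def MinimaxParams.Λ : ℝ :=
  49 / 9 * (A.ζhat⁻¹ + A.Lbar) ^ 2 * max (1 / (2 * A.L)) A.ηy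

variable {M A o}

/-- The value at the saddle point is a lower bound of the dual objective. -/
theorem IsSaddle.neg_le (hM : M.Regular A.L) (hA : A.Positive) {xs : V} {ys : W}
    (h : IsSaddle A M o xs ys) {zf : V} {yf : W} (hyf : yf ∈ M.Y) {Φ : ℝ}
    (hΦ : ∀ x ∈ M.X, A.L / 2 * ‖x + A.L⁻¹ • zf‖ ^ 2 - M.Hbar A o x yf ≤ Φ) :
    0 ≤ Φ + M.Hbar A o xs ys := by
  have h1 := hΦ xs h.1.1
  have h2 := MinimaxProblem.Hbar_concave (o := o) hM hA h.1.1 h.2 hyf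
  rw [sub_self, inner_zero_left] at h2
  have := hA.L; have := hA.σy_pos
  have h3 : 0 ≤ A.L / 2 * ‖xs + A.L⁻¹ • zf‖ ^ 2 := by positivity
  have h4 : 0 ≤ A.σy / 2 * ‖yf - ys‖ ^ 2 := by positivity
  linarith

theorem MidInv.dist_sq_le (hM : M.Regular A.L) (hA : A.Positive) {xs : V} {ys : W}
    (h : IsSaddle A M o xs ys) {s : MidState V W} {Ψ : ℝ} (hs : MidInv A M o xs ys s Ψ) :
    ‖-(A.L⁻¹ • s.z) - xs‖ ^ 2 + ‖s.y - ys‖ ^ 2 ≤ max (1 / (2 * A.L)) A.ηy * Ψ := by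
  obtain ⟨hyf, Φ, hΦ, hΨ⟩ := hs
  have hL := hA.L
  have hη := hA.ηy_pos
  have h1 := h.neg_le hM hA hyf hΦ
  have hα := hA.αbar_pos
  have h2 : 0 ≤ 2 / A.αbar * (Φ + M.Hbar A o xs ys) := by positivity
  have e : -(A.L⁻¹ • s.z) - xs = -(A.L⁻¹ • (s.z - -(A.L • xs))) := by
    rw [smul_sub, smul_neg, inv_smul_smul₀ hL.ne']; abel
  rw [e, norm_neg, norm_smul, mul_pow, Real.norm_eq_abs, sq_abs]
  set m := max (1 / (2 * A.L)) A.ηy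
  have hm1 : 1 / (2 * A.L) ≤ m := le_max_left _ _
  have hm2 : A.ηy ≤ m := le_max_right _ _
  have hm0 : 0 < m := hη.trans_le hm2
  have h3 : A.L⁻¹ ^ 2 * ‖s.z - -(A.L • xs)‖ ^ 2 ≤ m * (2 / A.L * ‖s.z - -(A.L • xs)‖ ^ 2) := by
    calc _ = 1 / (2 * A.L) * (2 / A.L * ‖s.z - -(A.L • xs)‖ ^ 2) := by field_simp
      _ ≤ _ := by gcongr
  have h4 : ‖s.y - ys‖ ^ 2 ≤ m * (A.ηy⁻¹ * ‖s.y - ys‖ ^ 2) := by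
    calc _ = A.ηy * (A.ηy⁻¹ * ‖s.y - ys‖ ^ 2) := by field_simp
      _ ≤ _ := by gcongr
  calc _ ≤ m * (2 / A.L * ‖s.z - -(A.L • xs)‖ ^ 2 + A.ηy⁻¹ * ‖s.y - ys‖ ^ 2) := by
        rw [mul_add]; exact add_le_add h3 h4
    _ ≤ m * Ψ := by gcongr; linarith

/-- The residual of the final forward-backward step of the solver. Only the Lipschitz continuity of
the gradient is available at `u`, which may lie outside of the domain. -/
theorem residual_le (hM : M.Regular A.L) (hA : A.Positive) {xs : V} {ys : W}
    (h : IsSaddle A M o xs ys) {u û : WithLp 2 (V × W)} (hu : u ∈ M.Ω)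
    (hû : IsSubgrad (prodSet M.X M.Y) (fun u => M.p u.fst + M.q u.snd) û
      (A.ζhat⁻¹ • (u - A.ζhat • M.opB A o u - û))) :
    ‖A.ζhat⁻¹ • (u - û) - (M.opB A o u - M.opB A o û)‖ ^ 2 ≤
      49 / 9 * (A.ζhat⁻¹ + A.Lbar) ^ 2 * ‖u - pair xs ys‖ ^ 2 := by
  have hζ := hA.ζhat_pos
  have hLb := hA.Lbar_pos
  set us := pair xs ys
  have hus : IsSubgrad (prodSet M.X M.Y) (fun u => M.p u.fst + M.q u.snd) us
      (A.ζhat⁻¹ • (us - A.ζhat • M.opB A o us - us)) := by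
    rw [show us - A.ζhat • M.opB A o us - us = A.ζhat • -M.opB A o us by
      rw [smul_neg]; abel, inv_smul_smul₀ hζ.ne']
    have h1 := h.1.pair h.2
    rwa [← neg_neg (M.gbY A xs ys)] at h1
  have h1 : ‖û - us‖ ≤ (1 + 1 / 3) * ‖u - us‖ := by
    refine (hû.norm_sub_le hζ hus).trans ?_
    rw [show u - A.ζhat • M.opB A o u - (us - A.ζhat • M.opB A o us) =
      (u - us) - A.ζhat • (M.opB A o u - M.opB A o us) by rw [smul_sub]; abel]
    refine (norm_sub_le _ _).trans ?_
    rw [norm_smul, Real.norm_of_nonneg hζ.le]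
    have h2 := MinimaxProblem.opB_sub_le (o := o) hM hA u us hu (hM.subset hus.1)
    have h3 := mul_le_mul_of_nonneg_left h2 hζ.le
    have h4 := mul_le_mul_of_nonneg_right hA.ζhat_mul_le (norm_nonneg (u - us))
    linarith
  have h2 : ‖u - û‖ ≤ 7 / 3 * ‖u - us‖ := by
    have := norm_sub_le_norm_sub_add_norm_sub u us û
    rw [norm_sub_rev us û] at this
    linarith
  have h3 : ‖A.ζhat⁻¹ • (u - û) - (M.opB A o u - M.opB A o û)‖ ≤
      (A.ζhat⁻¹ + A.Lbar) * (7 / 3 * ‖u - us‖) := by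
    refine (norm_sub_le _ _).trans ?_
    rw [norm_smul, Real.norm_of_nonneg (inv_pos.2 hζ).le]
    have h4 := MinimaxProblem.opB_sub_le (o := o) hM hA u û hu (hM.subset hû.1)
    calc _ ≤ A.ζhat⁻¹ * ‖u - û‖ + A.Lbar * ‖u - û‖ := by gcongr
      _ = (A.ζhat⁻¹ + A.Lbar) * ‖u - û‖ := by ring
      _ ≤ _ := by gcongr
  calc _ ≤ ((A.ζhat⁻¹ + A.Lbar) * (7 / 3 * ‖u - us‖)) ^ 2 := by gcongr
    _ = _ := by ring

/-- One iteration of the solver contracts the potential. -/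
theorem MidInv.step (hM : M.Regular A.L) (hA : A.Positive) {xs : V} {ys : W}
    (h : IsSaddle A M o xs ys) {s : MidState V W} {Ψ : ℝ} (hs : MidInv A M o xs ys s Ψ)
    {i : InnerState V W} (hi : InnerInv A M o s i) (hg : ¬ innerGuard A i) {s' : MidState V W}
    (hzf : s'.zf = i.gx + i.bx) (hyf : s'.yf = i.y)
    (hz : s'.z = s.z + (A.ηz * A.σx⁻¹) • (i.gx + i.bx - s.z) -
      A.ηz • (i.x + A.σx⁻¹ • (i.gx + i.bx)))
    (hy : s'.y = s.y + (A.ηy * A.σy) • (i.y - s.y) - A.ηy • (-i.gy + i.bY + A.σy • i.y)) :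
    MidInv A M o xs ys s' ((1 - A.αbar / 2) * Ψ) := by
  have hL := hA.L
  obtain ⟨hsyf, Φ, hΦ, hΨ⟩ := hs
  have hbx : IsSubgrad M.X M.p i.x i.bx := hi.sub.fst
  have hbY : IsSubgrad M.Y M.q i.y i.bY := hi.sub.snd
  set Z := i.gx + i.bx with hZ
  set gz := i.x + A.L⁻¹ • Z with hgz
  set gy := -i.gy + i.bY + A.σy • i.y with hgy
  set Φp := A.L / 2 * ‖gz‖ ^ 2 - M.Hbar A o i.x i.y with hΦp
  have egz : i.bx + M.gbX A o i.x i.y = A.L • gz := by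
    rw [hgz, hZ, hi.gx, smul_add, smul_inv_smul₀ hL.ne', MinimaxParams.σx]; abel
  have egy : i.bY - M.gbY A i.x i.y = gy := by
    rw [hgy, hi.gy]; abel
  -- expansion of the quadratic term around `gz`
  have hquad : ∀ d : V, A.L / 2 * ‖gz + d‖ ^ 2 =
      A.L / 2 * ‖gz‖ ^ 2 + inner ℝ gz (A.L • d) + A.L / 2 * ‖d‖ ^ 2 := by
    intro d
    rw [norm_add_sq_real, real_inner_smul_right]; ring
  have hquad' : ∀ z : V, A.L / 2 * ‖i.x + A.L⁻¹ • z‖ ^ 2 =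
      A.L / 2 * ‖gz‖ ^ 2 + inner ℝ gz (z - Z) + A.L⁻¹ / 2 * ‖Z - z‖ ^ 2 := by
    intro z
    rw [show i.x + A.L⁻¹ • z = gz + A.L⁻¹ • (z - Z) by rw [hgz, smul_sub]; abel, hquad,
      smul_inv_smul₀ hL.ne', norm_smul, mul_pow, Real.norm_eq_abs, sq_abs, norm_sub_rev z]
    field_simp
  have hconc : ∀ y ∈ M.Y, M.Hbar A o i.x y ≤
      M.Hbar A o i.x i.y - inner ℝ gy (y - i.y) - A.σy / 2 * ‖i.y - y‖ ^ 2 := by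
    intro y hy
    have := MinimaxProblem.Hbar_concave (o := o) hM hA hbx.1 hbY hy
    rwa [egy, norm_sub_rev y] at this
  have hσ := hA.σy_pos
  refine ⟨hyf ▸ hbY.1, Φp, ?_, ?_⟩
  · intro x hx
    have h1 := MinimaxProblem.Hbar_convex (o := o) hM hbx hx hbY.1
    rw [egz, real_inner_smul_left] at h1
    rw [hyf, hzf, show x + A.L⁻¹ • Z = gz + (x - i.x) by rw [hgz]; abel, hquad,
      real_inner_smul_right]
    linarith
  · have hstar := proximal_accuracy (σ := A.L) hL (zg := i.zg) (Z := Z) (Xf := i.x) (yg := i.yg)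
      (Yf := i.y) (gy := gy) (by
        rw [innerGuard, not_lt, hi.xm, hi.ym] at hg
        have ea : Z + (A.L / 2) • (i.x - A.L⁻¹ • i.zg) = aX A i.zg i.x i.gx + i.bx := by
          rw [hZ, aX, MinimaxParams.σx]; abel
        have eb : gy + (A.L / 8) • (i.y - i.yg) = aY A i.yg i.y i.gy + i.bY := by
          rw [hgy, aY, MinimaxParams.σx]; abel
        rw [ea, eb]
        exact hg)
    have hf : Φp + inner ℝ gz (s.zf - Z) + inner ℝ gy (s.yf - i.y) ≤ Φ := by
      have h1 := hΦ i.x hbx.1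
      have h2 := hconc s.yf hsyf
      rw [hquad'] at h1
      have h3 : 0 ≤ A.L⁻¹ / 2 * ‖Z - s.zf‖ ^ 2 := by positivity
      have h4 : 0 ≤ A.σy / 2 * ‖i.y - s.yf‖ ^ 2 := by positivity
      linarith
    have hst : Φp + inner ℝ gz (-(A.L • xs) - Z) + inner ℝ gy (ys - i.y) +
        A.L⁻¹ / 2 * ‖Z - -(A.L • xs)‖ ^ 2 + A.σy / 2 * ‖i.y - ys‖ ^ 2 ≤ -M.Hbar A o xs ys := by
      have h1 := MinimaxProblem.Hbar_convex (o := o) hM h.1 hbx.1 h.2.1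
      have h2 := hconc ys h.2.1
      have h3 := hquad' (-(A.L • xs))
      rw [smul_neg, inv_smul_smul₀ hL.ne', ← sub_eq_add_neg] at h3
      rw [neg_add_cancel, inner_zero_left] at h1
      linarith
    have hfs : -M.Hbar A o xs ys ≤ Φ := by
      have := h.neg_le hM hA hsyf hΦ
      linarith
    have key := accelerated_step hL hσ hA.αbar_pos MinimaxParams.αbar_le_one hA.ηy_pos
      hA.ηy_mul_σy_le hA.ηy_mul_le hA.αbar_le hz hi.zg hy hi.yg hstar hf hst hfs
    rw [sub_neg_eq_add Φp, sub_neg_eq_add Φ] at key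
    refine key.trans ?_
    have : 0 ≤ 1 - A.αbar / 2 := by linarith [MinimaxParams.αbar_le_one (A := A)]
    gcongr

variable {lg : QueryLog Q V W} {good : Q → Prop}

open Classical in
theorem midFinish_spec (hM : M.Regular A.L) (hA : A.Positive)
    (hΩ : ∀ x y, (∀ e ∈ lg.grad x y, good e) → pair x y ∈ M.Ω) {xs : V} {ys : W}
    (h : IsSaddle A M o xs ys) {s : MidState V W} {Ψ : ℝ} (hs : MidInv A M o xs ys s Ψ)
    {i : InnerState V W} (hi : InnerInv A M o s i) (hg : ¬ innerGuard A i) (l : List Q) :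
    ∃ c' l', midFinish (M.oracle lg) A o s i l = (c', l') ∧
      (∀ c, lg.Cheap c → l'.countP c ≤ l.countP c + 4) ∧
      ((∀ e ∈ l', good e) →
        (∃ s', c' = Config.mid o s' ∧ MidInv A M o xs ys s' ((1 - A.αbar / 2) * Ψ) ∧
          (A.eps₀ / ((o.k : ℝ) + 1)) ^ 2 < A.Λ * ((1 - A.αbar / 2) * Ψ)) ∨
        ∃ x y, ApproxSaddle A M o (A.eps₀ / ((o.k : ℝ) + 1)) x y ∧
          (c' = Config.halted x y ∧ ‖x - o.x‖ ≤ A.eps / (4 * A.L) ∨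
            c' = midInit A { k := o.k + 1, x := x, y := y } ∧
              A.eps / (4 * A.L) < ‖x - o.x‖)) := by
  have hζ := hA.ζhat_pos
  set z' := s.z + (A.ηz * A.σx⁻¹) • (i.gx + i.bx - s.z) -
    A.ηz • (i.x + A.σx⁻¹ • (i.gx + i.bx)) with hz'
  set y' := s.y + (A.ηy * A.σy) • (i.y - s.y) - A.ηy • (-i.gy + i.bY + A.σy • i.y) with hy'
  set x' := -(A.σx⁻¹ • z') with hx'
  set xh := M.proxP A.ζhat (x' - A.ζhat • M.gbX A o x' y') with hxh
  set yh := M.proxQ A.ζhat (y' + A.ζhat • M.gbY A x' y') with hyh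
  set rx := A.ζhat⁻¹ • (x' - xh) - (M.gbX A o x' y' - M.gbX A o xh yh) with hrx
  set ry := A.ζhat⁻¹ • (yh - y') - (M.gbY A x' y' - M.gbY A xh yh) with hry
  set s' : MidState V W := { z := z', y := y', zf := i.gx + i.bx, yf := i.y } with hs'
  have hrun : midFinish (M.oracle lg) A o s i l =
      (if Real.sqrt (‖rx‖ ^ 2 + ‖ry‖ ^ 2) ≤ A.eps₀ / ((o.k : ℝ) + 1) then
        if ‖xh - o.x‖ ≤ A.eps / (4 * A.L) then Config.halted xh yh
        else midInit A { k := o.k + 1, x := xh, y := yh }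
      else Config.mid o s', lg.grad xh yh ++ (lg.proxQ A.ζhat (y' + A.ζhat • M.gbY A x' y') ++
        (lg.proxP A.ζhat (x' - A.ζhat • M.gbX A o x' y') ++ (lg.grad x' y' ++ l)))) := by
    have h0 : midFinish (M.oracle lg) A o s i l =
      (if Real.sqrt (‖rx‖ ^ 2 + ‖ry‖ ^ 2) ≤ A.eps₀ / ((o.k : ℝ) + 1) then
        if ‖xh - o.x‖ ≤ A.eps / (4 * A.L) then (pure (Config.halted xh yh) : Comp Q (Config V W))
        else pure (midInit A { k := o.k + 1, x := xh, y := yh })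
      else pure (Config.mid o s')) (lg.grad xh yh ++
        (lg.proxQ A.ζhat (y' + A.ζhat • M.gbY A x' y') ++
        (lg.proxP A.ζhat (x' - A.ζhat • M.gbX A o x' y') ++ (lg.grad x' y' ++ l)))) := rfl
    rw [h0]
    split_ifs <;> rfl
  refine ⟨_, _, hrun, fun c hc => ?_, fun hgood => ?_⟩
  · simp only [List.countP_append]
    exact hc.count_le _ _ _ _ _ _ _ _ _
  have huΩ : pair x' y' ∈ M.Ω := by
    refine hΩ _ _ fun e he => hgood e ?_
    simp only [List.mem_append]
    exact .inr (.inr (.inr (.inl he)))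
  have hinv : MidInv A M o xs ys s' ((1 - A.αbar / 2) * Ψ) := hs.step hM hA h hi hg rfl rfl rfl rfl
  have hbx := hM.proxP A.ζhat hζ (x' - A.ζhat • M.gbX A o x' y')
  have hbY := hM.proxQ A.ζhat hζ (y' + A.ζhat • M.gbY A x' y')
  have e1 : A.ζhat⁻¹ • (x' - A.ζhat • M.gbX A o x' y' - xh) + M.gbX A o xh yh = rx := by
    rw [hrx, smul_sub, smul_sub, smul_sub, inv_smul_smul₀ hζ.ne']; abel
  have e2 : A.ζhat⁻¹ • (y' + A.ζhat • M.gbY A x' y' - yh) - M.gbY A xh yh = -ry := by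
    have gen : ∀ a b g g' : W, A.ζhat⁻¹ • (a + A.ζhat • g - b) - g' =
        -(A.ζhat⁻¹ • (b - a) - (g - g')) := by
      intros
      rw [smul_sub, smul_add, inv_smul_smul₀ hζ.ne']; module
    exact gen _ _ _ _
  have hτ : 0 ≤ A.eps₀ / ((o.k : ℝ) + 1) := by have := hA.eps₀; positivity
  by_cases h1 : Real.sqrt (‖rx‖ ^ 2 + ‖ry‖ ^ 2) ≤ A.eps₀ / ((o.k : ℝ) + 1)
  · right
    refine ⟨xh, yh, ⟨_, _, hbx, hbY, ?_⟩, ?_⟩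
    · rw [e1, e2, norm_neg]
      exact (Real.sqrt_le_left hτ).1 h1
    · rw [if_pos h1]
      by_cases h2 : ‖xh - o.x‖ ≤ A.eps / (4 * A.L)
      · exact .inl ⟨if_pos h2, h2⟩
      · exact .inr ⟨if_neg h2, not_le.1 h2⟩
  · left
    refine ⟨s', if_neg h1, hinv, ?_⟩
    have h2 := residual_le hM hA h (u := pair x' y') (û := pair xh yh) huΩ (by
      have e5 : A.ζhat⁻¹ • (pair x' y' - A.ζhat • M.opB A o (pair x' y') - pair xh yh) =
          pair (A.ζhat⁻¹ • (x' - A.ζhat • M.gbX A o x' y' - xh))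
            (A.ζhat⁻¹ • (y' + A.ζhat • M.gbY A x' y' - yh)) := by
        simp only [MinimaxProblem.opB, pair_sub, smul_pair, pair_fst, pair_snd, smul_neg,
          sub_neg_eq_add]
      rw [e5]
      exact hbx.pair hbY)
    have h3 := hinv.dist_sq_le hM hA h
    have e3 : ‖A.ζhat⁻¹ • (pair x' y' - pair xh yh) -
        (M.opB A o (pair x' y') - M.opB A o (pair xh yh))‖ ^ 2 = ‖rx‖ ^ 2 + ‖ry‖ ^ 2 := by
      have : A.ζhat⁻¹ • (pair x' y' - pair xh yh) -
        (M.opB A o (pair x' y') - M.opB A o (pair xh yh)) = pair rx (-ry) := by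
        simp only [MinimaxProblem.opB, pair_sub, smul_pair, pair_fst, pair_snd]
        congr 1
        rw [hry]; module
      rw [this, norm_pair_sq, norm_neg]
    have h4 : (A.eps₀ / ((o.k : ℝ) + 1)) ^ 2 < ‖rx‖ ^ 2 + ‖ry‖ ^ 2 := by
      rw [not_le, Real.lt_sqrt hτ] at h1
      exact h1
    have e4 : ‖pair x' y' - pair xs ys‖ ^ 2 = ‖-(A.L⁻¹ • s'.z) - xs‖ ^ 2 + ‖s'.y - ys‖ ^ 2 := by
      rw [pair_sub, norm_pair_sq]; rfl
    rw [e3, e4] at h2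
    refine h4.trans_le (h2.trans ?_)
    rw [MinimaxParams.Λ, mul_assoc (49 / 9 * _)]
    gcongr

end Middle

/-! ### Termination of the minimax method -/

section Run

variable {Q V W : Type} [NormedAddCommGroup V] [InnerProductSpace ℝ V]
  [NormedAddCommGroup W] [InnerProductSpace ℝ W]

/-- One step of the method, on pairs of a configuration and the list of queries made so far. -/
def next (O : MinimaxOracle Q V W) (A : MinimaxParams V W) (c : Config V W × List Q) :
    Config V W × List Q := (step O A c.1).run c.2

/-- The second pair is reached from the first one by finitely many steps. -/
def Reaches (O : MinimaxOracle Q V W) (A : MinimaxParams V W) (c c' : Config V W × List Q) : Prop :=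
  ∃ n, (next O A)^[n] c = c'

theorem Reaches.trans {O : MinimaxOracle Q V W} {A : MinimaxParams V W}
    {c c' c'' : Config V W × List Q} (h : Reaches O A c c') (h' : Reaches O A c' c'') :
    Reaches O A c c'' := by
  obtain ⟨n, rfl⟩ := h
  obtain ⟨n', rfl⟩ := h'
  exact ⟨n' + n, Function.iterate_add_apply _ _ _ _⟩

theorem Reaches.single {O : MinimaxOracle Q V W} {A : MinimaxParams V W}
    {c c' : Config V W × List Q} (h : next O A c = c') : Reaches O A c c' := ⟨1, h⟩

/-- All queries made from `c` on, and those already recorded in `c`, are good. -/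
def AllGood (good : Q → Prop) (O : MinimaxOracle Q V W) (A : MinimaxParams V W)
    (c : Config V W × List Q) : Prop := ∀ n, ∀ e ∈ ((next O A)^[n] c).2, good e

theorem AllGood.of_reaches {good : Q → Prop} {O : MinimaxOracle Q V W} {A : MinimaxParams V W}
    {c c' : Config V W × List Q} (h : AllGood good O A c) (h' : Reaches O A c c') :
    AllGood good O A c' := by
  obtain ⟨n', rfl⟩ := h'
  intro n e he
  rw [← Function.iterate_add_apply] at he
  exact h _ e he

theorem AllGood.here {good : Q → Prop} {O : MinimaxOracle Q V W} {A : MinimaxParams V W}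
    {c : Config V W × List Q} (h : AllGood good O A c) : ∀ e ∈ c.2, good e := h 0

theorem next_mid {O : MinimaxOracle Q V W} {A : MinimaxParams V W} {o : OuterState V W}
    {s : MidState V W} {l l' : List Q} {i : InnerState V W} (h : innerInit O A o s l = (i, l')) :
    next O A (Config.mid o s, l) = (Config.inner o s i, l') := by
  have : next O A (Config.mid o s, l) =
    (fun p : InnerState V W × List Q => (Config.inner o s p.1, p.2)) (innerInit O A o s l) := rfl
  rw [this, h]

open Classical in
theorem next_inner_of_guard {O : MinimaxOracle Q V W} {A : MinimaxParams V W}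
    {o : OuterState V W} {s : MidState V W} {l l' : List Q} {i i' : InnerState V W}
    (hg : innerGuard A i) (h : innerStep O A o i l = (i', l')) :
    next O A (Config.inner o s i, l) = (Config.inner o s i', l') := by
  have h0 : next O A (Config.inner o s i, l) = (if innerGuard A i then
      (do
        let i' ← innerStep O A o i
        return Config.inner o s i' : Comp Q (Config V W))
      else midFinish O A o s i) l := rfl
  have h1 : (do
        let i' ← innerStep O A o i
        return Config.inner o s i' : Comp Q (Config V W)) l =
    (fun p : InnerState V W × List Q => (Config.inner o s p.1, p.2)) (innerStep O A o i l) := rfl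
  rw [h0, if_pos hg, h1, h]

open Classical in
theorem next_inner_of_not_guard {O : MinimaxOracle Q V W} {A : MinimaxParams V W}
    {o : OuterState V W} {s : MidState V W} {l : List Q} {i : InnerState V W}
    (hg : ¬ innerGuard A i) :
    next O A (Config.inner o s i, l) = midFinish O A o s i l := by
  have h0 : next O A (Config.inner o s i, l) = (if innerGuard A i then
      (do
        let i' ← innerStep O A o i
        return Config.inner o s i' : Comp Q (Config V W))
      else midFinish O A o s i) l := rfl
  rw [h0, if_neg hg]

variable {A : MinimaxParams V W} {M : MinimaxProblem V W} {o : OuterState V W}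
  {lg : QueryLog Q V W} {good : Q → Prop}

theorem inner_loop (hM : M.Regular A.L) (hA : A.Positive)
    (hΩ : ∀ x y, (∀ e ∈ lg.grad x y, good e) → pair x y ∈ M.Ω) (s : MidState V W) (d : ℕ) :
    ∀ (i : InnerState V W) (l : List Q), InnerInv A M o s i → 30 * A.κ ≤ (i.t : ℝ) + d →
      AllGood good (M.oracle lg) A (Config.inner o s i, l) →
      ∃ i' l', Reaches (M.oracle lg) A (Config.inner o s i, l) (Config.inner o s i', l') ∧
        InnerInv A M o s i' ∧ ¬ innerGuard A i' ∧
        ∀ c, lg.Cheap c → l'.countP c ≤ l.countP c + 4 * d := by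
  induction d with
  | zero =>
    intro i l hi ht _
    exact ⟨i, l, ⟨0, rfl⟩, hi, hi.not_guard hM hA (by simpa using ht), fun _ _ => le_rfl⟩
  | succ d ih =>
    intro i l hi ht hgood
    by_cases hg : innerGuard A i
    · obtain ⟨i₁, l₁, h1, h2, h3⟩ := innerStep_spec (lg := lg) hM hA hΩ s hi l
      have hr : Reaches (M.oracle lg) A (Config.inner o s i, l) (Config.inner o s i₁, l₁) :=
        .single (next_inner_of_guard hg h1)
      have hgood₁ := hgood.of_reaches hr
      obtain ⟨h4, h5⟩ := h3 hgood₁.here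
      obtain ⟨i', l', h6, h7, h8, h9⟩ := ih i₁ l₁ h4 (by
        rw [h5]; push_cast at ht ⊢; linarith) hgood₁
      refine ⟨i', l', hr.trans h6, h7, h8, fun c hc => ?_⟩
      have := h2 c hc
      have := h9 c hc
      lia
    · exact ⟨i, l, ⟨0, rfl⟩, hi, hg, fun _ _ => by lia⟩

/-- A bound on the number of queries of one kind in one iteration of the solver. -/
def MinimaxParams.cost (A : MinimaxParams V W) : ℕ := 4 * ⌈30 * A.κ⌉₊ + 8

/-- The solver has returned a `τ`-stationary point, which is either the final output or the start of
the next outer iteration. -/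
def Returned (A : MinimaxParams V W) (M : MinimaxProblem V W) (o : OuterState V W)
    (c' : Config V W) : Prop :=
  ∃ x y, ApproxSaddle A M o (A.eps₀ / ((o.k : ℝ) + 1)) x y ∧
    (c' = Config.halted x y ∧ ‖x - o.x‖ ≤ A.eps / (4 * A.L) ∨
      c' = midInit A { k := o.k + 1, x := x, y := y } ∧ A.eps / (4 * A.L) < ‖x - o.x‖)

theorem mid_iteration (hM : M.Regular A.L) (hA : A.Positive)
    (hΩ : ∀ x y, (∀ e ∈ lg.grad x y, good e) → pair x y ∈ M.Ω) {xs : V} {ys : W}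
    (h : IsSaddle A M o xs ys) {s : MidState V W} {Ψ : ℝ} (hs : MidInv A M o xs ys s Ψ) {l : List Q}
    (hgood : AllGood good (M.oracle lg) A (Config.mid o s, l)) :
    ∃ c' l', Reaches (M.oracle lg) A (Config.mid o s, l) (c', l') ∧
      (∀ c, lg.Cheap c → l'.countP c ≤ l.countP c + A.cost) ∧
      ((∃ s', c' = Config.mid o s' ∧ MidInv A M o xs ys s' ((1 - A.αbar / 2) * Ψ) ∧
          (A.eps₀ / ((o.k : ℝ) + 1)) ^ 2 < A.Λ * ((1 - A.αbar / 2) * Ψ)) ∨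
        Returned A M o c') := by
  obtain ⟨i, l₁, h1, h2, h3⟩ := innerInit_spec (lg := lg) (o := o) hM hA hΩ s l
  have hr₁ : Reaches (M.oracle lg) A (Config.mid o s, l) (Config.inner o s i, l₁) :=
    .single (next_mid h1)
  have hg₁ := hgood.of_reaches hr₁
  obtain ⟨h4, h5⟩ := h3 hg₁.here
  obtain ⟨i₂, l₂, h6, h7, h8, h9⟩ := inner_loop hM hA hΩ s ⌈30 * A.κ⌉₊ i l₁ h4
    (by rw [h5]; simpa using Nat.le_ceil _) hg₁
  have hg₂ := hg₁.of_reaches h6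
  obtain ⟨c', l', h10, h11, h12⟩ := midFinish_spec (lg := lg) hM hA hΩ h hs h7 h8 l₂
  have hr₃ : Reaches (M.oracle lg) A (Config.inner o s i₂, l₂) (c', l') :=
    .single ((next_inner_of_not_guard h8).trans h10)
  refine ⟨c', l', (hr₁.trans h6).trans hr₃, fun c hc => ?_, h12 (hg₂.of_reaches hr₃).here⟩
  have := h2 c hc
  have := h9 c hc
  have := h11 c hc
  rw [MinimaxParams.cost]
  lia

theorem mid_loop (hM : M.Regular A.L) (hA : A.Positive)
    (hΩ : ∀ x y, (∀ e ∈ lg.grad x y, good e) → pair x y ∈ M.Ω) {xs : V} {ys : W}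
    (h : IsSaddle A M o xs ys) (J : ℕ) :
    ∀ {s : MidState V W} {Ψ : ℝ}, MidInv A M o xs ys s Ψ → ∀ {l : List Q},
      AllGood good (M.oracle lg) A (Config.mid o s, l) →
      A.Λ * ((1 - A.αbar / 2) ^ (J + 1) * Ψ) ≤ (A.eps₀ / ((o.k : ℝ) + 1)) ^ 2 →
      ∃ c' l', Reaches (M.oracle lg) A (Config.mid o s, l) (c', l') ∧
        (∀ c, lg.Cheap c → l'.countP c ≤ l.countP c + (J + 1) * A.cost) ∧ Returned A M o c' := by
  induction J with
  | zero =>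
    intro s Ψ hs l hgood hτ
    obtain ⟨c', l', h1, h2, h3⟩ := mid_iteration hM hA hΩ h hs hgood
    refine ⟨c', l', h1, by simpa using h2, h3.resolve_left ?_⟩
    rintro ⟨s', -, -, h4⟩
    rw [zero_add, pow_one] at hτ
    linarith
  | succ J ih =>
    intro s Ψ hs l hgood hτ
    obtain ⟨c', l', h1, h2, h3⟩ := mid_iteration hM hA hΩ h hs hgood
    rcases h3 with ⟨s', rfl, h4, -⟩ | h3
    · obtain ⟨c'', l'', h5, h6, h7⟩ := ih h4 (hgood.of_reaches h1)
        (by rw [pow_succ _ (J + 1), mul_assoc] at hτ; exact hτ)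
      refine ⟨c'', l'', h1.trans h5, fun c hc => ?_, h7⟩
      have := h2 c hc
      have := h6 c hc
      calc _ ≤ _ := this
        _ ≤ (l.countP c + A.cost) + (J + 1) * A.cost := by gcongr
        _ = _ := by ring
    · refine ⟨c', l', h1, fun c hc => (h2 c hc).trans ?_, h3⟩
      gcongr
      exact Nat.le_mul_of_pos_left _ (by lia)

/-- Bounds on the values of a minimax problem: `D2` bounds the squared diameter of `X`, `Hlo` the
perturbed objective from below, `Hup` its values `min_x` from above, and `Flo` its values `max_y`
from below. -/
structure MinimaxProblem.Bounds (M : MinimaxProblem V W) (A : MinimaxParams V W)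
    (D2 Hup Hlo Flo : ℝ) : Prop where
  diamX : ∀ x ∈ M.X, ∀ x' ∈ M.X, ‖x - x'‖ ^ 2 ≤ D2
  diamY : ∀ y ∈ M.Y, ∀ y' ∈ M.Y, ‖y - y'‖ ≤ A.D
  lo : ∀ x ∈ M.X, ∀ y ∈ M.Y, Hlo ≤ M.Heps A x y
  up : ∀ y ∈ M.Y, ∀ B, (∀ x ∈ M.X, B ≤ M.Heps A x y) → B ≤ Hup
  flo : ∀ x ∈ M.X, ∃ y ∈ M.Y, Flo ≤ M.Heps A x y

/-- The bound on the initial potential of the solver. -/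
def MinimaxParams.Ψ₀ (A : MinimaxParams V W) (D2 Hup Hlo : ℝ) : ℝ :=
  2 * A.L * D2 + A.ηy⁻¹ * A.D ^ 2 + 2 / A.αbar * (A.L / 2 * D2 + (Hup - Hlo + A.L * D2))

theorem MinimaxProblem.Hbar_eq (x : V) (y : W) :
    M.Hbar A o x y = M.Heps A x y + A.L * ‖x - o.x‖ ^ 2 := by
  rw [Hbar, Heps]; ring

theorem midInv_init (hM : M.Regular A.L) (hA : A.Positive) {D2 Hup Hlo Flo : ℝ}
    (hB : M.Bounds A D2 Hup Hlo Flo) {xs : V} {ys : W} (h : IsSaddle A M o xs ys)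
    (hx : o.x ∈ M.X) (hy : o.y ∈ M.Y) :
    MidInv A M o xs ys { z := -(A.σx • o.x), y := o.y, zf := -(A.σx • o.x), yf := o.y }
      (A.Ψ₀ D2 Hup Hlo) := by
  have hL := hA.L
  have hη := hA.ηy_pos
  have hα := hA.αbar_pos
  refine ⟨hy, A.L / 2 * D2 - Hlo, fun x hx' => ?_, ?_⟩
  · have h1 := hB.lo x hx' o.y hy
    have h2 : A.L / 2 * ‖x - o.x‖ ^ 2 ≤ A.L / 2 * D2 := by
      gcongr; exact hB.diamX x hx' o.x hx
    have h3 : 0 ≤ A.L * ‖x - o.x‖ ^ 2 := by positivity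
    rw [MinimaxParams.σx, smul_neg, inv_smul_smul₀ hL.ne', ← sub_eq_add_neg,
      MinimaxProblem.Hbar_eq]
    linarith
  · have h1 : M.Hbar A o xs ys - A.L * D2 ≤ Hup := by
      refine hB.up ys h.2.1 _ fun x hx' => ?_
      have h2 := MinimaxProblem.Hbar_convex (o := o) hM h.1 hx' h.2.1
      rw [neg_add_cancel, inner_zero_left, MinimaxProblem.Hbar_eq x] at h2
      have h3 : A.L * ‖x - o.x‖ ^ 2 ≤ A.L * D2 := by
        gcongr; exact hB.diamX x hx' o.x hx
      have h4 : 0 ≤ A.L / 2 * ‖x - xs‖ ^ 2 := by positivity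
      linarith
    have h2 : 2 / A.L * ‖-(A.σx • o.x) - -(A.L • xs)‖ ^ 2 ≤ 2 * A.L * D2 := by
      rw [MinimaxParams.σx, show -(A.L • o.x) - -(A.L • xs) = -(A.L • (o.x - xs)) by
        rw [smul_sub]; abel, norm_neg, norm_smul, mul_pow, Real.norm_eq_abs, sq_abs]
      calc _ = 2 * A.L * ‖o.x - xs‖ ^ 2 := by field_simp
        _ ≤ _ := by gcongr; exact hB.diamX _ hx _ h.1.1
    have h3 : A.ηy⁻¹ * ‖o.y - ys‖ ^ 2 ≤ A.ηy⁻¹ * A.D ^ 2 := by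
      gcongr; exact hB.diamY _ hy _ h.2.1
    rw [MinimaxParams.Ψ₀]
    refine add_le_add (add_le_add h2 h3) (mul_le_mul_of_nonneg_left ?_ (by positivity))
    linarith

/-- The quantity under the logarithm in the complexity bound. -/
def MinimaxParams.Cbound (A : MinimaxParams V W) (D2 Hup Hlo : ℝ) : ℝ :=
  36 / 49 * (A.Λ * A.Ψ₀ D2 Hup Hlo) / A.eps₀ ^ 2

/-- A bound on the number of iterations of the solver in outer iteration `k`. -/
def MinimaxParams.midBound (A : MinimaxParams V W) (D2 Hup Hlo : ℝ) (k : ℕ) : ℝ :=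
  2 / A.αbar * (1 + max (Real.log (A.Cbound D2 Hup Hlo)) 0 + 2 * Real.log ((k : ℝ) + 1))

theorem exists_mid_count (hA : A.Positive) (D2 Hup Hlo : ℝ) (k : ℕ) :
    ∃ J : ℕ, ((J + 1 : ℕ) : ℝ) ≤ A.midBound D2 Hup Hlo k ∧
      A.Λ * ((1 - A.αbar / 2) ^ (J + 1) * A.Ψ₀ D2 Hup Hlo) ≤ (A.eps₀ / ((k : ℝ) + 1)) ^ 2 := by
  have hα := hA.αbar_pos
  have hα1 := MinimaxParams.αbar_le_one (A := A)
  have hε := hA.eps₀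
  set C := A.Cbound D2 Hup Hlo with hC
  set b := max (Real.log C) 0 with hb
  have hk : (0 : ℝ) < (k : ℝ) + 1 := by positivity
  have hlk : 0 ≤ Real.log ((k : ℝ) + 1) := Real.log_nonneg (by linarith [Nat.cast_nonneg (α := ℝ) k])
  have hb0 : 0 ≤ b := le_max_right _ _
  have h49 : Real.log (49 / 36) ≤ 13 / 36 := by
    have := Real.log_le_sub_one_of_pos (x := 49 / 36) (by norm_num)
    linarith
  have h490 : 0 ≤ Real.log (49 / 36) := Real.log_nonneg (by norm_num)
  set y := Real.log (49 / 36) + b + 2 * Real.log ((k : ℝ) + 1) with hy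
  set x := 2 / A.αbar * y with hx
  have hy0 : 0 ≤ y := by positivity
  have hx0 : 0 ≤ x := by positivity
  have h2α : 2 ≤ 2 / A.αbar := by rw [le_div_iff₀ hα]; linarith
  refine ⟨⌊x⌋₊, ?_, ?_⟩
  · have h1 := Nat.floor_le hx0
    push_cast
    have h2 : A.midBound D2 Hup Hlo k = x + 2 / A.αbar * (1 - Real.log (49 / 36)) := by
      rw [MinimaxParams.midBound, hx, hy]; ring
    have h3 : 2 * (23 / 36) ≤ 2 / A.αbar * (1 - Real.log (49 / 36)) := by
      gcongr; linarith
    rw [h2]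
    linarith
  · have h1 : A.Λ * A.Ψ₀ D2 Hup Hlo = 49 / 36 * C * A.eps₀ ^ 2 := by
      rw [hC, MinimaxParams.Cbound]; field_simp
    have hpow : (1 - A.αbar / 2) ^ (⌊x⌋₊ + 1) ≤ Real.exp (-y) := by
      have h2 : 1 - A.αbar / 2 ≤ Real.exp (-(A.αbar / 2)) := by
        have := Real.add_one_le_exp (-(A.αbar / 2)); linarith
      calc _ ≤ Real.exp (-(A.αbar / 2)) ^ (⌊x⌋₊ + 1) := by
            gcongr; linarith
        _ = Real.exp (-(A.αbar / 2) * (⌊x⌋₊ + 1 : ℕ)) := by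
            rw [← Real.exp_nat_mul, mul_comm]
        _ ≤ Real.exp (-y) := by
            rw [Real.exp_le_exp]
            have h3 : x ≤ (⌊x⌋₊ + 1 : ℕ) := by
              push_cast; exact (Nat.lt_floor_add_one x).le
            have h4 : A.αbar / 2 * x = y := by rw [hx]; field_simp
            have h5 : A.αbar / 2 * x ≤ A.αbar / 2 * (⌊x⌋₊ + 1 : ℕ) := by gcongr
            linarith
    have hp0 : 0 ≤ (1 - A.αbar / 2) ^ (⌊x⌋₊ + 1) := pow_nonneg (by linarith) _
    rw [mul_left_comm, h1]
    have hCb : C ≤ Real.exp b := by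
      rcases le_or_gt C 0 with h | h
      · exact h.trans (Real.exp_pos _).le
      · rw [← Real.log_le_iff_le_exp h]; exact le_max_left _ _
    have hexp : Real.exp (-y) = (49 / 36)⁻¹ * (Real.exp b)⁻¹ * (((k : ℝ) + 1) ^ 2)⁻¹ := by
      rw [hy, neg_add, neg_add, Real.exp_add, Real.exp_add, Real.exp_neg, Real.exp_neg,
        Real.exp_neg, Real.exp_log (by norm_num),
        show 2 * Real.log ((k : ℝ) + 1) = Real.log (((k : ℝ) + 1) ^ 2) by
          rw [Real.log_pow]; norm_num, Real.exp_log (by positivity)]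
    calc (1 - A.αbar / 2) ^ (⌊x⌋₊ + 1) * (49 / 36 * C * A.eps₀ ^ 2) ≤
          (1 - A.αbar / 2) ^ (⌊x⌋₊ + 1) * (49 / 36 * Real.exp b * A.eps₀ ^ 2) := by gcongr
      _ ≤ Real.exp (-y) * (49 / 36 * Real.exp b * A.eps₀ ^ 2) := by gcongr
      _ = (A.eps₀ / ((k : ℝ) + 1)) ^ 2 := by
        rw [hexp]; field_simp

/-- The constant in front of `τ²` in the descent inequality of the outer loop. -/
def MinimaxParams.slack (A : MinimaxParams V W) : ℝ := 1 / (2 * A.L) + A.D / A.eps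

/-- Sufficient decrease of `max_y` of the perturbed objective in an outer iteration. -/
theorem ApproxSaddle.descent (hM : M.Regular A.L) (hA : A.Positive) {τ : ℝ} {x : V} {y : W}
    (h : ApproxSaddle A M o τ x y) (hx : o.x ∈ M.X) {m : ℝ} (hm : ∀ y' ∈ M.Y, M.Heps A o.x y' ≤ m)
    {y' : W} (hy' : y' ∈ M.Y) :
    M.Heps A x y' ≤ m - A.L * ‖x - o.x‖ ^ 2 + A.slack * τ ^ 2 := by
  obtain ⟨bx, bY, hbx, hbY, hτ⟩ := h
  have hL := hA.L
  have hσ := hA.σy_pos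
  have h1 := MinimaxProblem.Hbar_concave (o := o) hM hA hbx.1 hbY hy'
  have h2 := MinimaxProblem.Hbar_convex (o := o) hM hbx hx hbY.1
  have h3 := hm y hbY.1
  rw [MinimaxProblem.Hbar_eq o.x, sub_self, norm_zero] at h2
  rw [MinimaxProblem.Hbar_eq x y'] at h1
  -- Young's inequality in both blocks
  have hy1 : -inner ℝ (bx + M.gbX A o x y) (o.x - x) - A.L / 2 * ‖o.x - x‖ ^ 2 ≤
      1 / (2 * A.L) * ‖bx + M.gbX A o x y‖ ^ 2 := by
    set r := bx + M.gbX A o x y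
    have := sq_nonneg ‖r + A.L • (o.x - x)‖
    rw [norm_add_sq_real, real_inner_smul_right, norm_smul, mul_pow, Real.norm_eq_abs, sq_abs] at this
    have h5 := mul_nonneg (by positivity : 0 ≤ 1 / (2 * A.L)) this
    have h6 : 1 / (2 * A.L) * (‖r‖ ^ 2 + 2 * (A.L * inner ℝ r (o.x - x)) +
      A.L ^ 2 * ‖o.x - x‖ ^ 2) = 1 / (2 * A.L) * ‖r‖ ^ 2 + inner ℝ r (o.x - x) +
      A.L / 2 * ‖o.x - x‖ ^ 2 := by field_simp
    linarith
  have hy2 : -inner ℝ (bY - M.gbY A x y) (y' - y) - A.σy / 2 * ‖y' - y‖ ^ 2 ≤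
      A.D / A.eps * ‖bY - M.gbY A x y‖ ^ 2 := by
    set r := bY - M.gbY A x y
    have := sq_nonneg ‖r + A.σy • (y' - y)‖
    rw [norm_add_sq_real, real_inner_smul_right, norm_smul, mul_pow, Real.norm_eq_abs, sq_abs] at this
    have h5 := mul_nonneg (by positivity : 0 ≤ 1 / (2 * A.σy)) this
    have h6 : 1 / (2 * A.σy) * (‖r‖ ^ 2 + 2 * (A.σy * inner ℝ r (y' - y)) +
      A.σy ^ 2 * ‖y' - y‖ ^ 2) = 1 / (2 * A.σy) * ‖r‖ ^ 2 + inner ℝ r (y' - y) +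
      A.σy / 2 * ‖y' - y‖ ^ 2 := by field_simp
    have h7 : 1 / (2 * A.σy) = A.D / A.eps := by
      have := hA.D; have := hA.eps
      rw [MinimaxParams.σy]; field_simp
    rw [h6, h7] at h5
    linarith
  have h4 : 1 / (2 * A.L) * ‖bx + M.gbX A o x y‖ ^ 2 + A.D / A.eps * ‖bY - M.gbY A x y‖ ^ 2 ≤
      A.slack * τ ^ 2 := by
    have := hA.D; have := hA.eps
    have s1 : 0 ≤ 1 / (2 * A.L) := by positivity
    have s2 : 0 ≤ A.D / A.eps := by positivity
    have t1 := sq_nonneg ‖bx + M.gbX A o x y‖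
    have t2 := sq_nonneg ‖bY - M.gbY A x y‖
    calc _ ≤ A.slack * ‖bx + M.gbX A o x y‖ ^ 2 + A.slack * ‖bY - M.gbY A x y‖ ^ 2 := by
          rw [MinimaxParams.slack]; gcongr <;> linarith
      _ = A.slack * (‖bx + M.gbX A o x y‖ ^ 2 + ‖bY - M.gbY A x y‖ ^ 2) := by ring
      _ ≤ _ := by
          gcongr
          rw [MinimaxParams.slack]; positivity
  linarith

theorem sum_inv_sq_le_two (k : ℕ) : ∑ i ∈ Finset.range k, (((i : ℝ) + 1) ^ 2)⁻¹ ≤ 2 := by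
  have : ∀ k : ℕ, ∑ i ∈ Finset.range (k + 1), (((i : ℝ) + 1) ^ 2)⁻¹ ≤ 2 - 1 / ((k : ℝ) + 1) := by
    intro k
    induction k with
    | zero => simp; norm_num
    | succ k ih =>
      rw [Finset.sum_range_succ]
      have h : (((k + 1 : ℕ) : ℝ) + 1) = (k : ℝ) + 2 := by push_cast; ring
      rw [h]
      have hk : (0 : ℝ) < (k : ℝ) + 1 := by positivity
      have h2 : (((k : ℝ) + 2) ^ 2)⁻¹ ≤ 1 / ((k : ℝ) + 1) - 1 / ((k : ℝ) + 2) := by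
        rw [div_sub_div _ _ hk.ne' (by linarith), inv_eq_one_div]
        rw [div_le_div_iff₀ (by positivity) (by positivity)]
        nlinarith
      linarith
  cases k with
  | zero => simp
  | succ k =>
    have h : 0 ≤ 1 / ((k : ℝ) + 1) := by positivity
    linarith [this k]

/-- The invariants at the start of an outer iteration; `m₀` bounds `max_y` of the perturbed objective
at the initial point. -/
structure OuterInv (A : MinimaxParams V W) (M : MinimaxProblem V W) (lg : QueryLog Q V W)
    (D2 Hup Hlo m₀ : ℝ) (o : OuterState V W) (l : List Q) : Prop where
  memX : o.x ∈ M.X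
  memY : o.y ∈ M.Y
  value : ∀ y ∈ M.Y, M.Heps A o.x y ≤ m₀ - o.k * (A.eps ^ 2 / (16 * A.L)) +
    A.slack * A.eps₀ ^ 2 * ∑ i ∈ Finset.range o.k, (((i : ℝ) + 1) ^ 2)⁻¹
  count : ∀ c, lg.Cheap c →
    (l.countP c : ℝ) ≤ A.cost * ∑ i ∈ Finset.range o.k, A.midBound D2 Hup Hlo i

theorem MinimaxParams.Positive.slack_pos (hA : A.Positive) : 0 < A.slack := by
  have := hA.D; have := hA.eps; have := hA.L
  rw [MinimaxParams.slack]; positivity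

/-- The number of outer iterations is bounded by the available decrease. -/
theorem OuterInv.k_le (hA : A.Positive) {D2 Hup Hlo Flo m₀ : ℝ} (hB : M.Bounds A D2 Hup Hlo Flo)
    {l : List Q} (h : OuterInv A M lg D2 Hup Hlo m₀ o l) :
    (o.k : ℝ) ≤ 16 * A.L / A.eps ^ 2 * (m₀ - Flo + 2 * A.slack * A.eps₀ ^ 2) := by
  obtain ⟨y, hy, hF⟩ := hB.flo o.x h.memX
  have h1 := h.value y hy
  have hs := hA.slack_pos
  have hL := hA.L
  have hε := hA.eps
  have h2 : A.slack * A.eps₀ ^ 2 * ∑ i ∈ Finset.range o.k, (((i : ℝ) + 1) ^ 2)⁻¹ ≤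
      A.slack * A.eps₀ ^ 2 * 2 := by
    gcongr; exact sum_inv_sq_le_two _
  have h3 : (o.k : ℝ) * (A.eps ^ 2 / (16 * A.L)) ≤ m₀ - Flo + 2 * A.slack * A.eps₀ ^ 2 := by
    linarith
  calc (o.k : ℝ) = 16 * A.L / A.eps ^ 2 * (o.k * (A.eps ^ 2 / (16 * A.L))) := by field_simp
    _ ≤ _ := by gcongr

theorem outer_loop (hM : M.Regular A.L) (hA : A.Positive)
    (hΩ : ∀ x y, (∀ e ∈ lg.grad x y, good e) → pair x y ∈ M.Ω) {D2 Hup Hlo Flo m₀ : ℝ}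
    (hB : M.Bounds A D2 Hup Hlo Flo) (d : ℕ) :
    ∀ (o : OuterState V W) (l : List Q), OuterInv A M lg D2 Hup Hlo m₀ o l →
      16 * A.L / A.eps ^ 2 * (m₀ - Flo + 2 * A.slack * A.eps₀ ^ 2) < (o.k : ℝ) + d →
      AllGood good (M.oracle lg) A (midInit A o, l) →
      ∃ (o' : OuterState V W) (x : V) (y : W) (l' : List Q),
        Reaches (M.oracle lg) A (midInit A o, l) (Config.halted x y, l') ∧
        (o'.k : ℝ) ≤ 16 * A.L / A.eps ^ 2 * (m₀ - Flo + 2 * A.slack * A.eps₀ ^ 2) ∧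
        ApproxSaddle A M o' (A.eps₀ / ((o'.k : ℝ) + 1)) x y ∧ ‖x - o'.x‖ ≤ A.eps / (4 * A.L) ∧
        (∀ y' ∈ M.Y, M.Heps A x y' ≤ m₀ + 2 * A.slack * A.eps₀ ^ 2) ∧
        ∀ c, lg.Cheap c →
          (l'.countP c : ℝ) ≤ A.cost * ∑ i ∈ Finset.range (o'.k + 1), A.midBound D2 Hup Hlo i := by
  induction d with
  | zero =>
    intro o l h hk _
    have := h.k_le hA hB
    simp only [Nat.cast_zero, add_zero] at hk
    linarith
  | succ d ih =>
    intro o l h hk hgood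
    obtain ⟨xs, ys, hsad⟩ := M.exists_saddle (o := o) hM hA
    obtain ⟨J, hJ, hJ'⟩ := exists_mid_count hA D2 Hup Hlo o.k
    obtain ⟨c', l', h1, h2, x, y, h3, h4⟩ := mid_loop hM hA hΩ hsad J
      (midInv_init hM hA hB hsad h.memX h.memY) hgood hJ'
    have hcount : ∀ c, lg.Cheap c →
        (l'.countP c : ℝ) ≤ A.cost * ∑ i ∈ Finset.range (o.k + 1), A.midBound D2 Hup Hlo i := by
      intro c hc
      have e1 := h.count c hc
      have e2 : (l'.countP c : ℝ) ≤ l.countP c + ((J + 1 : ℕ) : ℝ) * A.cost := by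
        exact_mod_cast h2 c hc
      have e3 : ((J + 1 : ℕ) : ℝ) * A.cost ≤ A.midBound D2 Hup Hlo o.k * A.cost := by gcongr
      rw [Finset.sum_range_succ, mul_add]
      linarith
    have hL := hA.L
    have hs := hA.slack_pos
    have hdesc := fun y' hy' => h3.descent hM hA h.memX h.value (y' := y') hy'
    have hsum : ∑ i ∈ Finset.range (o.k + 1), (((i : ℝ) + 1) ^ 2)⁻¹ =
      ∑ i ∈ Finset.range o.k, (((i : ℝ) + 1) ^ 2)⁻¹ + (((o.k : ℝ) + 1) ^ 2)⁻¹ :=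
        Finset.sum_range_succ _ _
    have hτ : A.slack * (A.eps₀ / ((o.k : ℝ) + 1)) ^ 2 =
        A.slack * A.eps₀ ^ 2 * (((o.k : ℝ) + 1) ^ 2)⁻¹ := by
      rw [div_pow]; ring
    rcases h4 with ⟨rfl, h5⟩ | ⟨rfl, h5⟩
    · refine ⟨o, x, y, l', h1, h.k_le hA hB, h3, h5, fun y' hy' => ?_, hcount⟩
      have e1 := hdesc y' hy'
      have e2 : A.slack * A.eps₀ ^ 2 * ∑ i ∈ Finset.range (o.k + 1), (((i : ℝ) + 1) ^ 2)⁻¹ ≤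
          A.slack * A.eps₀ ^ 2 * 2 := by
        gcongr; exact sum_inv_sq_le_two _
      rw [hsum, mul_add] at e2
      rw [hτ] at e1
      have e3 : 0 ≤ A.L * ‖x - o.x‖ ^ 2 := by positivity
      have e4 : 0 ≤ (o.k : ℝ) * (A.eps ^ 2 / (16 * A.L)) := by have := hA.eps; positivity
      linarith
    · obtain ⟨bx, bY, hbx, hbY, -⟩ := h3
      obtain ⟨o', x', y', l'', g1, g2⟩ := ih { k := o.k + 1, x := x, y := y } l'
        ⟨hbx.1, hbY.1, fun y' hy' => by
          have e1 := hdesc y' hy'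
          rw [hτ] at e1
          have e2 : A.eps ^ 2 / (16 * A.L) ≤ A.L * ‖x - o.x‖ ^ 2 := by
            have := hA.eps
            calc A.eps ^ 2 / (16 * A.L) = A.L * (A.eps / (4 * A.L)) ^ 2 := by field_simp; norm_num
              _ ≤ _ := by gcongr
          dsimp only
          rw [hsum, mul_add]
          push_cast
          linarith, hcount⟩
        (by push_cast at hk ⊢; linarith) (hgood.of_reaches h1)
      exact ⟨o', x', y', l'', h1.trans g1, g2⟩

/-- The minimax method terminates with an approximate stationary point; the number of queries of each
kind and the value of the output are controlled. -/
theorem minimax_method_terminates (hM : M.Regular A.L) (hA : A.Positive)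
    (hΩ : ∀ x y, (∀ e ∈ lg.grad x y, good e) → pair x y ∈ M.Ω) {D2 Hup Hlo Flo m₀ : ℝ}
    (hB : M.Bounds A D2 Hup Hlo Flo) (hx : A.xinit ∈ M.X) (hy : A.yinit ∈ M.Y)
    (hm₀ : ∀ y ∈ M.Y, M.Heps A A.xinit y ≤ m₀)
    (hgood : ∀ j, ∀ e ∈ (run (M.oracle lg) A j).2, good e) :
    ∃ (j : ℕ) (o : OuterState V W) (x : V) (y : W) (l : List Q),
      run (M.oracle lg) A j = (Config.halted x y, l) ∧
      (o.k : ℝ) ≤ 16 * A.L / A.eps ^ 2 * (m₀ - Flo + 2 * A.slack * A.eps₀ ^ 2) ∧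
      ApproxSaddle A M o (A.eps₀ / ((o.k : ℝ) + 1)) x y ∧ ‖x - o.x‖ ≤ A.eps / (4 * A.L) ∧
      (∀ y' ∈ M.Y, M.Heps A x y' ≤ m₀ + 2 * A.slack * A.eps₀ ^ 2) ∧
      ∀ c, lg.Cheap c →
        (l.countP c : ℝ) ≤ A.cost * ∑ i ∈ Finset.range (o.k + 1), A.midBound D2 Hup Hlo i := by
  obtain ⟨d, hd⟩ := exists_nat_gt (16 * A.L / A.eps ^ 2 * (m₀ - Flo + 2 * A.slack * A.eps₀ ^ 2))
  obtain ⟨o', x, y, l', ⟨j, hj⟩, h2⟩ := outer_loop (m₀ := m₀) hM hA hΩ hB d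
    { k := 0, x := A.xinit, y := A.yinit } [] ⟨hx, hy, by simpa using hm₀, by simp⟩
    (by simpa using hd) hgood
  exact ⟨j, o', x, y, l', hj, h2⟩

end Run

/-! ### Extended real valued convex functions, proximal maps and subdifferentials -/

section Convex

/-- A one-sided linear upper bound near `0⁺` bounds the derivative. -/
theorem deriv_le_of_le_linear {ψ : ℝ → ℝ} {D K : ℝ} (hψ : HasDerivAt ψ D 0)
    (h : ∀ t, 0 < t → t ≤ 1 → ψ t ≤ ψ 0 + t * K) : D ≤ K := by
  have h1 := hψ.hasDerivWithinAt (s := Set.Ioi 0)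
  rw [hasDerivWithinAt_iff_tendsto_slope' (by simp)] at h1
  refine le_of_tendsto h1 ?_
  have : Set.Ioc (0 : ℝ) 1 ∈ nhdsWithin (0 : ℝ) (Set.Ioi 0) := Ioc_mem_nhdsGT one_pos
  filter_upwards [this] with t ht
  rw [slope_def_field, div_le_iff₀ (by linarith [ht.1])]
  have := h t ht.1 ht.2
  linarith

/-- A lower quadratic bound from a one-sided Lipschitz bound on the derivative. -/
theorem taylor_lower_bound {ψ ψ' : ℝ → ℝ} {C : ℝ} (hψ : ∀ t ∈ Set.Icc (0 : ℝ) 1, HasDerivAt ψ (ψ' t) t)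
    (h : ∀ t ∈ Set.Icc (0 : ℝ) 1, ψ' 0 - C * t ≤ ψ' t) : ψ 0 + ψ' 0 - C / 2 ≤ ψ 1 := by
  have hd : ∀ t ∈ Set.Icc (0 : ℝ) 1,
      HasDerivAt (fun t => ψ t - ψ' 0 * t + C / 2 * t ^ 2) (ψ' t - ψ' 0 + C * t) t := by
    intro t ht
    have h1 := ((hψ t ht).sub ((hasDerivAt_id t).const_mul (ψ' 0))).add
      (((hasDerivAt_id t).pow 2).const_mul (C / 2))
    refine (h1.congr_deriv ?_)
    simp; ring
  have hm : MonotoneOn (fun t => ψ t - ψ' 0 * t + C / 2 * t ^ 2) (Set.Icc (0 : ℝ) 1) := by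
    refine monotoneOn_of_deriv_nonneg (convex_Icc 0 1)
      (fun t ht => (hd t ht).continuousAt.continuousWithinAt)
      (fun t ht => (hd t (interior_subset ht)).differentiableAt.differentiableWithinAt)
      (fun t ht => ?_)
    rw [(hd t (interior_subset ht)).deriv]
    linarith [h t (interior_subset ht)]
  have := hm (Set.left_mem_Icc.2 zero_le_one) (Set.right_mem_Icc.2 zero_le_one) zero_le_one
  simp only [mul_zero, sub_zero, mul_one, one_pow] at this
  norm_num at this
  linarith

variable {H : Type*} [NormedAddCommGroup H] [InnerProductSpace ℝ H]

/-- The real values of an extended real valued function. -/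
def realPart (φ : H → EReal) (x : H) : ℝ := (φ x).toReal

theorem ProperClosedConvex.coe_realPart {φ : H → EReal} (h : ProperClosedConvex φ) {x : H}
    (hx : x ∈ dom φ) : ((realPart φ x : ℝ) : EReal) = φ x :=
  EReal.coe_toReal (ne_of_lt hx) (h.1 x)

theorem eq_top_of_notMem_dom {φ : H → EReal} {x : H} (hx : x ∉ dom φ) : φ x = ⊤ :=
  not_lt_top_iff.1 hx

theorem ProperClosedConvex.convexOn {φ : H → EReal} (h : ProperClosedConvex φ) :
    ConvexOn ℝ (dom φ) (realPart φ) := by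
  have key : ∀ x ∈ dom φ, ∀ y ∈ dom φ, ∀ a b : ℝ, 0 ≤ a → 0 ≤ b → a + b = 1 →
      φ (a • x + b • y) ≤ ((a * realPart φ x + b * realPart φ y : ℝ) : EReal) := by
    intro x hx y hy a b ha hb hab
    exact h.2.2.2 (x := (x, realPart φ x)) (h.coe_realPart hx).ge (y := (y, realPart φ y))
      (h.coe_realPart hy).ge ha hb hab
  have hdom : Convex ℝ (dom φ) := fun x hx y hy a b ha hb hab =>
    (key x hx y hy a b ha hb hab).trans_lt (EReal.coe_lt_top _)
  refine ⟨hdom, fun x hx y hy a b ha hb hab => ?_⟩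
  have h1 := key x hx y hy a b ha hb hab
  rw [← h.coe_realPart (hdom hx hy ha hb hab)] at h1
  exact EReal.coe_le_coe_iff.1 h1

theorem ConvexOn.le_segment {S : Set H} {φ : H → ℝ} (h : ConvexOn ℝ S φ) {x y : H} (hx : x ∈ S)
    (hy : y ∈ S) {t : ℝ} (h0 : 0 ≤ t) (h1 : t ≤ 1) :
    x + t • (y - x) ∈ S ∧ φ (x + t • (y - x)) ≤ φ x + t * (φ y - φ x) := by
  have e : x + t • (y - x) = (1 - t) • x + t • y := by module
  rw [e]
  refine ⟨h.1 hx hy (by linarith) h0 (by ring), ?_⟩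
  have := h.2 hx hy (by linarith : 0 ≤ 1 - t) h0 (by ring)
  simp only [smul_eq_mul] at this
  linarith

/-- The value of the proximal map is characterized by its optimality condition. -/
theorem isSubgrad_prox {φ : H → EReal} (h : ProperClosedConvex φ) (hc : IsCompact (dom φ))
    (hcont : ContinuousOn (realPart φ) (dom φ)) {γ : ℝ} (hγ : 0 < γ) (x : H) :
    IsSubgrad (dom φ) (realPart φ) (prox γ φ x) (γ⁻¹ • (x - prox γ φ x)) := by
  obtain ⟨v, hv, hmin⟩ := hc.exists_isMinOn h.2.1
    (f := fun v => ‖v - x‖ ^ 2 / 2 + γ * realPart φ v)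
    ((by fun_prop : Continuous fun v => ‖v - x‖ ^ 2 / 2).continuousOn.add
      (continuousOn_const.mul hcont))
  have hval : ∀ v ∈ dom φ, ((‖v - x‖ ^ 2 / 2 : ℝ) : EReal) + (γ : EReal) * φ v =
      ((‖v - x‖ ^ 2 / 2 + γ * realPart φ v : ℝ) : EReal) := by
    intro v hv
    rw [← h.coe_realPart hv, EReal.coe_add, EReal.coe_mul]
  have htop : ∀ v, v ∉ dom φ → ((‖v - x‖ ^ 2 / 2 : ℝ) : EReal) + (γ : EReal) * φ v = ⊤ := by
    intro v hv
    rw [eq_top_of_notMem_dom hv, EReal.coe_mul_top_of_pos hγ, EReal.coe_add_top]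
  have hex : ∃ v, IsProx γ φ x v := by
    refine ⟨v, fun v' => ?_⟩
    by_cases hv' : v' ∈ dom φ
    · rw [hval v hv, hval v' hv']
      exact EReal.coe_le_coe_iff.2 (hmin hv')
    · rw [htop v' hv']; exact le_top
  have hp : IsProx γ φ x (prox γ φ x) := Classical.epsilon_spec hex
  set u := prox γ φ x
  have hu : u ∈ dom φ := by
    by_contra hu
    have := hp v
    rw [htop u hu, hval v hv, top_le_iff] at this
    exact EReal.coe_ne_top _ this
  refine ⟨hu, fun v' hv' => ?_⟩
  have hd : HasDerivAt (fun t : ℝ => -(‖u + t • (v' - u) - x‖ ^ 2 / 2)) (-inner ℝ (u - x) (v' - u)) 0 := by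
    have h1 : HasDerivAt (fun t : ℝ => u + t • (v' - u) - x) (v' - u) 0 := by
      simpa using (((hasDerivAt_id (0 : ℝ)).smul_const (v' - u)).const_add u).sub_const x
    have h2 := (h1.norm_sq.div_const 2).neg
    refine h2.congr_deriv ?_
    simp
  have hD := deriv_le_of_le_linear (K := γ * (realPart φ v' - realPart φ u)) hd (fun t h0 h1 => by
    obtain ⟨h2, h3⟩ := ConvexOn.le_segment h.convexOn hu hv' h0.le h1
    have h4 := hp (u + t • (v' - u))
    rw [hval u hu, hval _ h2] at h4
    have h5 := EReal.coe_le_coe_iff.1 h4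
    have h6 := mul_le_mul_of_nonneg_left h3 hγ.le
    rw [zero_smul, add_zero]
    linarith)
  rw [real_inner_smul_left, ← neg_sub, inner_neg_left]
  have h7 : γ⁻¹ * -inner ℝ (u - x) (v' - u) ≤ γ⁻¹ * (γ * (realPart φ v' - realPart φ u)) := by
    gcongr
  rw [inv_mul_cancel_left₀ hγ.ne'] at h7
  linarith

/-- The gradient of a function plus a subgradient of a convex function is a subgradient of the sum. -/
theorem gradient_add_mem_subdiff [CompleteSpace H] {g : H → ℝ} {ψ : H → EReal} {x b : H} {r : ℝ}
    (hg : DifferentiableAt ℝ g x) (hr : ψ x = (r : EReal))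
    (hb : ∀ x', ((r + inner ℝ b (x' - x) : ℝ) : EReal) ≤ ψ x') :
    gradient g x + b ∈ subdiff (fun w => (g w : EReal) + ψ w) x := by
  set φ : H → EReal := fun w => (g w : EReal) + ψ w with hφ
  have hφx : φ x = ((g x + r : ℝ) : EReal) := by rw [hφ, EReal.coe_add, ← hr]
  set s := gradient g x + b with hs
  refine ⟨show φ x < ⊤ by rw [hφx]; exact EReal.coe_lt_top _, fun d => ?_⟩
  refine EReal.ge_of_forall_gt_iff_ge.1 fun c hc => ?_
  have hc : c < inner ℝ s d := EReal.coe_lt_coe_iff.1 hc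
  set η := inner ℝ s d - c with hη
  have hη0 : 0 < η := sub_pos.2 hc
  set δ : ℝ := η / (2 * (‖s‖ + 1)) with hδ
  have hδ0 : 0 < δ := by positivity
  refine le_trans ?_ (le_iSup _ (⟨δ, hδ0⟩ : {δ : ℝ // 0 < δ}))
  refine Filter.le_limsup_of_frequently_le ?_
  -- restrict the upper limit to the constant sequence `x' = x`
  have hle : (pure x ×ˢ nhdsWithin (0 : ℝ) (Set.Ioi 0) : Filter (H × ℝ)) ≤
      (nhds x ⊓ Filter.comap φ (nhds (φ x))) ×ˢ nhdsWithin (0 : ℝ) (Set.Ioi 0) := by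
    refine Filter.prod_mono (le_inf (pure_le_nhds x) ?_) le_rfl
    rw [← Filter.map_le_iff_le_comap, Filter.map_pure]
    exact pure_le_nhds _
  refine Filter.Frequently.filter_mono (Filter.Eventually.frequently ?_) hle
  rw [Filter.pure_prod, Filter.eventually_map]
  -- uniform first order expansion of `g` over the ball around `d`
  set κ : ℝ := η / (2 * (‖d‖ + δ)) with hκ
  have hκ0 : 0 < κ := by positivity
  have hlin := (hasGradientAt_iff_hasFDerivAt.1 hg.hasGradientAt).isLittleO.def hκ0
  obtain ⟨ε, hε, hball⟩ := Metric.eventually_nhds_iff.1 hlin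
  have ht : Set.Ioo (0 : ℝ) (ε / (‖d‖ + δ)) ∈ nhdsWithin (0 : ℝ) (Set.Ioi 0) :=
    Ioo_mem_nhdsGT (by positivity)
  filter_upwards [ht] with t ⟨ht0, ht1⟩
  refine le_iInf fun d' => ?_
  have hd' : ‖(d' : H) - d‖ < δ := mem_ball_iff_norm.1 d'.2
  have hd'n : ‖(d' : H)‖ ≤ ‖d‖ + δ := by
    have := norm_le_norm_add_norm_sub' (d' : H) d
    linarith
  have h1 := hball (y := x + t • (d' : H)) (by
    rw [dist_self_add_left, norm_smul, Real.norm_of_nonneg ht0.le]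
    rw [lt_div_iff₀ (by positivity)] at ht1
    exact lt_of_le_of_lt (by gcongr) ht1)
  rw [add_sub_cancel_left, norm_smul, Real.norm_of_nonneg ht0.le, Real.norm_eq_abs] at h1
  have h2 := (abs_le.1 h1).1
  simp only [InnerProductSpace.toDual_apply_apply, real_inner_smul_right] at h2
  have h3 := hb (x + t • (d' : H))
  rw [add_sub_cancel_left, real_inner_smul_right] at h3
  have h4 : ((g (x + t • (d' : H)) + (r + t * inner ℝ b (d' : H)) : ℝ) : EReal) ≤
      φ (x + t • (d' : H)) := by
    rw [EReal.coe_add]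
    exact add_le_add le_rfl h3
  rw [hφx]
  have h5 : (((g (x + t • (d' : H)) + (r + t * inner ℝ b (d' : H)) - (g x + r)) / t : ℝ) : EReal) ≤
      (φ (x + t • (d' : H)) - ((g x + r : ℝ) : EReal)) / (t : EReal) := by
    rw [EReal.coe_div, EReal.coe_sub]
    exact EReal.div_le_div_right_of_nonneg (EReal.coe_nonneg.2 ht0.le)
      (EReal.sub_le_sub h4 le_rfl)
  refine le_trans (EReal.coe_le_coe_iff.2 ?_) h5
  rw [le_div_iff₀ ht0]
  have h6 : inner ℝ s (d' : H) = inner ℝ s d + inner ℝ s ((d' : H) - d) := by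
    rw [← inner_add_right]; congr 1; abel
  have h7 : -(η / 2) ≤ inner ℝ s ((d' : H) - d) := by
    have h8 := (abs_le.1 (abs_real_inner_le_norm s ((d' : H) - d))).1
    have h9 : ‖s‖ * ‖(d' : H) - d‖ ≤ (‖s‖ + 1) * δ := by gcongr; linarith
    have h10 : (‖s‖ + 1) * δ = η / 2 := by rw [hδ]; field_simp
    linarith
  have h8 : κ * (t * ‖(d' : H)‖) ≤ t * (η / 2) := by
    calc κ * (t * ‖(d' : H)‖) ≤ κ * (t * (‖d‖ + δ)) := by gcongr
      _ = t * (η / 2) := by rw [hκ]; field_simp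
  have h9 : t * (c + η / 2) ≤ t * inner ℝ s (d' : H) := by
    gcongr; linarith
  rw [hs, inner_add_left] at h9
  linarith

end Convex

/-! ### Derivatives along lines, and the squared nonnegative part -/

section Lines

variable {H : Type*} [NormedAddCommGroup H] [InnerProductSpace ℝ H] [CompleteSpace H]

theorem hasDerivAt_line {φ : H → ℝ} {w d : H} {t : ℝ} (h : DifferentiableAt ℝ φ (w + t • d)) :
    HasDerivAt (fun s : ℝ => φ (w + s • d)) (inner ℝ (gradient φ (w + t • d)) d) t := by
  have h1 : HasDerivAt (fun s : ℝ => w + s • d) d t := by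
    simpa using ((hasDerivAt_id t).smul_const d).const_add w
  have h2 := (hasGradientAt_iff_hasFDerivAt.1 h.hasGradientAt).comp_hasDerivAt t h1
  rwa [InnerProductSpace.toDual_apply_apply] at h2

theorem continuousOn_of_differentiableAt {E F : Type*} [NormedAddCommGroup E] [NormedSpace ℝ E]
    [NormedAddCommGroup F] [NormedSpace ℝ F] {φ : E → F} {S : Set E}
    (h : ∀ w ∈ S, DifferentiableAt ℝ φ w) : ContinuousOn φ S :=
  fun w hw => (h w hw).continuousAt.continuousWithinAt

theorem hasDerivAt_sq_max (s : ℝ) : HasDerivAt (fun r : ℝ => (max r 0) ^ 2) (2 * max s 0) s := by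
  rcases lt_trichotomy s 0 with h | rfl | h
  · rw [max_eq_right h.le, mul_zero]
    refine (hasDerivAt_const s (0 : ℝ)).congr_of_eventuallyEq ?_
    filter_upwards [gt_mem_nhds h] with r hr
    rw [max_eq_right hr.le]; norm_num
  · rw [hasDerivAt_iff_isLittleO]
    have h1 : (fun r : ℝ => r ^ 2) =o[nhds 0] fun r => r := by
      simpa using (Asymptotics.isLittleO_pow_id (𝕜 := ℝ) (n := 2) (by norm_num))
    simp only [max_self, mul_zero, smul_zero, sub_zero, ne_eq, OfNat.ofNat_ne_zero,
      not_false_eq_true, zero_pow]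
    refine Asymptotics.IsBigO.trans_isLittleO (Asymptotics.IsBigO.of_bound 1 ?_) h1
    filter_upwards with r
    rw [Real.norm_of_nonneg (by positivity), Real.norm_of_nonneg (by positivity), one_mul]
    rcases le_total r 0 with hr | hr
    · rw [max_eq_right hr]; nlinarith
    · rw [max_eq_left hr]
  · have h1 : HasDerivAt (fun r : ℝ => r ^ 2) (2 * s) s := by simpa using hasDerivAt_pow 2 s
    rw [max_eq_left h.le]
    refine h1.congr_of_eventuallyEq ?_
    filter_upwards [lt_mem_nhds h] with r hr
    rw [max_eq_left hr.le]

theorem _root_.ConvexOn.sq_max {E : Type*} [AddCommGroup E] [Module ℝ E] {S : Set E} {g : E → ℝ}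
    (hg : ConvexOn ℝ S g) : ConvexOn ℝ S (fun y => (max (g y) 0) ^ 2) :=
  (hg.sup (convexOn_const 0 hg.1)).pow (fun _ _ => le_max_right _ _) 2

/-- The gradient inequality for a function that is convex and differentiable along a segment. -/
theorem ConvexOn.add_deriv_le {E : Type*} [NormedAddCommGroup E] [InnerProductSpace ℝ E] {S : Set E}
    {φ : E → ℝ} (h : ConvexOn ℝ S φ) {x y : E} (hx : x ∈ S) (hy : y ∈ S) {D : ℝ}
    (hD : HasDerivAt (fun t : ℝ => φ (x + t • (y - x))) D 0) : φ x + D ≤ φ y := by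
  have := deriv_le_of_le_linear (K := φ y - φ x) hD fun t h0 h1 => by
    simpa using (ConvexOn.le_segment h hx hy h0.le h1).2
  linarith

variable {l : ℕ}

theorem posPart_apply (v : Vec l) (i : Fin l) : posPart v i = max (v i) 0 := rfl

theorem norm_posPart_sq (v : Vec l) : ‖posPart v‖ ^ 2 = ∑ i, (max (v i) 0) ^ 2 := by
  rw [EuclideanSpace.norm_sq_eq]
  simp [posPart_apply]

theorem inner_posPart_self (v : Vec l) : inner ℝ (posPart v) v = ‖posPart v‖ ^ 2 := by
  rw [norm_posPart_sq, PiLp.inner_apply]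
  refine Finset.sum_congr rfl fun i _ => ?_
  rw [posPart_apply]
  rcases le_total (v i) 0 with h | h
  · simp [max_eq_right h]
  · simp [max_eq_left h, sq]

theorem norm_posPart_le (v : Vec l) : ‖posPart v‖ ≤ ‖v‖ := by
  have h1 := inner_posPart_self v
  have h2 := real_inner_le_norm (posPart v) v
  by_contra h
  push Not at h
  have h3 : 0 < ‖posPart v‖ := (norm_nonneg v).trans_lt h
  nlinarith

theorem continuous_posPart : Continuous (posPart (l := l)) := by
  unfold posPart; fun_prop

end Lines

/-! ### The bilevel problem: values, continuity and moduli -/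

section Pairs

variable {n m : ℕ}

@[simp] theorem pt_fst (x : Vec n) (y : Vec m) : (pt x y).fst = x := rfl
@[simp] theorem pt_snd (x : Vec n) (y : Vec m) : (pt x y).snd = y := rfl
@[simp] theorem pt_fst_snd (w : Pt n m) : pt w.fst w.snd = w := rfl

theorem pt_sub (x x' : Vec n) (y y' : Vec m) : pt x y - pt x' y' = pt (x - x') (y - y') := rfl

theorem norm_pt_sq (x : Vec n) (y : Vec m) : ‖pt x y‖ ^ 2 = ‖x‖ ^ 2 + ‖y‖ ^ 2 := norm_pair_sq x y

theorem inner_pt (x x' : Vec n) (y y' : Vec m) :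
    inner ℝ (pt x y) (pt x' y') = inner ℝ x x' + inner ℝ y y' := inner_pair x x' y y'

theorem inner_pt_zero (x : Vec n) (w : Pt n m) : inner ℝ (pt x 0) w = inner ℝ x w.fst := by
  rw [← pt_fst_snd w, inner_pt, inner_zero_left, add_zero, pt_fst]

theorem inner_zero_pt (w : Pt n m) (y : Vec m) : inner ℝ w (pt 0 y) = inner ℝ w.snd y := by
  rw [← pt_fst_snd w, inner_pt, inner_zero_right, zero_add, pt_snd]

theorem inner_pt_zero_right (w : Pt n m) (x : Vec n) : inner ℝ w (pt x 0) = inner ℝ w.fst x := by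
  rw [← pt_fst_snd w, inner_pt, inner_zero_right, add_zero, pt_fst]

theorem norm_pt_zero_left (y : Vec m) : ‖pt (0 : Vec n) y‖ = ‖y‖ := by
  have := norm_pt_sq (0 : Vec n) y
  rw [norm_zero, zero_pow two_ne_zero, zero_add] at this
  exact (sq_eq_sq₀ (norm_nonneg _) (norm_nonneg _)).1 this

theorem pt_add_smul_left (x d : Vec n) (z : Vec m) (t : ℝ) :
    pt (x + t • d) z = pt x z + t • pt d 0 := by
  change pair _ _ = pair _ _ + t • pair _ _
  rw [smul_pair, pair_add, smul_zero, add_zero]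

theorem pt_add_smul_right (x : Vec n) (z d : Vec m) (t : ℝ) :
    pt x (z + t • d) = pt x z + t • pt 0 d := by
  change pair _ _ = pair _ _ + t • pair _ _
  rw [smul_pair, pair_add, smul_zero, add_zero]

theorem continuous_pt : Continuous fun p : Vec n × Vec m => pt p.1 p.2 := by
  unfold pt; fun_prop

end Pairs

namespace Problem

variable {n m l : ℕ} {P : Problem n m l} {c : Moduli}

theorem pt_mem_XY {x : Vec n} {y : Vec m} (hx : x ∈ P.X) (hy : y ∈ P.Y) : pt x y ∈ P.XY := ⟨hx, hy⟩

theorem XY_compact (h₁ : P.Assumption1 c) : IsCompact P.XY := by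
  have h : P.XY = (fun p : Vec n × Vec m => pt p.1 p.2) '' (P.X ×ˢ P.Y) := by
    ext w
    exact ⟨fun hw => ⟨(w.fst, w.snd), hw, rfl⟩, by rintro ⟨p, hp, rfl⟩; exact hp⟩
  rw [h]
  exact (h₁.X_compact.prod h₁.Y_compact).image continuous_pt

theorem X_nonempty (h₁ : P.Assumption1 c) : P.X.Nonempty := h₁.f₂_convex.2.1

theorem Y_nonempty (h₁ : P.Assumption1 c) : P.Y.Nonempty := h₁.ft₂_convex.2.1

theorem f_eq_coe (h₁ : P.Assumption1 c) {w : Pt n m} (hx : w.fst ∈ P.X) :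
    P.f w = ((P.f₁ w + realPart P.f₂ w.fst : ℝ) : EReal) := by
  rw [f, EReal.coe_add, h₁.f₂_convex.coe_realPart hx]

theorem ft_eq_coe (h₁ : P.Assumption1 c) {w : Pt n m} (hy : w.snd ∈ P.Y) :
    P.ft w = ((P.ft₁ w + realPart P.ft₂ w.snd : ℝ) : EReal) := by
  rw [ft, EReal.coe_add, h₁.ft₂_convex.coe_realPart hy]

theorem fR_eq (h₁ : P.Assumption1 c) {w : Pt n m} (hx : w.fst ∈ P.X) :
    P.fR w = P.f₁ w + realPart P.f₂ w.fst := by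
  rw [fR, f_eq_coe h₁ hx, EReal.toReal_coe]

theorem ftR_eq (h₁ : P.Assumption1 c) {w : Pt n m} (hy : w.snd ∈ P.Y) :
    P.ftR w = P.ft₁ w + realPart P.ft₂ w.snd := by
  rw [ftR, ft_eq_coe h₁ hy, EReal.toReal_coe]

theorem coe_fR (h₁ : P.Assumption1 c) {w : Pt n m} (hx : w.fst ∈ P.X) :
    ((P.fR w : ℝ) : EReal) = P.f w := by rw [fR_eq h₁ hx, f_eq_coe h₁ hx]

theorem coe_ftR (h₁ : P.Assumption1 c) {w : Pt n m} (hy : w.snd ∈ P.Y) :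
    ((P.ftR w : ℝ) : EReal) = P.ft w := by rw [ftR_eq h₁ hy, ft_eq_coe h₁ hy]

theorem ft_eq_top {w : Pt n m} (hy : w.snd ∉ P.Y) : P.ft w = ⊤ := by
  rw [ft, eq_top_of_notMem_dom hy, EReal.coe_add_top]

theorem f_eq_top {w : Pt n m} (hx : w.fst ∉ P.X) : P.f w = ⊤ := by
  rw [f, eq_top_of_notMem_dom hx, EReal.coe_add_top]

theorem continuousOn_fR (h₁ : P.Assumption1 c) : ContinuousOn P.fR P.XY :=
  EReal.continuousOn_toReal.comp h₁.f_cont fun w hw => by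
    rw [f_eq_coe h₁ hw.1]
    rintro (h | h)
    exacts [EReal.coe_ne_bot _ h, EReal.coe_ne_top _ h]

theorem continuousOn_ftR (h₁ : P.Assumption1 c) : ContinuousOn P.ftR P.XY :=
  EReal.continuousOn_toReal.comp h₁.ft_cont fun w hw => by
    rw [ft_eq_coe h₁ hw.2]
    rintro (h | h)
    exacts [EReal.coe_ne_bot _ h, EReal.coe_ne_top _ h]

theorem continuousOn_realPart_f₂ (h₁ : P.Assumption1 c) : ContinuousOn (realPart P.f₂) P.X := by
  obtain ⟨y, hy⟩ := Y_nonempty h₁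
  have hc : ContinuousOn (fun x => pt x y) P.X :=
    (continuous_pt.comp (Continuous.prodMk_left y)).continuousOn
  have h1 : ContinuousOn (fun x => P.fR (pt x y) - P.f₁ (pt x y)) P.X :=
    ((continuousOn_fR h₁).comp hc fun x hx => pt_mem_XY hx hy).sub
      ((continuousOn_of_differentiableAt h₁.f₁_smooth.1).comp hc fun x hx => pt_mem_XY hx hy)
  refine h1.congr fun x hx => ?_
  change _ = P.fR (pt x y) - _
  rw [fR_eq h₁ (w := pt x y) hx]; simp

theorem continuousOn_realPart_ft₂ (h₁ : P.Assumption1 c) : ContinuousOn (realPart P.ft₂) P.Y := by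
  obtain ⟨x, hx⟩ := X_nonempty h₁
  have hc : ContinuousOn (fun y => pt x y) P.Y :=
    (continuous_pt.comp (Continuous.prodMk_right x)).continuousOn
  have h1 : ContinuousOn (fun y => P.ftR (pt x y) - P.ft₁ (pt x y)) P.Y :=
    ((continuousOn_ftR h₁).comp hc fun y hy => pt_mem_XY hx hy).sub
      ((continuousOn_of_differentiableAt h₁.ft₁_smooth.1).comp hc fun y hy => pt_mem_XY hx hy)
  refine h1.congr fun y hy => ?_
  change _ = P.ftR (pt x y) - _
  rw [ftR_eq h₁ (w := pt x y) hy]; simp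

theorem continuousOn_gt (h₂ : P.Assumption2 c) : ContinuousOn P.gt P.XY :=
  continuousOn_of_differentiableAt h₂.gt_diff

/-- A modulus of an inequality over pairs of points of `𝒳 × 𝒴` is nonnegative as `D_y > 0`. -/
theorem modulus_nonneg (h₁ : P.Assumption1 c) (hDy : 0 < P.Dy) {K : ℝ}
    (h : ∀ w ∈ P.XY, ∀ w' ∈ P.XY, 0 ≤ K * ‖w - w'‖) : 0 ≤ K := by
  obtain ⟨x, hx⟩ := X_nonempty h₁
  have hnt : P.Y.Nontrivial := by
    by_contra hs
    exact hDy.ne' (Metric.diam_subsingleton (Set.not_nontrivial_iff.1 hs))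
  obtain ⟨y, hy, y', hy', hne⟩ := hnt
  have h1 := h _ (pt_mem_XY hx hy) _ (pt_mem_XY hx hy')
  rw [pt_sub, sub_self, norm_pt_zero_left] at h1
  exact nonneg_of_mul_nonneg_left h1 (norm_pos_iff.2 (sub_ne_zero.2 hne))

theorem Lgradf₁_nonneg (h₁ : P.Assumption1 c) (hDy : 0 < P.Dy) : 0 ≤ c.Lgradf₁ :=
  modulus_nonneg h₁ hDy fun w hw w' hw' => (norm_nonneg _).trans (h₁.f₁_smooth.2 w hw w' hw')

theorem Lgradft₁_nonneg (h₁ : P.Assumption1 c) (hDy : 0 < P.Dy) : 0 ≤ c.Lgradft₁ :=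
  modulus_nonneg h₁ hDy fun w hw w' hw' => (norm_nonneg _).trans (h₁.ft₁_smooth.2 w hw w' hw')

theorem Lf_nonneg (h₁ : P.Assumption1 c) (h₂ : P.Assumption2 c) (hDy : 0 < P.Dy) : 0 ≤ c.Lf :=
  modulus_nonneg h₁ hDy fun w hw w' hw' => (abs_nonneg _).trans (h₂.f_lip w hw w' hw')

theorem Lft_nonneg (h₁ : P.Assumption1 c) (h₂ : P.Assumption2 c) (hDy : 0 < P.Dy) : 0 ≤ c.Lft :=
  modulus_nonneg h₁ hDy fun w hw w' hw' => (abs_nonneg _).trans (h₂.ft_lip w hw w' hw')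

theorem Lgradgt_nonneg (h₁ : P.Assumption1 c) (h₂ : P.Assumption2 c) (hDy : 0 < P.Dy) :
    0 ≤ c.Lgradgt :=
  modulus_nonneg h₁ hDy fun w hw w' hw' => (Real.sqrt_nonneg _).trans (h₂.gt_smooth w hw w' hw')

theorem gtHi_nonneg : 0 ≤ P.gtHi :=
  Real.sSup_nonneg fun _ ⟨_, _, h⟩ => h ▸ norm_nonneg _

theorem norm_gt_le (h₁ : P.Assumption1 c) (h₂ : P.Assumption2 c) {w : Pt n m} (hw : w ∈ P.XY) :
    ‖P.gt w‖ ≤ P.gtHi :=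
  le_csSup ((XY_compact h₁).bddAbove_image (continuousOn_gt h₂).norm) (Set.mem_image_of_mem _ hw)

theorem fLow_le (h₁ : P.Assumption1 c) {w : Pt n m} (hw : w ∈ P.XY) : P.fLow ≤ P.fR w :=
  csInf_le ((XY_compact h₁).bddBelow_image (continuousOn_fR h₁)) (Set.mem_image_of_mem _ hw)

theorem ftLow_le (h₁ : P.Assumption1 c) {w : Pt n m} (hw : w ∈ P.XY) : P.ftLow ≤ P.ftR w :=
  csInf_le ((XY_compact h₁).bddBelow_image (continuousOn_ftR h₁)) (Set.mem_image_of_mem _ hw)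

theorem le_ftHi (h₁ : P.Assumption1 c) {w : Pt n m} (hw : w ∈ P.XY) : P.ftR w ≤ P.ftHi :=
  le_csSup ((XY_compact h₁).bddAbove_image (continuousOn_ftR h₁)) (Set.mem_image_of_mem _ hw)

theorem norm_sub_le_Dx (h₁ : P.Assumption1 c) {x x' : Vec n} (hx : x ∈ P.X) (hx' : x' ∈ P.X) :
    ‖x - x'‖ ≤ P.Dx :=
  (dist_eq_norm x x') ▸ Metric.dist_le_diam_of_mem h₁.X_compact.isBounded hx hx'

theorem norm_sub_le_Dy (h₁ : P.Assumption1 c) {y y' : Vec m} (hy : y ∈ P.Y) (hy' : y' ∈ P.Y) :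
    ‖y - y'‖ ≤ P.Dy :=
  (dist_eq_norm y y') ▸ Metric.dist_le_diam_of_mem h₁.Y_compact.isBounded hy hy'

/-- The modulus of half of the gradient of `‖[g̃]₊‖²` is nonnegative. -/
theorem penaltyModulus_nonneg (h₁ : P.Assumption1 c) (h₂ : P.Assumption2 c) (hDy : 0 < P.Dy) :
    0 ≤ P.gtHi * c.Lgradgt + c.Lgt ^ 2 :=
  add_nonneg (mul_nonneg gtHi_nonneg (Lgradgt_nonneg h₁ h₂ hDy)) (sq_nonneg _)

theorem le_Ltilde (h₁ : P.Assumption1 c) (h₂ : P.Assumption2 c) (hDy : 0 < P.Dy) {ε : ℝ}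
    (hε : 0 < ε) (hε1 : ε ≤ 1 / 4) :
    c.Lgradf₁ + c.Lgradft₁ + (P.gtHi * c.Lgradgt + c.Lgt ^ 2) ≤ P.Ltilde c ε := by
  have h3 := Lgradft₁_nonneg h₁ hDy
  have h4 := penaltyModulus_nonneg h₁ h₂ hDy
  have h5 : 1 ≤ ε⁻¹ := (one_le_inv₀ hε).2 (by linarith)
  have h6 : 1 ≤ (ε ^ 3)⁻¹ := (one_le_inv₀ (by positivity)).2 (pow_le_one₀ hε.le (by linarith))
  rw [Ltilde]
  have h7 : c.Lgradft₁ ≤ 2 * ε⁻¹ * c.Lgradft₁ := le_mul_of_one_le_left h3 (by linarith)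
  have h8 : P.gtHi * c.Lgradgt + c.Lgt ^ 2 ≤ 4 * (ε ^ 3)⁻¹ * (P.gtHi * c.Lgradgt + c.Lgt ^ 2) :=
    le_mul_of_one_le_left h4 (by linarith)
  linarith

/-! ### Derivatives of the functions of the bilevel problem -/

theorem hasDerivAt_penalty_line {w d : Pt n m} {t : ℝ}
    (h : DifferentiableAt ℝ P.gt (w + t • d)) :
    HasDerivAt (fun s : ℝ => ‖posPart (P.gt (w + s • d))‖ ^ 2)
      (2 * inner ℝ (P.gradgtMul (w + t • d) (posPart (P.gt (w + t • d)))) d) t := by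
  simp only [norm_posPart_sq, gradgtMul, sum_inner, Finset.mul_sum]
  refine HasDerivAt.fun_sum fun i _ => ?_
  have h1 := hasDerivAt_line (φ := fun w => P.gt w i) (w := w) (d := d) (t := t)
    (differentiableAt_euclidean.1 h i)
  refine ((hasDerivAt_sq_max _).comp t h1).congr_deriv ?_
  rw [real_inner_smul_left, posPart_apply, gradgt]
  ring

theorem convexOn_penalty (h₂ : P.Assumption2 c) {x : Vec n} (hx : x ∈ P.X) :
    ConvexOn ℝ Set.univ (fun y => ‖posPart (P.gt (pt x y))‖ ^ 2) := by
  simp only [norm_posPart_sq]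
  refine ⟨convex_univ, fun y _ y' _ a b ha hb hab => ?_⟩
  simp only [smul_eq_mul, Finset.mul_sum]
  rw [← Finset.sum_add_distrib]
  exact Finset.sum_le_sum fun i _ =>
    (h₂.gt_convex x hx i).sq_max.2 (Set.mem_univ y) (Set.mem_univ y') ha hb hab

theorem ft₁_add_inner_le (h₁ : P.Assumption1 c) {x : Vec n} {y : Vec m} (hx : x ∈ P.X)
    (hy : y ∈ P.Y) (y' : Vec m) :
    P.ft₁ (pt x y) + inner ℝ (gradient P.ft₁ (pt x y)).snd (y' - y) ≤ P.ft₁ (pt x y') := by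
  refine ConvexOn.add_deriv_le (h₁.ft₁_convex x hx) (Set.mem_univ y) (Set.mem_univ y') ?_
  have h1 := hasDerivAt_line (φ := P.ft₁) (w := pt x y) (d := pt 0 (y' - y)) (t := 0)
    (by rw [zero_smul, add_zero]; exact h₁.ft₁_smooth.1 _ (pt_mem_XY hx hy))
  rw [zero_smul, add_zero, inner_zero_pt] at h1
  simpa only [pt_add_smul_right] using h1

theorem gt_add_inner_le (h₂ : P.Assumption2 c) {x : Vec n} {y : Vec m} (hx : x ∈ P.X)
    (hy : y ∈ P.Y) (y' : Vec m) (i : Fin l) :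
    P.gt (pt x y) i + inner ℝ (P.gradgt (pt x y) i).snd (y' - y) ≤ P.gt (pt x y') i := by
  refine ConvexOn.add_deriv_le (h₂.gt_convex x hx i) (Set.mem_univ y) (Set.mem_univ y') ?_
  have h1 := hasDerivAt_line (φ := fun w => P.gt w i) (w := pt x y) (d := pt 0 (y' - y)) (t := 0)
    (by rw [zero_smul, add_zero]; exact differentiableAt_euclidean.1 (h₂.gt_diff _ (pt_mem_XY hx hy)) i)
  rw [zero_smul, add_zero, inner_zero_pt] at h1
  simpa only [pt_add_smul_right, gradgt] using h1

theorem penalty_add_inner_le (h₂ : P.Assumption2 c) {x : Vec n} {y : Vec m} (hx : x ∈ P.X)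
    (hy : y ∈ P.Y) (y' : Vec m) :
    ‖posPart (P.gt (pt x y))‖ ^ 2 +
      2 * inner ℝ (P.gradgtMul (pt x y) (posPart (P.gt (pt x y)))).snd (y' - y) ≤
      ‖posPart (P.gt (pt x y'))‖ ^ 2 := by
  refine ConvexOn.add_deriv_le (convexOn_penalty h₂ hx) (Set.mem_univ y) (Set.mem_univ y') ?_
  have h1 := hasDerivAt_penalty_line (P := P) (w := pt x y) (d := pt 0 (y' - y)) (t := 0)
    (by rw [zero_smul, add_zero]; exact h₂.gt_diff _ (pt_mem_XY hx hy))
  rw [zero_smul, add_zero, inner_zero_pt] at h1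
  simpa only [pt_add_smul_right] using h1

/-! ### The minimax problem of the penalty method -/

/-- The gradient of `ρ (f̃₁ + μ ‖[g̃]₊‖²)`. -/
def penGrad (P : Problem n m l) (ρ μ : ℝ) (w : Pt n m) : Pt n m :=
  ρ • gradient P.ft₁ w + (2 * ρ * μ) • P.gradgtMul w (posPart (P.gt w))

/-- The smooth function `ρ (f̃₁ + μ ‖[g̃]₊‖²)`. -/
def penSmooth (P : Problem n m l) (ρ μ : ℝ) (w : Pt n m) : ℝ :=
  ρ * P.ft₁ w + ρ * μ * ‖posPart (P.gt w)‖ ^ 2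

/-- The minimax problem with oracles `P.oracle ρ μ`; its gradients make sense where they are
evaluated at points of `U`. -/
def minimax (P : Problem n m l) (ρ μ : ℝ) (U : Set (Pt n m)) : MinimaxProblem (Pt n m) (Vec m) where
  X := P.XY
  Y := P.Y
  p w := realPart P.f₂ w.fst + ρ * realPart P.ft₂ w.snd
  q z := ρ * realPart P.ft₂ z
  h w z := P.f₁ w + P.penSmooth ρ μ w - P.penSmooth ρ μ (pt w.fst z)
  gx w z := gradient P.f₁ w + ρ • gradient P.ft₁ w +
    (2 * ρ * μ) • P.gradgtMul w (posPart (P.gt w)) -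
      pt (ρ • (gradient P.ft₁ (pt w.fst z)).fst +
        (2 * ρ * μ) • (P.gradgtMul (pt w.fst z) (posPart (P.gt (pt w.fst z)))).fst) 0
  gy w z := -(ρ • (gradient P.ft₁ (pt w.fst z)).snd) -
    (2 * ρ * μ) • (P.gradgtMul (pt w.fst z) (posPart (P.gt (pt w.fst z)))).snd
  proxP γ w := pt (prox γ P.f₂ w.fst) (prox (γ * ρ) P.ft₂ w.snd)
  proxQ γ z := prox (γ * ρ) P.ft₂ z
  Ω := {u | u.fst ∈ U ∧ pt u.fst.fst u.snd ∈ U}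

/-- The queries made by the oracles `P.oracle ρ μ`. -/
def queryLog (ρ : ℝ) : QueryLog (Query n m) (Pt n m) (Vec m) where
  grad w z := [Query.gradgt (pt w.fst z), Query.gradft₁ (pt w.fst z), Query.gradgt w,
    Query.gradft₁ w, Query.gradf₁ w]
  proxP γ w := [Query.proxft₂ (γ * ρ) w.snd, Query.proxf₂ γ w.fst]
  proxQ γ z := [Query.proxft₂ (γ * ρ) z]

theorem oracle_eq (P : Problem n m l) (ρ μ : ℝ) (U : Set (Pt n m)) :
    P.oracle ρ μ = (P.minimax ρ μ U).oracle (queryLog ρ) := rfl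

theorem minimax_gx (ρ μ : ℝ) (U : Set (Pt n m)) (w : Pt n m) (z : Vec m) :
    (P.minimax ρ μ U).gx w z =
      gradient P.f₁ w + P.penGrad ρ μ w - pt (P.penGrad ρ μ (pt w.fst z)).fst 0 := by
  rw [minimax, penGrad, ← add_assoc]; rfl

theorem minimax_gy (ρ μ : ℝ) (U : Set (Pt n m)) (w : Pt n m) (z : Vec m) :
    (P.minimax ρ μ U).gy w z = -(P.penGrad ρ μ (pt w.fst z)).snd := by
  change -(ρ • (gradient P.ft₁ (pt w.fst z)).snd) -
    (2 * ρ * μ) • (P.gradgtMul (pt w.fst z) (posPart (P.gt (pt w.fst z)))).snd =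
      -(ρ • (gradient P.ft₁ (pt w.fst z)).snd +
    (2 * ρ * μ) • (P.gradgtMul (pt w.fst z) (posPart (P.gt (pt w.fst z)))).snd)
  abel

theorem hasDerivAt_penSmooth_line (ρ μ : ℝ) {w d : Pt n m} {t : ℝ}
    (hf : DifferentiableAt ℝ P.ft₁ (w + t • d)) (hg : DifferentiableAt ℝ P.gt (w + t • d)) :
    HasDerivAt (fun s : ℝ => P.penSmooth ρ μ (w + s • d))
      (inner ℝ (P.penGrad ρ μ (w + t • d)) d) t := by
  refine (((hasDerivAt_line hf).const_mul ρ).add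
    ((hasDerivAt_penalty_line hg).const_mul (ρ * μ))).congr_deriv ?_
  rw [penGrad, inner_add_left, real_inner_smul_left, real_inner_smul_left]
  ring

theorem penGrad_sub_le {U : Set (Pt n m)} (hU : P.SmoothRegion c U) {ρ μ : ℝ} (hρ : 0 ≤ ρ)
    (hμ : 0 ≤ μ) {w w' : Pt n m} (hw : w ∈ U) (hw' : w' ∈ U) :
    ‖P.penGrad ρ μ w - P.penGrad ρ μ w'‖ ≤
      (ρ * c.Lgradft₁ + 2 * ρ * μ * (P.gtHi * c.Lgradgt + c.Lgt ^ 2)) * ‖w - w'‖ := by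
  have e : P.penGrad ρ μ w - P.penGrad ρ μ w' =
      ρ • (gradient P.ft₁ w - gradient P.ft₁ w') +
        (2 * ρ * μ) • (P.gradgtMul w (posPart (P.gt w)) - P.gradgtMul w' (posPart (P.gt w'))) := by
    rw [penGrad, penGrad]; module
  rw [e]
  refine (norm_add_le _ _).trans ?_
  rw [norm_smul, norm_smul, Real.norm_of_nonneg hρ, Real.norm_of_nonneg (by positivity)]
  have h3 := mul_le_mul_of_nonneg_left (hU.ft₁_smooth.2 w hw w' hw') hρ
  have h4 := mul_le_mul_of_nonneg_left (hU.penalty_smooth w hw w' hw')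
    (by positivity : 0 ≤ 2 * ρ * μ)
  linarith

/-- The gradient field of the minimax problem is `L̃`-Lipschitz. -/
theorem minimax_lipschitz (h₁ : P.Assumption1 c) (h₂ : P.Assumption2 c) (hDy : 0 < P.Dy)
    {U : Set (Pt n m)} (hU : P.SmoothRegion c U) {ε : ℝ} (hε : 0 < ε)
    {u u' : WithLp 2 (Pt n m × Vec m)} (hu : u ∈ (P.minimax ε⁻¹ (ε ^ 2)⁻¹ U).Ω)
    (hu' : u' ∈ (P.minimax ε⁻¹ (ε ^ 2)⁻¹ U).Ω) :
    ‖pair ((P.minimax ε⁻¹ (ε ^ 2)⁻¹ U).gx u.fst u.snd) (-(P.minimax ε⁻¹ (ε ^ 2)⁻¹ U).gy u.fst u.snd) -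
      pair ((P.minimax ε⁻¹ (ε ^ 2)⁻¹ U).gx u'.fst u'.snd)
        (-(P.minimax ε⁻¹ (ε ^ 2)⁻¹ U).gy u'.fst u'.snd)‖ ≤ P.Ltilde c ε * ‖u - u'‖ := by
  simp only [minimax_gx, minimax_gy, neg_neg]
  set ρ := ε⁻¹
  set μ := (ε ^ 2)⁻¹
  have hρ : 0 ≤ ρ := (inv_pos.2 hε).le
  have hμ : 0 ≤ μ := by positivity
  set w := u.fst
  set w' := u'.fst
  set v := pt u.fst.fst u.snd with hv
  set v' := pt u'.fst.fst u'.snd with hv'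
  set S := P.gtHi * c.Lgradgt + c.Lgt ^ 2
  have hS : 0 ≤ S := penaltyModulus_nonneg h₁ h₂ hDy
  have hLt := Lgradft₁_nonneg h₁ hDy
  have hLf := Lgradf₁_nonneg h₁ hDy
  have e : pair (gradient P.f₁ w + P.penGrad ρ μ w - pt (P.penGrad ρ μ v).fst 0)
      (P.penGrad ρ μ v).snd -
      pair (gradient P.f₁ w' + P.penGrad ρ μ w' - pt (P.penGrad ρ μ v').fst 0)
      (P.penGrad ρ μ v').snd =
      pair (gradient P.f₁ w - gradient P.f₁ w' + (P.penGrad ρ μ w - P.penGrad ρ μ w')) 0 +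
      pair (-pt (P.penGrad ρ μ v - P.penGrad ρ μ v').fst (0 : Vec m))
        (P.penGrad ρ μ v - P.penGrad ρ μ v').snd := by
    have e1 : pt (P.penGrad ρ μ v - P.penGrad ρ μ v').fst (0 : Vec m) =
        pt (P.penGrad ρ μ v).fst 0 - pt (P.penGrad ρ μ v').fst 0 := by
      rw [pt_sub, sub_zero]; rfl
    rw [pair_sub, pair_add, e1, zero_add]
    congr 1
    abel
  rw [e]
  have hu1 : ‖w - w'‖ ≤ ‖u - u'‖ := by
    refine le_of_sq_le_sq ?_ (norm_nonneg _)
    have := norm_pair_sq (u.fst - u'.fst) (u.snd - u'.snd)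
    rw [show u - u' = pair (u.fst - u'.fst) (u.snd - u'.snd) from rfl, this]
    exact le_add_of_nonneg_right (sq_nonneg _)
  have hv1 : ‖v - v'‖ ≤ ‖u - u'‖ := by
    refine le_of_sq_le_sq ?_ (norm_nonneg _)
    have h3 := norm_pair_sq (u.fst - u'.fst) (u.snd - u'.snd)
    rw [show u - u' = pair (u.fst - u'.fst) (u.snd - u'.snd) from rfl, h3, hv, hv', pt_sub,
      norm_pt_sq]
    have h4 := norm_pt_sq (u.fst - u'.fst).fst (u.fst - u'.fst).snd
    rw [pt_fst_snd] at h4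
    rw [h4, show (u.fst - u'.fst).fst = u.fst.fst - u'.fst.fst from rfl]
    linarith [sq_nonneg ‖(u.fst - u'.fst).snd‖]
  have n1 : ‖pair (gradient P.f₁ w - gradient P.f₁ w' + (P.penGrad ρ μ w - P.penGrad ρ μ w'))
      (0 : Vec m)‖ ≤ (c.Lgradf₁ + (ρ * c.Lgradft₁ + 2 * ρ * μ * S)) * ‖u - u'‖ := by
    have h3 : ‖pair (gradient P.f₁ w - gradient P.f₁ w' + (P.penGrad ρ μ w - P.penGrad ρ μ w'))
        (0 : Vec m)‖ = ‖gradient P.f₁ w - gradient P.f₁ w' + (P.penGrad ρ μ w - P.penGrad ρ μ w')‖ := by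
      refine (sq_eq_sq₀ (norm_nonneg _) (norm_nonneg _)).1 ?_
      rw [norm_pair_sq, norm_zero]; ring
    rw [h3, add_mul]
    refine (norm_add_le _ _).trans (add_le_add ?_ ?_)
    · exact (hU.f₁_smooth.2 w hu.1 w' hu'.1).trans (by gcongr)
    · exact (penGrad_sub_le hU hρ hμ hu.1 hu'.1).trans (by gcongr)
  have n2 : ‖pair (-pt (P.penGrad ρ μ v - P.penGrad ρ μ v').fst (0 : Vec m))
      (P.penGrad ρ μ v - P.penGrad ρ μ v').snd‖ ≤ (ρ * c.Lgradft₁ + 2 * ρ * μ * S) * ‖u - u'‖ := by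
    have h3 : ‖pair (-pt (P.penGrad ρ μ v - P.penGrad ρ μ v').fst (0 : Vec m))
        (P.penGrad ρ μ v - P.penGrad ρ μ v').snd‖ = ‖P.penGrad ρ μ v - P.penGrad ρ μ v'‖ := by
      refine (sq_eq_sq₀ (norm_nonneg _) (norm_nonneg _)).1 ?_
      have h4 := norm_pt_sq (P.penGrad ρ μ v - P.penGrad ρ μ v').fst
        (P.penGrad ρ μ v - P.penGrad ρ μ v').snd
      rw [pt_fst_snd] at h4
      rw [norm_pair_sq, norm_neg, norm_pt_sq, h4, norm_zero]; ring
    rw [h3]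
    exact (penGrad_sub_le hU hρ hμ hu.2 hu'.2).trans (by gcongr)
  refine (norm_add_le _ _).trans ((add_le_add n1 n2).trans (le_of_eq ?_))
  have h5 : ρ * μ = (ε ^ 3)⁻¹ := by
    simp only [ρ, μ]; rw [← mul_inv]; ring_nf
  rw [Ltilde, ← h5]; ring

/-- The minimax problem of the penalty method satisfies the hypotheses under which the first-order
method works. -/
theorem minimax_regular (h₁ : P.Assumption1 c) (h₂ : P.Assumption2 c) (hDy : 0 < P.Dy)
    {U : Set (Pt n m)} (hU : P.SmoothRegion c U) {ε : ℝ} (hε : 0 < ε) :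
    (P.minimax ε⁻¹ (ε ^ 2)⁻¹ U).Regular (P.Ltilde c ε) := by
  have hρ : 0 < ε⁻¹ := inv_pos.2 hε
  have hμ : 0 ≤ (ε ^ 2)⁻¹ := by positivity
  have hXY : Convex ℝ P.XY := fun w hw w' hw' a b ha hb hab =>
    ⟨h₁.f₂_convex.convexOn.1 hw.1 hw'.1 ha hb hab, h₁.ft₂_convex.convexOn.1 hw.2 hw'.2 ha hb hab⟩
  have hsub : prodSet P.XY P.Y ⊆ (P.minimax ε⁻¹ (ε ^ 2)⁻¹ U).Ω := fun u hu =>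
    ⟨hU.subset hu.1, hU.subset ⟨hu.1.1, hu.2⟩⟩
  have hprox : ∀ s > 0, ∀ z, IsSubgrad P.Y (fun z => ε⁻¹ * realPart P.ft₂ z)
      (prox (s * ε⁻¹) P.ft₂ z) (s⁻¹ • (z - prox (s * ε⁻¹) P.ft₂ z)) := by
    intro s hs z
    have h := isSubgrad_prox h₁.ft₂_convex h₁.Y_compact (continuousOn_realPart_ft₂ h₁)
      (mul_pos hs hρ) z
    refine ⟨h.1, fun z' hz' => ?_⟩
    have h3 := mul_le_mul_of_nonneg_left (h.2 z' hz') hρ.le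
    rw [real_inner_smul_left] at h3 ⊢
    have h4 : ε⁻¹ * (s * ε⁻¹)⁻¹ = s⁻¹ := by field_simp
    rw [mul_add, ← mul_assoc ε⁻¹ (s * ε⁻¹)⁻¹, h4] at h3
    exact h3
  refine ⟨?_, hsub, fun s hs v => ?_, hprox, ?_, ?_,
    fun u hu u' hu' => minimax_lipschitz h₁ h₂ hDy hU hε hu hu'⟩
  · have h : prodSet P.XY P.Y = (WithLp.toLp 2 : Pt n m × Vec m → _) '' (P.XY ×ˢ P.Y) := by
      ext w
      exact ⟨fun hw => ⟨(w.fst, w.snd), hw, rfl⟩, by rintro ⟨p, hp, rfl⟩; exact hp⟩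
    change IsComplete (prodSet P.XY P.Y)
    rw [h]
    exact (((XY_compact h₁).prod h₁.Y_compact).image
      (WithLp.prod_continuous_toLp 2 _ _)).isComplete
  · exact (isSubgrad_prox h₁.f₂_convex h₁.X_compact (continuousOn_realPart_f₂ h₁) hs v.fst).pair
      (hprox s hs v.snd)
  · intro w hw w' hw' z hz
    set d := w' - w with hd
    have hmem : ∀ t ∈ Set.Icc (0 : ℝ) 1, w + t • d ∈ P.XY := fun t ht => by
      rw [show w + t • d = (1 - t) • w + t • w' by rw [hd]; module]
      exact hXY hw hw' (by linarith [ht.2]) ht.1 (by ring)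
    have e0 : ∀ t : ℝ, pt (w + t • d).fst z = pt w.fst z + t • pt d.fst 0 := fun t =>
      pt_add_smul_left w.fst d.fst z t
    have hder : ∀ t ∈ Set.Icc (0 : ℝ) 1,
        HasDerivAt (fun s : ℝ => (P.minimax ε⁻¹ (ε ^ 2)⁻¹ U).h (w + s • d) z)
          (inner ℝ ((P.minimax ε⁻¹ (ε ^ 2)⁻¹ U).gx (w + t • d) z) d) t := by
      intro t ht
      have hm1 := hmem t ht
      have hm2 : pt w.fst z + t • pt d.fst 0 ∈ P.XY := by
        rw [← e0]; exact ⟨hm1.1, hz⟩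
      have h3 := ((hasDerivAt_line (h₁.f₁_smooth.1 _ hm1)).add
        (hasDerivAt_penSmooth_line ε⁻¹ (ε ^ 2)⁻¹ (h₁.ft₁_smooth.1 _ hm1) (h₂.gt_diff _ hm1))).sub
        (hasDerivAt_penSmooth_line ε⁻¹ (ε ^ 2)⁻¹ (h₁.ft₁_smooth.1 _ hm2) (h₂.gt_diff _ hm2))
      rw [minimax_gx, inner_sub_left, inner_add_left, inner_pt_zero, e0,
        ← inner_pt_zero_right _ d.fst]
      refine h3.congr_of_eventuallyEq (Filter.Eventually.of_forall fun s => ?_)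
      simp only [minimax, e0, Pi.add_apply, Pi.sub_apply]
    have h4 := taylor_lower_bound (C := P.Ltilde c ε * ‖d‖ ^ 2) hder (fun t ht => by
      have hu : pair (w + t • d) z ∈ (P.minimax ε⁻¹ (ε ^ 2)⁻¹ U).Ω := hsub ⟨hmem t ht, hz⟩
      have hu0 : pair (w + (0 : ℝ) • d) z ∈ (P.minimax ε⁻¹ (ε ^ 2)⁻¹ U).Ω :=
        hsub ⟨hmem 0 ⟨le_rfl, zero_le_one⟩, hz⟩
      have h5 := minimax_lipschitz h₁ h₂ hDy hU hε hu hu0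
      set g := (P.minimax ε⁻¹ (ε ^ 2)⁻¹ U).gx (w + t • d) z
      set g0 := (P.minimax ε⁻¹ (ε ^ 2)⁻¹ U).gx (w + (0 : ℝ) • d) z
      have h6 : ‖g - g0‖ ≤ P.Ltilde c ε * (t * ‖d‖) := by
        have e1 : pair (w + t • d) z - pair (w + (0 : ℝ) • d) z = pair (t • d) 0 := by
          rw [pair_sub]; simp
        have e2 : ‖pair (t • d) (0 : Vec m)‖ = t * ‖d‖ := by
          refine (sq_eq_sq₀ (norm_nonneg _) (mul_nonneg ht.1 (norm_nonneg _))).1 ?_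
          rw [norm_pair_sq, norm_zero, norm_smul, Real.norm_of_nonneg ht.1]; ring
        rw [e1, e2] at h5
        refine le_trans (le_of_sq_le_sq ?_ (norm_nonneg _)) h5
        rw [pair_sub, norm_pair_sq]
        exact le_add_of_nonneg_right (sq_nonneg _)
      have h7 := (abs_le.1 (abs_real_inner_le_norm (g - g0) d)).1
      rw [inner_sub_left] at h7
      have h8 : ‖g - g0‖ * ‖d‖ ≤ P.Ltilde c ε * (t * ‖d‖) * ‖d‖ := by gcongr
      nlinarith)
    simp only [zero_smul, add_zero, one_smul] at h4
    rw [show w + d = w' by rw [hd]; abel] at h4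
    linarith
  · intro w hw z hz z' hz'
    have h3 := mul_le_mul_of_nonneg_left (ft₁_add_inner_le h₁ hw.1 hz z') hρ.le
    have h4 := mul_le_mul_of_nonneg_left (penalty_add_inner_le h₂ hw.1 hz z')
      (mul_nonneg hρ.le hμ)
    rw [minimax_gy, inner_neg_left]
    have e1 : inner ℝ (P.penGrad ε⁻¹ (ε ^ 2)⁻¹ (pt w.fst z)).snd (z' - z) =
        ε⁻¹ * inner ℝ (gradient P.ft₁ (pt w.fst z)).snd (z' - z) +
        2 * ε⁻¹ * (ε ^ 2)⁻¹ *
          inner ℝ (P.gradgtMul (pt w.fst z) (posPart (P.gt (pt w.fst z)))).snd (z' - z) := by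
      rw [← real_inner_smul_left, ← real_inner_smul_left, ← inner_add_left]; rfl
    rw [e1]
    simp only [minimax, penSmooth]
    linarith

end Problem

namespace Problem

variable {n m l : ℕ} {P : Problem n m l} {c : Moduli}

/-! ### The lower level problem and the bounds on the minimax objective -/

theorem posPart_gt_eq_zero {x : Vec n} {z : Vec m} (h : P.Feasible x z) :
    posPart (P.gt (pt x z)) = 0 := by
  ext i
  rw [posPart_apply, max_eq_right (h i)]; rfl

theorem penalty_eq_of_feasible (μ : ℝ) {x : Vec n} {z : Vec m} (h : P.Feasible x z) :
    P.penalty μ (pt x z) = P.ftR (pt x z) := by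
  rw [penalty, posPart_gt_eq_zero h, norm_zero]; ring

theorem ftR_le_penalty {μ : ℝ} (hμ : 0 ≤ μ) (w : Pt n m) : P.ftR w ≤ P.penalty μ w :=
  le_add_of_nonneg_right (by positivity)

theorem exists_feasible (h₂ : P.Assumption2 c) {x : Vec n} (hx : x ∈ P.X) :
    ∃ z ∈ P.Y, P.Feasible x z ∧ ∀ i, c.G ≤ -P.gt (pt x z) i := by
  obtain ⟨zhat, hz⟩ := h₂.slater
  exact ⟨zhat x, (hz x hx).1, fun i => by linarith [(hz x hx).2 i, h₂.G_pos], (hz x hx).2⟩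

theorem lowerSol_subset (h₁ : P.Assumption1 c) (h₂ : P.Assumption2 c) {x : Vec n} (hx : x ∈ P.X)
    {y : Vec m} (hy : y ∈ P.lowerSol x) : y ∈ P.Y := by
  obtain ⟨z, hz, hf, -⟩ := exists_feasible h₂ hx
  by_contra h
  have h3 := hy.2 z hf
  rw [ft_eq_top (w := pt x y) h, top_le_iff, ← coe_ftR h₁ (w := pt x z) hz] at h3
  exact EReal.coe_ne_top _ h3

theorem exists_lowerSol (h₁ : P.Assumption1 c) (h₂ : P.Assumption2 c) {x : Vec n} (hx : x ∈ P.X) :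
    ∃ y, y ∈ P.lowerSol x := by
  have hc : ContinuousOn (fun y => pt x y) P.Y :=
    (continuous_pt.comp (Continuous.prodMk_right x)).continuousOn
  have hmaps : Set.MapsTo (fun y => pt x y) P.Y P.XY := fun y hy => pt_mem_XY hx hy
  have hg : ContinuousOn (fun y => posPart (P.gt (pt x y))) P.Y :=
    continuous_posPart.comp_continuousOn ((continuousOn_gt h₂).comp hc hmaps)
  have hclosed : IsClosed (P.Y ∩ (fun y => posPart (P.gt (pt x y))) ⁻¹' {0}) :=
    hg.preimage_isClosed_of_isClosed h₁.Y_compact.isClosed isClosed_singleton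
  have hcomp := h₁.Y_compact.of_isClosed_subset hclosed Set.inter_subset_left
  have hmem : ∀ y, posPart (P.gt (pt x y)) = 0 → P.Feasible x y := fun y hy i => by
    have h3 := congrArg (fun v : Vec l => v i) hy
    simp only [posPart_apply] at h3
    exact (le_max_left _ _).trans h3.le
  obtain ⟨z, hz, hf, -⟩ := exists_feasible h₂ hx
  obtain ⟨y, hy, hmin⟩ := hcomp.exists_isMinOn ⟨z, hz, posPart_gt_eq_zero hf⟩
    (f := fun y => P.ftR (pt x y))
    (((continuousOn_ftR h₁).comp hc hmaps).mono Set.inter_subset_left)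
  refine ⟨y, hmem y hy.2, fun z' hz' => ?_⟩
  by_cases hY : z' ∈ P.Y
  · rw [← coe_ftR h₁ (w := pt x y) hy.1, ← coe_ftR h₁ (w := pt x z') hY]
    exact EReal.coe_le_coe_iff.2 (hmin ⟨hY, posPart_gt_eq_zero hz'⟩)
  · rw [ft_eq_top (w := pt x z') hY]; exact le_top

theorem ftStar_eq {x : Vec n} {y : Vec m} (hy : y ∈ P.lowerSol x) : P.ftStar x = P.ftR (pt x y) := by
  rw [ftStar, ftR]
  congr 1
  exact le_antisymm (iInf_le_of_le ⟨y, hy.1⟩ le_rfl) (le_iInf fun z => hy.2 z.1 z.2)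

theorem ftStar_le (h₁ : P.Assumption1 c) (h₂ : P.Assumption2 c) {x : Vec n} (hx : x ∈ P.X)
    {z : Vec m} (hz : z ∈ P.Y) (hf : P.Feasible x z) : P.ftStar x ≤ P.ftR (pt x z) := by
  obtain ⟨y, hy⟩ := exists_lowerSol h₁ h₂ hx
  rw [ftStar_eq hy]
  have h3 := hy.2 z hf
  rw [← coe_ftR h₁ (w := pt x y) (lowerSol_subset h₁ h₂ hx hy), ← coe_ftR h₁ (w := pt x z) hz] at h3
  exact EReal.coe_le_coe_iff.1 h3

/-- A lower bound of `f` over the feasible points of the bilevel problem in `𝒳 × 𝒴` is one of its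
optimal value, which is finite by compactness and the Slater condition. -/
theorem le_fStar (h₁ : P.Assumption1 c) (h₂ : P.Assumption2 c) {B : ℝ}
    (h : ∀ x ∈ P.X, ∀ y ∈ P.Y, y ∈ P.lowerSol x → B ≤ P.fR (pt x y)) : B ≤ P.fStar := by
  have h3 : (B : EReal) ≤ ⨅ w : {w : Pt n m // w.snd ∈ P.lowerSol w.fst}, P.f w.1 := by
    refine le_iInf fun w => ?_
    by_cases hx : w.1.fst ∈ P.X
    · rw [← coe_fR h₁ hx]
      exact EReal.coe_le_coe_iff.2 (h _ hx _ (lowerSol_subset h₁ h₂ hx w.2) w.2)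
    · rw [f_eq_top hx]; exact le_top
  obtain ⟨x, hx⟩ := X_nonempty h₁
  obtain ⟨y, hy⟩ := exists_lowerSol h₁ h₂ hx
  have h4 : (⨅ w : {w : Pt n m // w.snd ∈ P.lowerSol w.fst}, P.f w.1) ≤
      ((P.fR (pt x y) : ℝ) : EReal) := by
    rw [coe_fR h₁ (w := pt x y) hx]
    exact iInf_le_of_le ⟨pt x y, hy⟩ le_rfl
  have h5 := EReal.coe_toReal (ne_top_of_le_ne_top (EReal.coe_ne_top _) h4)
    (ne_bot_of_le_ne_bot (EReal.coe_ne_bot _) h3)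
  rw [← h5] at h3
  exact EReal.coe_le_coe_iff.1 h3

theorem minimax_Heps (h₁ : P.Assumption1 c) {ε : ℝ} {x₀ : Vec n} {y₀ : Vec m} {U : Set (Pt n m)}
    {ρ μ : ℝ} {w : Pt n m} {z : Vec m} (hw : w ∈ P.XY) (hz : z ∈ P.Y) :
    (P.minimax ρ μ U).Heps (P.params c ε x₀ y₀) w z =
      P.fR w + ρ * (P.penalty μ w - P.penalty μ (pt w.fst z)) - ε / (4 * P.Dy) * ‖z - y₀‖ ^ 2 := by
  rw [MinimaxProblem.Heps, fR_eq h₁ hw.1, penalty, penalty, ftR_eq h₁ hw.2,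
    ftR_eq h₁ (w := pt w.fst z) hz]
  simp only [minimax, penSmooth, params, pt_snd]
  ring

theorem proximity_le (h₁ : P.Assumption1 c) (hDy : 0 < P.Dy) {ε : ℝ} (hε : 0 < ε) {y y' : Vec m}
    (hy : y ∈ P.Y) (hy' : y' ∈ P.Y) : ε / (4 * P.Dy) * ‖y - y'‖ ^ 2 ≤ ε * P.Dy / 4 := by
  have h3 : ‖y - y'‖ ^ 2 ≤ P.Dy ^ 2 := by gcongr; exact norm_sub_le_Dy h₁ hy hy'
  calc ε / (4 * P.Dy) * ‖y - y'‖ ^ 2 ≤ ε / (4 * P.Dy) * P.Dy ^ 2 := by gcongr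
    _ = ε * P.Dy / 4 := by field_simp

/-- The bounds on the minimax objective: its upper value is controlled by the optimal value of the
bilevel problem, since the penalty terms cancel at lower level solutions. -/
theorem minimax_bounds (h₁ : P.Assumption1 c) (h₂ : P.Assumption2 c) (hDy : 0 < P.Dy) {ε : ℝ}
    (hε : 0 < ε) {x₀ : Vec n} {y₀ : Vec m} (hy₀ : y₀ ∈ P.Y) (U : Set (Pt n m)) :
    (P.minimax ε⁻¹ (ε ^ 2)⁻¹ U).Bounds (P.params c ε x₀ y₀) (P.Dx ^ 2 + P.Dy ^ 2)
      (P.fStar + ε⁻¹ * (P.ftHi - P.ftLow))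
      (P.fLow + ε⁻¹ * (P.ftLow - (P.ftHi + (ε ^ 2)⁻¹ * P.gtHi ^ 2)) - ε * P.Dy / 4)
      (P.fLow - ε * P.Dy / 4) := by
  have hρ : 0 ≤ ε⁻¹ := (inv_pos.2 hε).le
  have hμ : 0 ≤ (ε ^ 2)⁻¹ := by positivity
  refine ⟨fun w hw w' hw' => ?_, fun y hy y' hy' => norm_sub_le_Dy h₁ hy hy', fun w hw z hz => ?_,
    fun z hz B hB => ?_, fun w hw => ⟨w.snd, hw.2, ?_⟩⟩
  · have h3 := norm_pt_sq (w - w').fst (w - w').snd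
    rw [pt_fst_snd] at h3
    rw [h3]
    gcongr
    · exact norm_sub_le_Dx h₁ hw.1 hw'.1
    · exact norm_sub_le_Dy h₁ hw.2 hw'.2
  · rw [minimax_Heps h₁ hw hz]
    have hv : pt w.fst z ∈ P.XY := ⟨hw.1, hz⟩
    have h3 : P.penalty (ε ^ 2)⁻¹ (pt w.fst z) ≤ P.ftHi + (ε ^ 2)⁻¹ * P.gtHi ^ 2 := by
      rw [penalty]
      have := (norm_posPart_le (P.gt (pt w.fst z))).trans (norm_gt_le h₁ h₂ hv)
      gcongr
      exact le_ftHi h₁ hv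
    have h4 := (ftLow_le h₁ hw).trans (ftR_le_penalty hμ w)
    have h5 := proximity_le h₁ hDy hε hz hy₀
    have h6 := fLow_le h₁ hw
    have h7 : ε⁻¹ * (P.ftLow - (P.ftHi + (ε ^ 2)⁻¹ * P.gtHi ^ 2)) ≤
        ε⁻¹ * (P.penalty (ε ^ 2)⁻¹ w - P.penalty (ε ^ 2)⁻¹ (pt w.fst z)) := by gcongr
    linarith
  · have h3 : B - ε⁻¹ * (P.ftHi - P.ftLow) ≤ P.fStar := le_fStar h₁ h₂ fun x hx y hy hs => by
      have h4 := hB (pt x y) (pt_mem_XY hx hy)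
      rw [minimax_Heps h₁ (pt_mem_XY hx hy) hz, penalty_eq_of_feasible _ hs.1] at h4
      have h5 := le_ftHi h₁ (pt_mem_XY hx hy)
      have h6 := (ftLow_le h₁ (pt_mem_XY hx hz)).trans (ftR_le_penalty hμ (pt x z))
      have h7 : ε⁻¹ * (P.ftR (pt x y) - P.penalty (ε ^ 2)⁻¹ (pt x z)) ≤
        ε⁻¹ * (P.ftHi - P.ftLow) := by gcongr
      have h8 : 0 ≤ ε / (4 * P.Dy) * ‖z - y₀‖ ^ 2 := by positivity
      rw [pt_fst] at h4
      linarith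
    linarith
  · rw [minimax_Heps h₁ hw hw.2, pt_fst_snd, sub_self, mul_zero, add_zero]
    have h5 := proximity_le h₁ hDy hε hw.2 hy₀
    have h6 := fLow_le h₁ hw
    linarith

/-! ### The constants of the complexity bound -/

section Constants

variable {ε : ℝ} {x₀ : Vec n} {y₀ : Vec m}

theorem eps₀_sq (hε : 0 < ε) : (P.params c ε x₀ y₀).eps₀ ^ 2 = ε ^ 5 := by
  change (ε ^ (5 / 2 : ℝ)) ^ 2 = ε ^ 5
  rw [← Real.rpow_natCast, ← Real.rpow_mul hε.le, ← Real.rpow_natCast]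
  norm_num

theorem params_positive (hL : 0 < P.Ltilde c ε) (hDy : 0 < P.Dy) (hε : 0 < ε) :
    (P.params c ε x₀ y₀).Positive :=
  ⟨hL, hDy, hε, Real.rpow_pos_of_pos hε _⟩

theorem params_αbar (hDy : 0 < P.Dy) :
    (P.params c ε x₀ y₀).αbar = P.αtilde c ε := by
  simp only [MinimaxParams.αbar, MinimaxParams.σy, MinimaxParams.σx, params, αtilde]
  congr 2
  field_simp
  ring

theorem two_div_αtilde (hL : 0 < P.Ltilde c ε) (hDy : 0 < P.Dy) (hε : 0 < ε) :
    2 / P.αtilde c ε = max 2 (Real.sqrt (P.Dy * P.Ltilde c ε * ε⁻¹)) := by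
  set r := Real.sqrt (P.Dy * P.Ltilde c ε * ε⁻¹) with hr
  have hr0 : 0 < r := Real.sqrt_pos.2 (by positivity)
  have h3 : Real.sqrt (4 * ε / (P.Dy * P.Ltilde c ε)) = 2 / r := by
    rw [Real.sqrt_eq_iff_mul_self_eq (by positivity) (by positivity), div_mul_div_comm, hr,
      Real.mul_self_sqrt (by positivity)]
    field_simp
    norm_num
  rw [αtilde, h3]
  rcases le_total r 2 with h | h
  · rw [min_eq_left ((one_le_div hr0).2 h), max_eq_left h, div_one]
  · rw [min_eq_right ((div_le_one hr0).2 h), max_eq_right h]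
    field_simp

theorem αtilde_pos (hL : 0 < P.Ltilde c ε) (hDy : 0 < P.Dy) (hε : 0 < ε) : 0 < P.αtilde c ε :=
  lt_min one_pos (Real.sqrt_pos.2 (by positivity))

theorem params_ηy (hDy : 0 < P.Dy) :
    (P.params c ε x₀ y₀).ηy = min (P.Dy * ε⁻¹) (4 / (P.αtilde c ε * P.Ltilde c ε)) := by
  rw [MinimaxParams.ηy, params_αbar hDy]
  simp only [MinimaxParams.σy, MinimaxParams.σx, params]
  congr 1
  field_simp

theorem params_ηy_inv (hL : 0 < P.Ltilde c ε) (hDy : 0 < P.Dy) (hε : 0 < ε) :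
    (P.params c ε x₀ y₀).ηy⁻¹ = max (ε / P.Dy) (P.αtilde c ε * P.Ltilde c ε / 4) := by
  have hα := αtilde_pos hL hDy hε
  have h1 : 0 < P.Dy * ε⁻¹ := by positivity
  have h2 : 0 < 4 / (P.αtilde c ε * P.Ltilde c ε) := by positivity
  have e1 : (P.Dy * ε⁻¹)⁻¹ = ε / P.Dy := by field_simp
  have e2 : (4 / (P.αtilde c ε * P.Ltilde c ε))⁻¹ = P.αtilde c ε * P.Ltilde c ε / 4 := by field_simp
  rw [params_ηy hDy, ← e1, ← e2]
  rcases le_total (P.Dy * ε⁻¹) (4 / (P.αtilde c ε * P.Ltilde c ε)) with h | h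
  · rw [min_eq_left h, max_eq_left (inv_anti₀ h1 h)]
  · rw [min_eq_right h, max_eq_right (inv_anti₀ h2 h)]

theorem params_Cbound (hL : 0 < P.Ltilde c ε) (hDy : 0 < P.Dy) (hε : 0 < ε) :
    (P.params c ε x₀ y₀).Cbound (P.Dx ^ 2 + P.Dy ^ 2) (P.fStar + ε⁻¹ * (P.ftHi - P.ftLow))
      (P.fLow + ε⁻¹ * (P.ftLow - (P.ftHi + (ε ^ 2)⁻¹ * P.gtHi ^ 2)) - ε * P.Dy / 4) =
      P.Ctilde c ε := by
  have hα := αtilde_pos hL hDy hε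
  have hm : 0 < min (P.Ltilde c ε) (ε / (2 * P.Dy)) := lt_min hL (by positivity)
  have hQ : 0 < (3 * P.Ltilde c ε + ε / (2 * P.Dy)) ^ 2 / min (P.Ltilde c ε) (ε / (2 * P.Dy)) +
      3 * P.Ltilde c ε + ε / (2 * P.Dy) := by positivity
  rw [MinimaxParams.Cbound, MinimaxParams.Λ, MinimaxParams.Ψ₀, eps₀_sq hε, params_ηy_inv hL hDy hε,
    params_αbar hDy, params_ηy hDy, Ctilde, δtilde]
  simp only [MinimaxParams.ζhat, MinimaxParams.Lbar, MinimaxParams.σy, MinimaxParams.σx, params]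
  rw [inv_div, ← add_assoc]
  generalize (3 * P.Ltilde c ε + ε / (2 * P.Dy)) ^ 2 / min (P.Ltilde c ε) (ε / (2 * P.Dy)) +
      3 * P.Ltilde c ε + ε / (2 * P.Dy) = Q at *
  generalize max (1 / (2 * P.Ltilde c ε)) (min (P.Dy * ε⁻¹) (4 / (P.αtilde c ε * P.Ltilde c ε))) = A
  generalize max (ε / P.Dy) (P.αtilde c ε * P.Ltilde c ε / 4) = B
  field_simp
  ring

theorem slack_le (hL : 0 < P.Ltilde c ε) (hDy : 0 < P.Dy) (hε : 0 < ε) :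
    2 * (P.params c ε x₀ y₀).slack * (P.params c ε x₀ y₀).eps₀ ^ 2 ≤
      2 * ε ^ 5 * ((P.Ltilde c ε)⁻¹ + 4 * P.Dy ^ 2 * P.Ltilde c ε * (ε ^ 2)⁻¹) := by
  rw [eps₀_sq hε, MinimaxParams.slack]
  simp only [params]
  have h3 : 1 / (2 * P.Ltilde c ε) + P.Dy / ε ≤
      (P.Ltilde c ε)⁻¹ + 4 * P.Dy ^ 2 * P.Ltilde c ε * (ε ^ 2)⁻¹ := by
    set s := P.Dy * P.Ltilde c ε / ε with hs
    have e1 : 1 / (2 * P.Ltilde c ε) + P.Dy / ε = (1 / 2 + s) * (P.Ltilde c ε)⁻¹ := by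
      rw [hs]; field_simp
    have e2 : (P.Ltilde c ε)⁻¹ + 4 * P.Dy ^ 2 * P.Ltilde c ε * (ε ^ 2)⁻¹ =
        (1 + 4 * s ^ 2) * (P.Ltilde c ε)⁻¹ := by
      rw [hs]; field_simp
    rw [e1, e2]
    exact mul_le_mul_of_nonneg_right (by nlinarith [sq_nonneg (2 * s - 1 / 2)])
      (inv_pos.2 hL).le
  have h4 : 0 ≤ ε ^ 5 := by positivity
  nlinarith

/-- The outer iteration bound of the minimax method is at most `K̃`. The two formulas differ by a
factor of at least `2` up to the lower order terms, and the integrality of `k` absorbs the `-1` in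
`K̃`. -/
theorem le_Ktilde (hL : 0 < P.Ltilde c ε) (hDy : 0 < P.Dy) (hε : 0 < ε)
    (hε1 : ε ≤ 1 / 4) {k : ℕ}
    (hk : (k : ℝ) ≤ 16 * (P.params c ε x₀ y₀).L / (P.params c ε x₀ y₀).eps ^ 2 *
      (P.fR (pt x₀ y₀) + 1 - (P.fLow - ε * P.Dy / 4) +
        2 * (P.params c ε x₀ y₀).slack * (P.params c ε x₀ y₀).eps₀ ^ 2)) :
    k ≤ P.Ktilde c ε x₀ y₀ := by
  rcases k with _ | k
  · exact Nat.zero_le _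
  rw [eps₀_sq hε, MinimaxParams.slack] at hk
  simp only [params] at hk
  rw [Ktilde]
  refine Nat.lt_ceil.2 ?_
  push_cast at hk
  set s := P.Dy * P.Ltilde c ε / ε with hs
  have hs0 : 0 < s := by positivity
  set B := (1 + P.fR (pt x₀ y₀) - P.fLow + ε * P.Dy / 4) * P.Ltilde c ε * (ε ^ 2)⁻¹ with hB
  have e1 : 16 * P.Ltilde c ε / ε ^ 2 * (P.fR (pt x₀ y₀) + 1 - (P.fLow - ε * P.Dy / 4) +
      2 * (1 / (2 * P.Ltilde c ε) + P.Dy / ε) * ε ^ 5) = 16 * B + 16 * ε ^ 3 * (1 + 2 * s) := by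
    rw [hB, hs]; field_simp; ring
  have e2 : 32 * (1 + P.fR (pt x₀ y₀) - P.fLow + ε * P.Dy / 4) * P.Ltilde c ε * (ε ^ 2)⁻¹ +
      32 * ε ^ 3 * (1 + 4 * P.Dy ^ 2 * P.Ltilde c ε ^ 2 * (ε ^ 2)⁻¹) - 1 =
      32 * B + 32 * ε ^ 3 * (1 + 4 * s ^ 2) - 1 := by
    rw [hB, hs]; field_simp
  rw [e1] at hk
  rw [e2]
  have h3 : ε ^ 3 ≤ 1 / 64 := by
    calc ε ^ 3 ≤ (1 / 4) ^ 3 := by gcongr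
      _ = 1 / 64 := by norm_num
  have h4 : 64 * ε ^ 3 * (s - 2 * s ^ 2) ≤ 1 / 8 := by
    have h5 : s - 2 * s ^ 2 ≤ 1 / 8 := by nlinarith [sq_nonneg (s - 1 / 4)]
    have h6 : 0 < ε ^ 3 := by positivity
    nlinarith
  have h7 : (0 : ℝ) ≤ k := Nat.cast_nonneg k
  linarith

theorem sum_midBound_le {V W : Type} (A : MinimaxParams V W) (hα : 0 < A.αbar) (D2 Hup Hlo : ℝ)
    {k K : ℕ} (h : k ≤ K) :
    ∑ i ∈ Finset.range (k + 1), A.midBound D2 Hup Hlo i ≤ 2 / A.αbar *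
      (((K : ℝ) + 1) * max (Real.log (A.Cbound D2 Hup Hlo)) 0 + (K : ℝ) + 1 +
        2 * (K : ℝ) * Real.log ((K : ℝ) + 1)) := by
  simp only [MinimaxParams.midBound]
  rw [← Finset.mul_sum]
  gcongr
  rw [Finset.sum_add_distrib, Finset.sum_const, Finset.card_range, nsmul_eq_mul,
    ← Finset.mul_sum, Finset.sum_range_succ']
  have hkK : (k : ℝ) ≤ K := Nat.cast_le.2 h
  have h3 : ∑ i ∈ Finset.range k, Real.log (((i + 1 : ℕ) : ℝ) + 1) ≤
      (K : ℝ) * Real.log ((K : ℝ) + 1) := by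
    have h4 : ∀ i ∈ Finset.range k, Real.log (((i + 1 : ℕ) : ℝ) + 1) ≤ Real.log ((K : ℝ) + 1) := by
      intro i hi
      have : ((i + 1 : ℕ) : ℝ) ≤ K := Nat.cast_le.2 (by have := Finset.mem_range.1 hi; lia)
      gcongr
    refine (Finset.sum_le_card_nsmul _ _ _ h4).trans ?_
    rw [Finset.card_range, nsmul_eq_mul]
    have : 0 ≤ Real.log ((K : ℝ) + 1) :=
      Real.log_nonneg (le_add_of_nonneg_left (Nat.cast_nonneg K))
    gcongr
  have h5 : ((k + 1 : ℕ) : ℝ) * (1 + max (Real.log (A.Cbound D2 Hup Hlo)) 0) ≤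
      ((K : ℝ) + 1) * (1 + max (Real.log (A.Cbound D2 Hup Hlo)) 0) := by
    push_cast; gcongr
  rw [Nat.cast_zero, zero_add, Real.log_one, add_zero]
  linarith

theorem cost_le (hA : (P.params c ε x₀ y₀).Positive) :
    ((P.params c ε x₀ y₀).cost : ℝ) ≤ (⌈96 * Real.sqrt 2 *
      (1 + (24 * P.Ltilde c ε + 4 * ε / P.Dy) * (P.Ltilde c ε)⁻¹)⌉₊ : ℝ) + 2 := by
  have hL := hA.L
  have hD := hA.D
  have hε := hA.eps
  simp only [params] at hL hD hε
  have e : (P.params c ε x₀ y₀).κ =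
      1 + (24 * P.Ltilde c ε + 4 * ε / P.Dy) * (P.Ltilde c ε)⁻¹ := by
    simp only [MinimaxParams.κ, MinimaxParams.Lbar, MinimaxParams.σx, params]
    field_simp
    ring
  rw [← e, MinimaxParams.cost]
  have hκ : 1 ≤ (P.params c ε x₀ y₀).κ := by
    rw [e]; exact le_add_of_nonneg_right (by positivity)
  set κ := (P.params c ε x₀ y₀).κ
  have h3 := Nat.ceil_lt_add_one (by positivity : 0 ≤ 30 * κ)
  have h4 := Nat.le_ceil (96 * Real.sqrt 2 * κ)
  have h5 : (1.41 : ℝ) ≤ Real.sqrt 2 := Real.le_sqrt_of_sq_le (by norm_num)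
  have h6 : 96 * 1.41 * κ ≤ 96 * Real.sqrt 2 * κ := by gcongr
  push_cast
  linarith

end Constants

/-! ### Termination of the penalty method -/

theorem queryLog_cheap (ρ : ℝ) :
    (queryLog (n := n) (m := m) ρ).Cheap
        (fun e => match e with | Query.gradf₁ _ => true | _ => false) ∧
    (queryLog (n := n) (m := m) ρ).Cheap
        (fun e => match e with | Query.gradft₁ _ => true | _ => false) ∧
    (queryLog (n := n) (m := m) ρ).Cheap
        (fun e => match e with | Query.gradgt _ => true | _ => false) ∧
    (queryLog (n := n) (m := m) ρ).Cheap
        (fun e => match e with | Query.proxf₂ _ _ => true | _ => false) ∧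
    (queryLog (n := n) (m := m) ρ).Cheap
        (fun e => match e with | Query.proxft₂ _ _ => true | _ => false) := by
  refine ⟨.inl fun x y s s' x' y' => ?_, .inl fun x y s s' x' y' => ?_,
    .inl fun x y s s' x' y' => ?_, .inr fun x y s s' x' y' => ?_, .inr fun x y s s' x' y' => ?_⟩ <;>
  simp [queryLog]

/-- The penalty method terminates within the stated numbers of oracle calls; its output is
approximately stationary for the minimax problem, and approximately minimizes the primal function
in the sense of the last conjunct. -/
theorem penaltyRun_terminates (h₁ : P.Assumption1 c) (h₂ : P.Assumption2 c) (hDy : 0 < P.Dy)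
    {ε : ℝ} (hε : 0 < ε) (hε1 : ε ≤ 1 / 4) (hL : 0 < P.Ltilde c ε) {x₀ : Vec n} {y₀ : Vec m}
    (hx₀ : x₀ ∈ P.X) (hy₀ : y₀ ∈ P.Y)
    (hstart : ∀ y ∈ P.Y, P.penalty (ε ^ 2)⁻¹ (pt x₀ y₀) ≤ P.penalty (ε ^ 2)⁻¹ (pt x₀ y) + ε)
    {U : Set (Pt n m)} (hU : P.SmoothRegion c U)
    (hgood : ∀ j : ℕ, ∀ q ∈ (P.penaltyRun c ε x₀ y₀ j).2, q.GradIn U) :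
    ∃ (j : ℕ) (x : Vec n) (y z : Vec m) (bx : Pt n m) (bz : Vec m),
      (P.penaltyRun c ε x₀ y₀ j).1 = Config.halted (pt x y) z ∧
      (Query.numGradf₁ (P.penaltyRun c ε x₀ y₀ j).2 : ℝ) ≤ P.Ntilde c ε x₀ y₀ ∧
      (Query.numGradft₁ (P.penaltyRun c ε x₀ y₀ j).2 : ℝ) ≤ P.Ntilde c ε x₀ y₀ ∧
      (Query.numGradgt (P.penaltyRun c ε x₀ y₀ j).2 : ℝ) ≤ P.Ntilde c ε x₀ y₀ ∧
      (Query.numProxf₂ (P.penaltyRun c ε x₀ y₀ j).2 : ℝ) ≤ P.Ntilde c ε x₀ y₀ ∧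
      (Query.numProxft₂ (P.penaltyRun c ε x₀ y₀ j).2 : ℝ) ≤ P.Ntilde c ε x₀ y₀ ∧
      IsSubgrad P.XY (fun w => realPart P.f₂ w.fst + ε⁻¹ * realPart P.ft₂ w.snd) (pt x y) bx ∧
      IsSubgrad P.Y (fun z => ε⁻¹ * realPart P.ft₂ z) z bz ∧
      ‖bx + (gradient P.f₁ (pt x y) + P.penGrad ε⁻¹ (ε ^ 2)⁻¹ (pt x y) -
        pt (P.penGrad ε⁻¹ (ε ^ 2)⁻¹ (pt x z)).fst 0)‖ ≤ ε ∧
      ‖bz + (P.penGrad ε⁻¹ (ε ^ 2)⁻¹ (pt x z)).snd‖ ≤ ε ∧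
      ∀ z' ∈ P.Y, P.fR (pt x y) +
        ε⁻¹ * (P.penalty (ε ^ 2)⁻¹ (pt x y) - P.penalty (ε ^ 2)⁻¹ (pt x z')) ≤
          1 + P.fR (pt x₀ y₀) + P.Dy * ε / 4 +
            2 * ε ^ 5 * ((P.Ltilde c ε)⁻¹ + 4 * P.Dy ^ 2 * P.Ltilde c ε * (ε ^ 2)⁻¹) := by
  set M := P.minimax ε⁻¹ (ε ^ 2)⁻¹ U with hMdef
  set A := P.params c ε x₀ y₀ with hAdef
  have hM : M.Regular A.L := minimax_regular h₁ h₂ hDy hU hε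
  have hA : A.Positive := params_positive hL hDy hε
  have hρ : 0 < ε⁻¹ := inv_pos.2 hε
  have hrun : ∀ j, P.penaltyRun c ε x₀ y₀ j = run (M.oracle (queryLog ε⁻¹)) A j := fun j => by
    rw [penaltyRun, oracle_eq P ε⁻¹ (ε ^ 2)⁻¹ U]
  have hm₀ : ∀ z ∈ M.Y, M.Heps A A.xinit z ≤ P.fR (pt x₀ y₀) + 1 := by
    intro z hz
    have h3 : M.Heps A A.xinit z = _ :=
      minimax_Heps (w := pt x₀ y₀) h₁ (pt_mem_XY hx₀ hy₀) hz
    rw [h3]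
    have h4 := hstart z hz
    have h5 : ε⁻¹ * (P.penalty (ε ^ 2)⁻¹ (pt x₀ y₀) - P.penalty (ε ^ 2)⁻¹ (pt x₀ z)) ≤ ε⁻¹ * ε := by
      gcongr; linarith
    rw [inv_mul_cancel₀ hε.ne'] at h5
    have h6 : 0 ≤ ε / (4 * P.Dy) * ‖z - y₀‖ ^ 2 := by positivity
    rw [pt_fst]
    linarith
  obtain ⟨j, o, w, z, lst, hj, hk, ⟨bx, bz, hbx, hbz, hres⟩, hmove, hval, hcount⟩ :=
    minimax_method_terminates (good := Query.GradIn U) (lg := queryLog ε⁻¹) hM hA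
      (fun w z h => ⟨h (Query.gradf₁ w) (by simp [queryLog]),
        h (Query.gradgt (pt w.fst z)) (by simp [queryLog])⟩)
      (minimax_bounds h₁ h₂ hDy hε hy₀ U) (pt_mem_XY hx₀ hy₀) hy₀ hm₀
      (fun j => by rw [← hrun]; exact hgood j)
  have hkK := le_Ktilde hL hDy hε hε1 hk
  have hw : w ∈ P.XY := hbx.1
  have hz : z ∈ P.Y := hbz.1
  have hcnt : ∀ cc, (queryLog (n := n) (m := m) ε⁻¹).Cheap cc →
      (((P.penaltyRun c ε x₀ y₀ j).2).countP cc : ℝ) ≤ P.Ntilde c ε x₀ y₀ := by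
    intro cc hcc
    rw [hrun, hj]
    refine (hcount cc hcc).trans ?_
    have hα := αtilde_pos hL hDy hε
    have h3 := sum_midBound_le A (by rw [hAdef, params_αbar hDy]; exact hα) (P.Dx ^ 2 + P.Dy ^ 2)
      (P.fStar + ε⁻¹ * (P.ftHi - P.ftLow))
      (P.fLow + ε⁻¹ * (P.ftLow - (P.ftHi + (ε ^ 2)⁻¹ * P.gtHi ^ 2)) - ε * P.Dy / 4) hkK
    rw [hAdef, params_αbar hDy, params_Cbound hL hDy hε, two_div_αtilde hL hDy hε] at h3
    rw [Ntilde, mul_assoc]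
    exact (mul_le_mul_of_nonneg_left h3 (Nat.cast_nonneg _)).trans
      (mul_le_mul_of_nonneg_right (cost_le hA) (by
        have : 0 ≤ Real.log ((P.Ktilde c ε x₀ y₀ : ℝ) + 1) :=
          Real.log_nonneg (le_add_of_nonneg_left (Nat.cast_nonneg _))
        positivity))
  obtain ⟨c1, c2, c3, c4, c5⟩ := queryLog_cheap (n := n) (m := m) ε⁻¹
  -- the tolerance of the last call of the solver is at most `ε / 2`
  have hτ : (A.eps₀ / ((o.k : ℝ) + 1)) ^ 2 ≤ (ε / 2) ^ 2 := by
    have h3 : A.eps₀ / ((o.k : ℝ) + 1) ≤ A.eps₀ :=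
      div_le_self hA.eps₀.le (le_add_of_nonneg_left (Nat.cast_nonneg _))
    have h4 : 0 ≤ A.eps₀ / ((o.k : ℝ) + 1) := div_nonneg hA.eps₀.le (by positivity)
    calc (A.eps₀ / ((o.k : ℝ) + 1)) ^ 2 ≤ A.eps₀ ^ 2 := by gcongr
      _ = ε ^ 2 * ε ^ 3 := by rw [eps₀_sq hε]; ring
      _ ≤ ε ^ 2 * (1 / 4) ^ 3 := by gcongr
      _ ≤ (ε / 2) ^ 2 := by nlinarith [sq_nonneg ε]
  have hres1 : ‖bx + M.gbX A o w z‖ ≤ ε / 2 :=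
    le_of_sq_le_sq (by linarith [sq_nonneg ‖bz - M.gbY A w z‖]) (by positivity)
  have hres2 : ‖bz - M.gbY A w z‖ ≤ ε / 2 :=
    le_of_sq_le_sq (by linarith [sq_nonneg ‖bx + M.gbX A o w z‖]) (by positivity)
  refine ⟨j, w.fst, w.snd, z, bx, bz, ?_, hcnt _ c1, hcnt _ c2, hcnt _ c3, hcnt _ c4, hcnt _ c5,
    hbx, hbz, ?_, ?_, fun z' hz' => ?_⟩
  · rw [hrun, hj]; rfl
  · have e : bx + (gradient P.f₁ (pt w.fst w.snd) + P.penGrad ε⁻¹ (ε ^ 2)⁻¹ (pt w.fst w.snd) -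
        pt (P.penGrad ε⁻¹ (ε ^ 2)⁻¹ (pt w.fst z)).fst 0) =
        (bx + M.gbX A o w z) - (2 * A.L) • (w - o.x) := by
      rw [MinimaxProblem.gbX, hMdef, minimax_gx, pt_fst_snd]; abel
    rw [e]
    refine (norm_sub_le _ _).trans ?_
    have h4 : ‖(2 * A.L) • (w - o.x)‖ ≤ ε / 2 := by
      rw [norm_smul, Real.norm_of_nonneg (by linarith [hA.L])]
      calc 2 * A.L * ‖w - o.x‖ ≤ 2 * A.L * (A.eps / (4 * A.L)) := by
            have := hA.L; gcongr
        _ = ε / 2 := by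
            have := hA.L.ne'
            have h5 : A.eps = ε := rfl
            rw [h5]; field_simp; norm_num
    linarith
  · have e : bz + (P.penGrad ε⁻¹ (ε ^ 2)⁻¹ (pt w.fst z)).snd =
        (bz - M.gbY A w z) - (ε / (2 * P.Dy)) • (z - y₀) := by
      have h5 : M.gbY A w z = M.gy w z - (ε / (2 * P.Dy)) • (z - y₀) := rfl
      rw [h5, hMdef, minimax_gy]; abel
    rw [e]
    refine (norm_sub_le _ _).trans ?_
    have h4 : ‖(ε / (2 * P.Dy)) • (z - y₀)‖ ≤ ε / 2 := by
      rw [norm_smul, Real.norm_of_nonneg (by positivity)]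
      calc ε / (2 * P.Dy) * ‖z - y₀‖ ≤ ε / (2 * P.Dy) * P.Dy := by
            gcongr; exact norm_sub_le_Dy h₁ hz hy₀
        _ = ε / 2 := by field_simp
    linarith
  · have h3 := hval z' hz'
    rw [hMdef, minimax_Heps h₁ hw hz'] at h3
    have h4 := proximity_le h₁ hDy hε hz' hy₀
    have h5 := slack_le (x₀ := x₀) (y₀ := y₀) hL hDy hε
    rw [pt_fst_snd]
    linarith

end Problem

namespace Problem

variable {n m l : ℕ} {P : Problem n m l} {c : Moduli}

/-! ### From stationarity of the minimax problem to the optimality conditions -/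

theorem _root_.BilevelPenalty.IsSubgrad.coe_le {H : Type*} [NormedAddCommGroup H]
    [InnerProductSpace ℝ H] {φ : H → EReal} (hφ : ProperClosedConvex φ) {x b : H}
    (h : IsSubgrad (dom φ) (realPart φ) x b) (x' : H) :
    ((realPart φ x + inner ℝ b (x' - x) : ℝ) : EReal) ≤ φ x' := by
  by_cases hx : x' ∈ dom φ
  · rw [← hφ.coe_realPart hx]
    exact EReal.coe_le_coe_iff.2 (h.2 x' hx)
  · rw [eq_top_of_notMem_dom hx]; exact le_top

theorem _root_.BilevelPenalty.IsSubgrad.of_mul {H : Type*} [NormedAddCommGroup H]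
    [InnerProductSpace ℝ H] {S : Set H} {φ : H → ℝ} {ρ : ℝ} (hρ : 0 < ρ) {x b : H}
    (h : IsSubgrad S (fun z => ρ * φ z) x b) : IsSubgrad S φ x (ρ⁻¹ • b) := by
  refine ⟨h.1, fun x' hx' => ?_⟩
  have h3 := mul_le_mul_of_nonneg_left (h.2 x' hx') (inv_pos.2 hρ).le
  rw [mul_add, inv_mul_cancel_left₀ hρ.ne', inv_mul_cancel_left₀ hρ.ne'] at h3
  rwa [real_inner_smul_left]

theorem gradgtMul_smul (w : Pt n m) (a : ℝ) (v : Vec l) :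
    P.gradgtMul w (a • v) = a • P.gradgtMul w v := by
  simp only [gradgtMul, Finset.smul_sum, smul_smul, PiLp.smul_apply, smul_eq_mul]

theorem gradient_add_mem_subdiff_f (h₁ : P.Assumption1 c) {w : Pt n m} (hw : w ∈ P.XY) {b : Vec n}
    (hb : IsSubgrad P.X (realPart P.f₂) w.fst b) : gradient P.f₁ w + pt b 0 ∈ subdiff P.f w :=
  gradient_add_mem_subdiff (ψ := fun w : Pt n m => P.f₂ w.fst) (h₁.f₁_smooth.1 w hw)
    (h₁.f₂_convex.coe_realPart hw.1).symm fun w' => by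
      rw [inner_pt_zero]
      exact hb.coe_le h₁.f₂_convex w'.fst

theorem gradient_add_mem_subdiff_ft (h₁ : P.Assumption1 c) {w : Pt n m} (hw : w ∈ P.XY) {b : Vec m}
    (hb : IsSubgrad P.Y (realPart P.ft₂) w.snd b) : gradient P.ft₁ w + pt 0 b ∈ subdiff P.ft w :=
  gradient_add_mem_subdiff (ψ := fun w : Pt n m => P.ft₂ w.snd) (h₁.ft₁_smooth.1 w hw)
    (h₁.ft₂_convex.coe_realPart hw.2).symm fun w' => by
      rw [real_inner_comm, inner_zero_pt, real_inner_comm]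
      exact hb.coe_le h₁.ft₂_convex w'.snd

/-- The embedding `y ↦ (0; y)`. -/
def inrIso (n m : ℕ) : Vec m →ₗᵢ[ℝ] Pt n m where
  toFun y := pt 0 y
  map_add' y y' := by
    change pair _ _ = pair _ _ + pair _ _
    rw [pair_add, add_zero]
  map_smul' a y := by
    change pair _ _ = a • pair _ _
    rw [smul_pair, smul_zero]
  norm_map' y := norm_pt_zero_left y

theorem hasGradientAt_snd {φ : Pt n m → ℝ} {x : Vec n} {z : Vec m}
    (h : DifferentiableAt ℝ φ (pt x z)) :
    HasGradientAt (fun z' => φ (pt x z')) (gradient φ (pt x z)).snd z := by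
  rw [hasGradientAt_iff_hasFDerivAt]
  have h3 : HasFDerivAt (fun z' : Vec m => pt x z') (inrIso n m).toContinuousLinearMap z := by
    have e : (fun z' : Vec m => pt x z') = fun z' => pt x 0 + inrIso n m z' := by
      funext z'
      change pair _ _ = pair _ _ + pair _ _
      rw [pair_add, add_zero, zero_add]
    rw [e]
    exact (inrIso n m).toContinuousLinearMap.hasFDerivAt.const_add _
  refine ((hasGradientAt_iff_hasFDerivAt.1 h.hasGradientAt).comp z h3).congr_fderiv ?_
  ext v
  simp only [ContinuousLinearMap.comp_apply, InnerProductSpace.toDual_apply_apply]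
  exact inner_zero_pt _ v

theorem gradient_add_mem_subdiff_ft_right (h₁ : P.Assumption1 c) {x : Vec n} {z b : Vec m}
    (hx : x ∈ P.X) (hb : IsSubgrad P.Y (realPart P.ft₂) z b) :
    (gradient P.ft₁ (pt x z)).snd + b ∈ subdiff (fun z' => P.ft (pt x z')) z := by
  have h3 := hasGradientAt_snd (h₁.ft₁_smooth.1 _ (pt_mem_XY hx hb.1))
  rw [← h3.gradient]
  exact gradient_add_mem_subdiff (g := fun z' => P.ft₁ (pt x z')) (ψ := P.ft₂)
    h3.differentiableAt (h₁.ft₂_convex.coe_realPart hb.1).symm (hb.coe_le h₁.ft₂_convex)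

theorem infEDist_zero_le {E : Type*} [SeminormedAddCommGroup E] {S : Set E} {s : E} {e : ℝ}
    (hs : s ∈ S) (h : ‖s‖ ≤ e) : Metric.infEDist 0 S ≤ ENNReal.ofReal e := by
  refine (Metric.infEDist_le_edist_of_mem hs).trans ?_
  rw [edist_dist, dist_zero_left]
  exact ENNReal.ofReal_le_ofReal h

theorem infEDist_statSetXY_le (h₁ : P.Assumption1 c) {ε : ℝ} (hε : 0 < ε) {x : Vec n} {y z : Vec m}
    {bx : Pt n m} {e : ℝ}
    (hbx : IsSubgrad P.XY (fun w => realPart P.f₂ w.fst + ε⁻¹ * realPart P.ft₂ w.snd) (pt x y) bx)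
    (he : ‖bx + (gradient P.f₁ (pt x y) + P.penGrad ε⁻¹ (ε ^ 2)⁻¹ (pt x y) -
      pt (P.penGrad ε⁻¹ (ε ^ 2)⁻¹ (pt x z)).fst 0)‖ ≤ e) :
    Metric.infEDist 0 (P.statSetXY ε⁻¹ x y z ((2 * (ε ^ 2)⁻¹) • posPart (P.gt (pt x z)))
      ((2 * (ε ^ 3)⁻¹) • posPart (P.gt (pt x y)))) ≤ ENNReal.ofReal e := by
  have hb1 : IsSubgrad P.X (realPart P.f₂) x bx.fst :=
    IsSubgrad.fst (X := P.X) (Y := P.Y) (q := fun y => ε⁻¹ * realPart P.ft₂ y) hbx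
  have hb2 : IsSubgrad P.Y (realPart P.ft₂) y (ε⁻¹⁻¹ • bx.snd) :=
    IsSubgrad.of_mul (inv_pos.2 hε) (IsSubgrad.snd (X := P.X) (Y := P.Y) (p := realPart P.f₂)
      (q := fun y => ε⁻¹ * realPart P.ft₂ y) hbx)
  refine infEDist_zero_le (Set.add_mem_add (Set.add_mem_add
    (gradient_add_mem_subdiff_f h₁ hbx.1 hb1) (Set.smul_mem_smul_set
      (gradient_add_mem_subdiff_ft h₁ hbx.1 hb2))) rfl) ((le_of_eq ?_).trans he)
  congr 1
  have e1 : bx = pt bx.fst 0 + ε⁻¹ • pt 0 (ε⁻¹⁻¹ • bx.snd) := by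
    change pair _ _ = pair _ _ + ε⁻¹ • pair _ _
    rw [smul_pair, pair_add, smul_zero, add_zero, zero_add, smul_inv_smul₀ (inv_ne_zero hε.ne')]
    rfl
  have e2 : ε⁻¹ * (2 * (ε ^ 2)⁻¹) = 2 * ε⁻¹ * (ε ^ 2)⁻¹ := by ring
  have e3 : 2 * (ε ^ 3)⁻¹ = 2 * ε⁻¹ * (ε ^ 2)⁻¹ := by field_simp
  have e4 : ε⁻¹ • pt ((gradient P.ft₁ (pt x z)).fst +
      (P.gradgtMul (pt x z) ((2 * (ε ^ 2)⁻¹) • posPart (P.gt (pt x z)))).fst) (0 : Vec m) =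
      pt (P.penGrad ε⁻¹ (ε ^ 2)⁻¹ (pt x z)).fst 0 := by
    change ε⁻¹ • pair _ _ = pair (ε⁻¹ • (gradient P.ft₁ (pt x z)).fst +
      (2 * ε⁻¹ * (ε ^ 2)⁻¹) • (P.gradgtMul (pt x z) (posPart (P.gt (pt x z)))).fst) _
    rw [smul_pair, smul_zero, gradgtMul_smul, smul_add, ← e2]
    change pair (_ + ε⁻¹ • (2 * (ε ^ 2)⁻¹) •
      (P.gradgtMul (pt x z) (posPart (P.gt (pt x z)))).fst) _ = _
    rw [smul_smul]
  rw [e4, gradgtMul_smul, e3]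
  conv_rhs => rw [e1, penGrad]
  rw [smul_add]
  abel

theorem infEDist_statSetZ_le (h₁ : P.Assumption1 c) {ε : ℝ} (hε : 0 < ε) {x : Vec n} {z : Vec m}
    (hx : x ∈ P.X) {bz : Vec m} {e : ℝ}
    (hbz : IsSubgrad P.Y (fun z => ε⁻¹ * realPart P.ft₂ z) z bz)
    (he : ‖bz + (P.penGrad ε⁻¹ (ε ^ 2)⁻¹ (pt x z)).snd‖ ≤ e) :
    Metric.infEDist 0 (P.statSetZ ε⁻¹ x z ((2 * (ε ^ 2)⁻¹) • posPart (P.gt (pt x z)))) ≤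
      ENNReal.ofReal e := by
  refine infEDist_zero_le (Set.smul_mem_smul_set (Set.add_mem_add
    (gradient_add_mem_subdiff_ft_right h₁ hx (IsSubgrad.of_mul (inv_pos.2 hε) hbz)) rfl))
    ((le_of_eq ?_).trans he)
  congr 1
  have e2 : 2 * ε⁻¹ * (ε ^ 2)⁻¹ = ε⁻¹ * (2 * (ε ^ 2)⁻¹) := by ring
  change _ = bz + (ε⁻¹ • (gradient P.ft₁ (pt x z)).snd +
    (2 * ε⁻¹ * (ε ^ 2)⁻¹) • (P.gradgtMul (pt x z) (posPart (P.gt (pt x z)))).snd)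
  rw [gradgtMul_smul, e2, smul_add, smul_add, smul_inv_smul₀ (inv_ne_zero hε.ne')]
  change _ + ε⁻¹ • (2 * (ε ^ 2)⁻¹) • (P.gradgtMul (pt x z) (posPart (P.gt (pt x z)))).snd = _
  rw [smul_smul]
  abel

/-! ### Consequences of the Slater condition -/

theorem norm_le_sum_of_nonneg {v : Vec l} (hv : ∀ i, 0 ≤ v i) : ‖v‖ ≤ ∑ i, v i := by
  refine le_of_sq_le_sq ?_ (Finset.sum_nonneg fun i _ => hv i)
  rw [EuclideanSpace.norm_sq_eq]
  simp only [Real.norm_eq_abs, sq_abs]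
  exact Finset.sum_sq_le_sq_sum_of_nonneg fun i _ => hv i

/-- Multipliers at approximately stationary points are bounded through the Slater point: its distance
to the constraint boundary is `G`, and moving towards it increases the objective at most at the
rate `K`. -/
theorem posPart_gt_le (h₁ : P.Assumption1 c) (h₂ : P.Assumption2 c) {x : Vec n} {y : Vec m}
    (hx : x ∈ P.X) (hy : y ∈ P.Y) {a e K : ℝ} (ha : 0 < a) (he : 0 ≤ e) (hK : 0 ≤ K) {s : Vec m}
    (hs : ∀ y' ∈ P.Y, inner ℝ s (y' - y) ≤ K * ‖y' - y‖)
    (hr : ‖s + a • (P.gradgtMul (pt x y) (posPart (P.gt (pt x y)))).snd‖ ≤ e) :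
    ‖posPart (P.gt (pt x y))‖ ≤ a⁻¹ * c.G⁻¹ * P.Dy * (e + K) := by
  obtain ⟨zh, hzh, -, hG⟩ := exists_feasible h₂ hx
  set v := posPart (P.gt (pt x y)) with hv
  have hv0 : ∀ i, 0 ≤ v i := fun i => le_max_right _ _
  have hD := norm_sub_le_Dy h₁ hzh hy
  have h3 : inner ℝ v (P.gt (pt x y)) + inner ℝ (P.gradgtMul (pt x y) v).snd (zh - y) ≤
      -(c.G * ∑ i, v i) := by
    have e1 : inner ℝ (P.gradgtMul (pt x y) v).snd (zh - y) =
        ∑ i, v i * inner ℝ (P.gradgt (pt x y) i).snd (zh - y) := by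
      rw [← inner_zero_pt, gradgtMul, sum_inner]
      refine Finset.sum_congr rfl fun i _ => ?_
      rw [real_inner_smul_left, inner_zero_pt]
    rw [e1, PiLp.inner_apply, ← Finset.sum_add_distrib, Finset.mul_sum, ← Finset.sum_neg_distrib]
    refine Finset.sum_le_sum fun i _ => ?_
    have h4 := gt_add_inner_le h₂ hx hy zh i
    have h5 := hG i
    have h6 : v i * (P.gt (pt x y) i + inner ℝ (P.gradgt (pt x y) i).snd (zh - y)) ≤
        v i * -c.G := mul_le_mul_of_nonneg_left (by linarith) (hv0 i)
    simp only [RCLike.inner_apply, conj_trivial]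
    linarith
  have h4 : 0 ≤ inner ℝ v (P.gt (pt x y)) := by rw [hv, inner_posPart_self]; positivity
  have h5 := hs zh hzh
  have h6 := (abs_le.1 (abs_real_inner_le_norm (s + a • (P.gradgtMul (pt x y) v).snd) (zh - y))).1
  rw [inner_add_left, real_inner_smul_left] at h6
  have h7 : ‖s + a • (P.gradgtMul (pt x y) v).snd‖ * ‖zh - y‖ ≤ e * P.Dy := by gcongr
  have h8 : K * ‖zh - y‖ ≤ K * P.Dy := by gcongr
  have h9 : c.G * ‖v‖ ≤ c.G * ∑ i, v i :=
    mul_le_mul_of_nonneg_left (norm_le_sum_of_nonneg hv0) h₂.G_pos.le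
  have h10 : a * (c.G * ‖v‖) ≤ (e + K) * P.Dy := by
    have h11 : a * inner ℝ (P.gradgtMul (pt x y) v).snd (zh - y) ≤ a * -(c.G * ‖v‖) :=
      mul_le_mul_of_nonneg_left (by linarith) ha.le
    linarith
  have hG0 := h₂.G_pos
  have e2 : a⁻¹ * c.G⁻¹ * P.Dy * (e + K) = (e + K) * P.Dy / (a * c.G) := by field_simp
  rw [e2, le_div_iff₀ (by positivity)]
  linarith

theorem inner_smul_posPart_le {a B : ℝ} (ha : 0 ≤ a) {v : Vec l} (h : ‖posPart v‖ ≤ B) :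
    |inner ℝ (a • posPart v) v| ≤ a * B ^ 2 := by
  rw [real_inner_smul_left, inner_posPart_self, abs_of_nonneg (by positivity)]
  gcongr

theorem subgrad_ft_inner_le (h₁ : P.Assumption1 c) (h₂ : P.Assumption2 c) {x : Vec n} {z b : Vec m}
    (hx : x ∈ P.X) (hb : IsSubgrad P.Y (realPart P.ft₂) z b) {z' : Vec m} (hz' : z' ∈ P.Y) :
    inner ℝ ((gradient P.ft₁ (pt x z)).snd + b) (z' - z) ≤ c.Lft * ‖z' - z‖ := by
  have h3 := ft₁_add_inner_le h₁ hx hb.1 z'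
  have h4 := hb.2 z' hz'
  have h5 := (le_abs_self _).trans (h₂.ft_lip _ (pt_mem_XY hx hz') _ (pt_mem_XY hx hb.1))
  rw [ftR_eq h₁ (w := pt x z') hz', ftR_eq h₁ (w := pt x z) hb.1, pt_sub, sub_self,
    norm_pt_zero_left, pt_snd, pt_snd] at h5
  rw [inner_add_left]
  linarith

theorem gradient_f₁_inner_le (h₁ : P.Assumption1 c) (h₂ : P.Assumption2 c) {x : Vec n} {y y' : Vec m}
    (hx : x ∈ P.X) (hy : y ∈ P.Y) (hy' : y' ∈ P.Y) :
    inner ℝ (gradient P.f₁ (pt x y)).snd (y' - y) ≤ c.Lf * ‖y' - y‖ := by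
  have h1 := hasDerivAt_line (φ := P.f₁) (w := pt x y) (d := pt 0 (y' - y)) (t := 0)
    (by rw [zero_smul, add_zero]; exact h₁.f₁_smooth.1 _ (pt_mem_XY hx hy))
  rw [zero_smul, add_zero, inner_zero_pt] at h1
  refine deriv_le_of_le_linear h1 fun t h0 h1 => ?_
  have h3 : y + t • (y' - y) ∈ P.Y :=
    (ConvexOn.le_segment h₁.ft₂_convex.convexOn hy hy' h0.le h1).1
  have h4 := (le_abs_self _).trans (h₂.f_lip _ (pt_mem_XY hx h3) _ (pt_mem_XY hx hy))
  rw [fR_eq h₁ (w := pt x _) hx, fR_eq h₁ (w := pt x y) hx, pt_sub, sub_self,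
    norm_pt_zero_left, add_sub_cancel_left, norm_smul, Real.norm_of_nonneg h0.le, pt_fst,
    pt_fst] at h4
  rw [zero_smul, add_zero, ← pt_add_smul_right]
  linarith

/-- Moving an infeasible point towards the Slater point until it is feasible shows that its lower
level value is not far below the optimal one. -/
theorem ftStar_le_add (h₁ : P.Assumption1 c) (h₂ : P.Assumption2 c) (hDy : 0 < P.Dy) {x : Vec n}
    {y : Vec m} (hx : x ∈ P.X) (hy : y ∈ P.Y) :
    P.ftStar x ≤ P.ftR (pt x y) + c.Lft * (P.Dy * (‖posPart (P.gt (pt x y))‖ * c.G⁻¹)) := by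
  obtain ⟨zh, hzh, -, hG⟩ := exists_feasible h₂ hx
  have hG0 := h₂.G_pos
  set v := ‖posPart (P.gt (pt x y))‖ with hv
  have hv0 : 0 ≤ v := norm_nonneg _
  set t := v / (c.G + v) with ht
  have ht0 : 0 ≤ t := by positivity
  have ht1 : t ≤ 1 := (div_le_one (by positivity)).2 (by linarith)
  have htG : t ≤ v * c.G⁻¹ := by
    rw [ht, div_eq_mul_inv]
    gcongr
    linarith
  have hmem : y + t • (zh - y) ∈ P.Y :=
    (ConvexOn.le_segment h₁.ft₂_convex.convexOn hy hzh ht0 ht1).1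
  have hfeas : P.Feasible x (y + t • (zh - y)) := fun i => by
    refine (ConvexOn.le_segment (h₂.gt_convex x hx i) (Set.mem_univ y) (Set.mem_univ zh)
      ht0 ht1).2.trans ?_
    have h3 : P.gt (pt x y) i ≤ v :=
      (le_max_left _ 0).trans ((le_abs_self _).trans (PiLp.norm_apply_le (posPart (P.gt (pt x y))) i))
    have h4 := hG i
    have h5 : (1 - t) * P.gt (pt x y) i ≤ (1 - t) * v :=
      mul_le_mul_of_nonneg_left h3 (by linarith)
    have h6 : t * P.gt (pt x zh) i ≤ t * -c.G := mul_le_mul_of_nonneg_left (by linarith) ht0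
    have h7 : (1 - t) * v + t * -c.G = 0 := by rw [ht]; field_simp; ring
    linarith
  refine (ftStar_le h₁ h₂ hx hmem hfeas).trans ?_
  have h4 := (le_abs_self _).trans (h₂.ft_lip _ (pt_mem_XY hx hmem) _ (pt_mem_XY hx hy))
  rw [pt_sub, sub_self, norm_pt_zero_left, add_sub_cancel_left, norm_smul,
    Real.norm_of_nonneg ht0] at h4
  have h5 : t * ‖zh - y‖ ≤ v * c.G⁻¹ * P.Dy := by
    gcongr
    exact norm_sub_le_Dy h₁ hzh hy
  have h6 := mul_le_mul_of_nonneg_left h5 (Lft_nonneg h₁ h₂ hDy)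
  linarith

/-- The feasibility and complementarity bounds at the output of the penalty method, and the gap of
its lower level value. -/
theorem feasibility_bounds (h₁ : P.Assumption1 c) (h₂ : P.Assumption2 c) (hDy : 0 < P.Dy)
    {ε : ℝ} (hε : 0 < ε) {x₀ : Vec n} {y₀ : Vec m} {x : Vec n} {y z : Vec m}
    {bx : Pt n m} {bz : Vec m}
    (hbx : IsSubgrad P.XY (fun w => realPart P.f₂ w.fst + ε⁻¹ * realPart P.ft₂ w.snd) (pt x y) bx)
    (hbz : IsSubgrad P.Y (fun z => ε⁻¹ * realPart P.ft₂ z) z bz)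
    (hex : ‖bx + (gradient P.f₁ (pt x y) + P.penGrad ε⁻¹ (ε ^ 2)⁻¹ (pt x y) -
      pt (P.penGrad ε⁻¹ (ε ^ 2)⁻¹ (pt x z)).fst 0)‖ ≤ ε)
    (hez : ‖bz + (P.penGrad ε⁻¹ (ε ^ 2)⁻¹ (pt x z)).snd‖ ≤ ε)
    (hval : ∀ z' ∈ P.Y, P.fR (pt x y) +
      ε⁻¹ * (P.penalty (ε ^ 2)⁻¹ (pt x y) - P.penalty (ε ^ 2)⁻¹ (pt x z')) ≤
        1 + P.fR (pt x₀ y₀) + P.Dy * ε / 4 +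
          2 * ε ^ 5 * ((P.Ltilde c ε)⁻¹ + 4 * P.Dy ^ 2 * P.Ltilde c ε * (ε ^ 2)⁻¹)) :
    ‖posPart (P.gt (pt x z))‖ ≤ ε ^ 2 * c.G⁻¹ * P.Dy * (ε ^ 2 + c.Lft) / 2 ∧
    |P.ftR (pt x y) - P.ftStar x| ≤ P.valueGap c ε x₀ y₀ ∧
    ‖posPart (P.gt (pt x y))‖ ≤ ε ^ 2 * c.G⁻¹ * P.Dy * (ε ^ 2 + ε * c.Lf + c.Lft) / 2 := by
  have hx : x ∈ P.X := hbx.1.1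
  have hy : y ∈ P.Y := hbx.1.2
  have hz : z ∈ P.Y := hbz.1
  have hLf := Lf_nonneg h₁ h₂ hDy
  have hLft := Lft_nonneg h₁ h₂ hDy
  have hG0 := h₂.G_pos
  have hbz' := IsSubgrad.of_mul (inv_pos.2 hε) hbz
  have hby : IsSubgrad P.Y (realPart P.ft₂) y (ε⁻¹⁻¹ • bx.snd) :=
    IsSubgrad.of_mul (inv_pos.2 hε) (IsSubgrad.snd (X := P.X) (Y := P.Y) (p := realPart P.f₂)
      (q := fun y => ε⁻¹ * realPart P.ft₂ y) hbx)
  have r1 : ‖posPart (P.gt (pt x z))‖ ≤ ε ^ 2 * c.G⁻¹ * P.Dy * (ε ^ 2 + c.Lft) / 2 := by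
    have h3 := posPart_gt_le (a := 2 * (ε ^ 2)⁻¹) (e := ε ^ 2) (K := c.Lft) h₁ h₂ hx hz
      (by positivity) (by positivity) hLft (fun z' hz' => subgrad_ft_inner_le h₁ h₂ hx hbz' hz') ?_
    · refine h3.trans (le_of_eq ?_)
      rw [mul_inv, inv_inv]; ring
    · have e : (gradient P.ft₁ (pt x z)).snd + ε⁻¹⁻¹ • bz +
          (2 * (ε ^ 2)⁻¹) • (P.gradgtMul (pt x z) (posPart (P.gt (pt x z)))).snd =
          ε • (bz + (P.penGrad ε⁻¹ (ε ^ 2)⁻¹ (pt x z)).snd) := by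
        change _ = ε • (bz + (ε⁻¹ • (gradient P.ft₁ (pt x z)).snd +
          (2 * ε⁻¹ * (ε ^ 2)⁻¹) • (P.gradgtMul (pt x z) (posPart (P.gt (pt x z)))).snd))
        rw [inv_inv, smul_add, smul_add, smul_inv_smul₀ hε.ne', smul_smul,
          show ε * (2 * ε⁻¹ * (ε ^ 2)⁻¹) = 2 * (ε ^ 2)⁻¹ by field_simp]
        abel
      rw [e, norm_smul, Real.norm_of_nonneg hε.le]
      exact (mul_le_mul_of_nonneg_left hez hε.le).trans (sq ε).ge
  have r3 : ‖posPart (P.gt (pt x y))‖ ≤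
      ε ^ 2 * c.G⁻¹ * P.Dy * (ε ^ 2 + ε * c.Lf + c.Lft) / 2 := by
    have h3 := posPart_gt_le (a := 2 * ε⁻¹ * (ε ^ 2)⁻¹) (e := ε) (K := c.Lf + ε⁻¹ * c.Lft)
      (s := (gradient P.f₁ (pt x y)).snd +
        ε⁻¹ • ((gradient P.ft₁ (pt x y)).snd + ε⁻¹⁻¹ • bx.snd)) h₁ h₂ hx hy
      (by positivity) hε.le (by positivity) (fun y' hy' => ?_) ?_
    · refine h3.trans (le_of_eq ?_)
      field_simp
      ring
    · have h4 := gradient_f₁_inner_le h₁ h₂ hx hy hy'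
      have h5 := mul_le_mul_of_nonneg_left (subgrad_ft_inner_le h₁ h₂ hx hby hy')
        (inv_pos.2 hε).le
      rw [inner_add_left, real_inner_smul_left]
      linarith
    · have e : (gradient P.f₁ (pt x y)).snd +
          ε⁻¹ • ((gradient P.ft₁ (pt x y)).snd + ε⁻¹⁻¹ • bx.snd) +
          (2 * ε⁻¹ * (ε ^ 2)⁻¹) • (P.gradgtMul (pt x y) (posPart (P.gt (pt x y)))).snd =
          (bx + (gradient P.f₁ (pt x y) + P.penGrad ε⁻¹ (ε ^ 2)⁻¹ (pt x y) -
            pt (P.penGrad ε⁻¹ (ε ^ 2)⁻¹ (pt x z)).fst 0)).snd := by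
        change _ = bx.snd + ((gradient P.f₁ (pt x y)).snd + (ε⁻¹ • (gradient P.ft₁ (pt x y)).snd +
          (2 * ε⁻¹ * (ε ^ 2)⁻¹) • (P.gradgtMul (pt x y) (posPart (P.gt (pt x y)))).snd) - 0)
        rw [smul_add, smul_inv_smul₀ (inv_ne_zero hε.ne')]
        abel
      rw [e]
      refine le_trans (le_of_sq_le_sq ?_ (norm_nonneg _)) hex
      set u := bx + (gradient P.f₁ (pt x y) + P.penGrad ε⁻¹ (ε ^ 2)⁻¹ (pt x y) -
        pt (P.penGrad ε⁻¹ (ε ^ 2)⁻¹ (pt x z)).fst 0)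
      have h6 := norm_pt_sq u.fst u.snd
      rw [pt_fst_snd] at h6
      rw [h6]
      exact le_add_of_nonneg_left (sq_nonneg _)
  refine ⟨r1, ?_, r3⟩
  rw [abs_le', valueGap]
  constructor
  · refine le_trans ?_ (le_max_left _ _)
    obtain ⟨y', hy'⟩ := exists_lowerSol h₁ h₂ hx
    have h3 := hval y' (lowerSol_subset h₁ h₂ hx hy')
    rw [penalty_eq_of_feasible _ hy'.1, ← ftStar_eq hy'] at h3
    have h4 := fLow_le h₁ hbx.1
    have h5 : ε⁻¹ * (P.ftR (pt x y) - P.ftStar x) ≤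
        ε⁻¹ * (P.penalty (ε ^ 2)⁻¹ (pt x y) - P.ftStar x) := by
      gcongr
      exact ftR_le_penalty (by positivity) _
    have h6 := mul_le_mul_of_nonneg_left (h5.trans (le_sub_iff_add_le'.2 h3)) hε.le
    rw [mul_inv_cancel_left₀ hε.ne'] at h6
    refine h6.trans (mul_le_mul_of_nonneg_left ?_ hε.le)
    linarith
  · refine le_trans ?_ (le_max_right _ _)
    have h3 := ftStar_le_add h₁ h₂ hDy hx hy
    have h4 : c.Lft * (P.Dy * (‖posPart (P.gt (pt x y))‖ * c.G⁻¹)) ≤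
        c.Lft * (P.Dy * (ε ^ 2 * c.G⁻¹ * P.Dy * (ε ^ 2 + ε * c.Lf + c.Lft) / 2 * c.G⁻¹)) := by
      gcongr
    have e : c.Lft * (P.Dy * (ε ^ 2 * c.G⁻¹ * P.Dy * (ε ^ 2 + ε * c.Lf + c.Lft) / 2 * c.G⁻¹)) =
        ε ^ 2 * (c.G ^ 2)⁻¹ * P.Dy ^ 2 * c.Lft * (ε ^ 2 + ε * c.Lf + c.Lft) / 2 := by
      field_simp
    linarith

end Problem

namespace Problem

variable {n m l : ℕ} {P : Problem n m l} {c : Moduli}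

/-! ### Orders of the bounds -/

/-- The accuracies and initial points over which the orders of the bounds are uniform. -/
def admissible (P : Problem n m l) : Set (ℝ × Vec n × Vec m) :=
  {i | 0 < i.1 ∧ i.1 ≤ 1 / 4 ∧ i.2.1 ∈ P.X ∧ i.2.2 ∈ P.Y}

/-- `F = O(ε⁻ᵏ)`, uniformly over the admissible accuracies and initial points. -/
def OrderLE (P : Problem n m l) (k : ℕ) (F : ℝ × Vec n × Vec m → ℝ) : Prop :=
  ∃ C, 0 ≤ C ∧ ∀ i ∈ P.admissible, |F i| ≤ C * i.1⁻¹ ^ k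

theorem one_le_inv_of_admissible {i : ℝ × Vec n × Vec m} (hi : i ∈ P.admissible) : 1 ≤ i.1⁻¹ :=
  (one_le_inv₀ hi.1).2 (by linarith [hi.2.1])

theorem one_le_log_inv_of_admissible {i : ℝ × Vec n × Vec m} (hi : i ∈ P.admissible) :
    1 ≤ Real.log i.1⁻¹ := by
  rw [Real.le_log_iff_exp_le (inv_pos.2 hi.1)]
  have h1 : (4 : ℝ) ≤ i.1⁻¹ := by
    rw [le_inv_comm₀ (by norm_num) hi.1]; linarith [hi.2.1]
  linarith [Real.exp_one_lt_d9]

namespace OrderLE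

variable {k k' : ℕ} {F F' : ℝ × Vec n × Vec m → ℝ}

theorem of_le (h : P.OrderLE k F) (hF : ∀ i ∈ P.admissible, |F' i| ≤ |F i|) : P.OrderLE k F' := by
  obtain ⟨C, h0, h1⟩ := h
  exact ⟨C, h0, fun i hi => (hF i hi).trans (h1 i hi)⟩

theorem mono (h : P.OrderLE k F) (hk : k ≤ k') : P.OrderLE k' F := by
  obtain ⟨C, h0, h1⟩ := h
  refine ⟨C, h0, fun i hi => (h1 i hi).trans ?_⟩
  have := one_le_inv_of_admissible hi
  gcongr

theorem const (a : ℝ) : P.OrderLE 0 fun _ => a :=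
  ⟨|a|, abs_nonneg a, fun i _ => by simp⟩

theorem inv_pow (k : ℕ) : P.OrderLE k fun i => (i.1 ^ k)⁻¹ :=
  ⟨1, zero_le_one, fun i hi => by
    rw [one_mul, _root_.inv_pow, abs_of_nonneg (inv_nonneg.2 (pow_nonneg hi.1.le k))]⟩

theorem inv : P.OrderLE 1 fun i => i.1⁻¹ := by simpa using inv_pow (P := P) 1

theorem pow_zero (k : ℕ) : P.OrderLE 0 fun i => i.1 ^ k :=
  (const 1).of_le fun i hi => by
    rw [abs_of_nonneg (pow_nonneg hi.1.le k), abs_one]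
    exact pow_le_one₀ hi.1.le (by linarith [hi.2.1])

theorem eps : P.OrderLE 0 fun i => i.1 := by simpa using pow_zero (P := P) 1

theorem eps_mul (h : P.OrderLE (k + 1) F) : P.OrderLE k fun i => i.1 * F i := by
  obtain ⟨C, h0, h1⟩ := h
  refine ⟨C, h0, fun i hi => ?_⟩
  have hε := hi.1
  rw [abs_mul, abs_of_pos hε]
  calc i.1 * |F i| ≤ i.1 * (C * i.1⁻¹ ^ (k + 1)) := by gcongr; exact h1 i hi
    _ = C * i.1⁻¹ ^ k := by rw [pow_succ]; field_simp

theorem add_le (h : P.OrderLE k F) (h' : P.OrderLE k' F') {G : ℝ × Vec n × Vec m → ℝ} {r : ℕ}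
    (hk : k ≤ r) (hk' : k' ≤ r) (hG : ∀ i ∈ P.admissible, |G i| ≤ |F i| + |F' i|) :
    P.OrderLE r G := by
  obtain ⟨C, h0, h1⟩ := h.mono hk
  obtain ⟨C', h0', h1'⟩ := h'.mono hk'
  refine ⟨C + C', add_nonneg h0 h0', fun i hi => (hG i hi).trans ?_⟩
  rw [add_mul]
  exact add_le_add (h1 i hi) (h1' i hi)

theorem add (h : P.OrderLE k F) (h' : P.OrderLE k' F') :
    P.OrderLE (max k k') fun i => F i + F' i :=
  h.add_le h' (le_max_left _ _) (le_max_right _ _) fun _ _ => abs_add_le _ _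

theorem sub (h : P.OrderLE k F) (h' : P.OrderLE k' F') :
    P.OrderLE (max k k') fun i => F i - F' i :=
  h.add_le h' (le_max_left _ _) (le_max_right _ _) fun _ _ => abs_sub _ _

theorem max (h : P.OrderLE k F) (h' : P.OrderLE k' F') :
    P.OrderLE (max k k') fun i => max (F i) (F' i) :=
  h.add_le h' (le_max_left _ _) (le_max_right _ _) fun _ _ =>
    abs_max_le_max_abs_abs.trans
      (max_le (le_add_of_nonneg_right (abs_nonneg _)) (le_add_of_nonneg_left (abs_nonneg _)))

theorem mul (h : P.OrderLE k F) (h' : P.OrderLE k' F') :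
    P.OrderLE (k + k') fun i => F i * F' i := by
  obtain ⟨C, h0, h1⟩ := h
  obtain ⟨C', h0', h1'⟩ := h'
  refine ⟨C * C', mul_nonneg h0 h0', fun i hi => ?_⟩
  rw [abs_mul, pow_add, mul_mul_mul_comm]
  exact mul_le_mul (h1 i hi) (h1' i hi) (abs_nonneg _)
    (mul_nonneg h0 (pow_nonneg (inv_pos.2 hi.1).le k))

theorem pow (h : P.OrderLE k F) (r : ℕ) : P.OrderLE (k * r) fun i => F i ^ r := by
  obtain ⟨C, h0, h1⟩ := h
  refine ⟨C ^ r, pow_nonneg h0 r, fun i hi => ?_⟩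
  rw [abs_pow, pow_mul, ← mul_pow]
  exact pow_le_pow_left₀ (abs_nonneg _) (h1 i hi) r

theorem sqrt (h : P.OrderLE (2 * k) F) : P.OrderLE k fun i => Real.sqrt (F i) := by
  obtain ⟨C, h0, h1⟩ := h
  refine ⟨Real.sqrt C, Real.sqrt_nonneg C, fun i hi => ?_⟩
  have hu : 0 ≤ i.1⁻¹ ^ k := pow_nonneg (inv_pos.2 hi.1).le k
  rw [abs_of_nonneg (Real.sqrt_nonneg _), ← Real.sqrt_sq hu, ← Real.sqrt_mul h0, ← pow_mul,
    mul_comm k 2]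
  exact Real.sqrt_le_sqrt ((le_abs_self _).trans (h1 i hi))

theorem natCeil (h : P.OrderLE k F) : P.OrderLE k fun i => (⌈F i⌉₊ : ℝ) :=
  h.add_le (const 1) le_rfl (Nat.zero_le k) fun i _ => by
    rw [abs_of_nonneg (Nat.cast_nonneg _), abs_one]
    have h1 := Nat.ceil_lt_add_one (abs_nonneg (F i))
    have h2 : (⌈F i⌉₊ : ℝ) ≤ ⌈|F i|⌉₊ := Nat.cast_le.2 (Nat.ceil_mono (le_abs_self _))
    linarith

/-- A quantity of polynomial order has a logarithm of order `log ε⁻¹`. -/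
theorem max_log (h : P.OrderLE k F) :
    P.OrderLE 0 fun i => Max.max (Real.log (F i)) 0 / Real.log i.1⁻¹ := by
  obtain ⟨C, h0, h1⟩ := h
  have hC : 0 ≤ Real.log (C + 1) := Real.log_nonneg (by linarith)
  have hCk : 0 ≤ Real.log (C + 1) + k := add_nonneg hC (Nat.cast_nonneg k)
  refine ⟨Real.log (C + 1) + k, hCk, fun i hi => ?_⟩
  have hu := one_le_log_inv_of_admissible hi
  have hu0 : 0 < Real.log i.1⁻¹ := zero_lt_one.trans_le hu
  rw [_root_.pow_zero, mul_one, abs_of_nonneg (div_nonneg (le_max_right _ _) hu0.le),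
    div_le_iff₀ hu0]
  refine max_le ?_ (mul_nonneg hCk hu0.le)
  rcases eq_or_ne (F i) 0 with hF | hF
  · rw [hF, Real.log_zero]
    exact mul_nonneg hCk hu0.le
  have hp : 0 < i.1⁻¹ ^ k := pow_pos (inv_pos.2 hi.1) k
  calc Real.log (F i) = Real.log |F i| := (Real.log_abs _).symm
    _ ≤ Real.log ((C + 1) * i.1⁻¹ ^ k) := by
        refine Real.log_le_log (abs_pos.2 hF) ((h1 i hi).trans ?_)
        gcongr
        linarith
    _ = Real.log (C + 1) + k * Real.log i.1⁻¹ := by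
        rw [Real.log_mul (by positivity) hp.ne', Real.log_pow]
    _ ≤ (Real.log (C + 1) + k) * Real.log i.1⁻¹ := by
        rw [add_mul]
        gcongr
        exact le_mul_of_one_le_right hC hu

end OrderLE

theorem Ltilde_pos (h₁ : P.Assumption1 c) (h₂ : P.Assumption2 c) (hDy : 0 < P.Dy)
    (hL : 0 < c.Lgradf₁ + c.Lgradft₁ + (P.gtHi * c.Lgradgt + c.Lgt ^ 2))
    {ε : ℝ} (hε : 0 < ε) (hε1 : ε ≤ 1 / 4) : 0 < P.Ltilde c ε :=
  hL.trans_le (le_Ltilde h₁ h₂ hDy hε hε1)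

theorem order_Ltilde : P.OrderLE 3 fun i => P.Ltilde c i.1 :=
  (((OrderLE.const c.Lgradf₁).add (((OrderLE.const 2).mul OrderLE.inv).mul (.const c.Lgradft₁))).add
    (((OrderLE.const 4).mul (.inv_pow 3)).mul (.const (P.gtHi * c.Lgradgt + c.Lgt ^ 2)))).mono
    (by norm_num)

theorem order_Ltilde_inv (h₁ : P.Assumption1 c) (h₂ : P.Assumption2 c) (hDy : 0 < P.Dy)
    (hL : 0 < c.Lgradf₁ + c.Lgradft₁ + (P.gtHi * c.Lgradgt + c.Lgt ^ 2))
    : P.OrderLE 0 fun i => (P.Ltilde c i.1)⁻¹ :=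
  (OrderLE.const (c.Lgradf₁ + c.Lgradft₁ + (P.gtHi * c.Lgradgt + c.Lgt ^ 2))⁻¹).of_le fun i hi => by
    rw [abs_of_pos (inv_pos.2 hL), abs_of_pos (inv_pos.2 (Ltilde_pos h₁ h₂ hDy hL hi.1 hi.2.1))]
    exact inv_anti₀ hL (le_Ltilde h₁ h₂ hDy hi.1 hi.2.1)

theorem order_fR (h₁ : P.Assumption1 c) : P.OrderLE 0 fun i => P.fR (pt i.2.1 i.2.2) := by
  obtain ⟨C, hC⟩ := (XY_compact h₁).exists_bound_of_continuousOn (continuousOn_fR h₁)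
  refine (OrderLE.const C).of_le fun i hi => ?_
  exact (hC _ (pt_mem_XY hi.2.2.1 hi.2.2.2)).trans (le_abs_self C)

theorem order_max_sqrt :
    P.OrderLE 2 fun i => max 2 (Real.sqrt (P.Dy * P.Ltilde c i.1 * i.1⁻¹)) :=
  ((OrderLE.const 2).max (OrderLE.sqrt (k := 2)
    (((OrderLE.const P.Dy).mul (order_Ltilde (c := c))).mul .inv))).mono (by norm_num)

theorem order_αtilde_inv (h₁ : P.Assumption1 c) (h₂ : P.Assumption2 c) (hDy : 0 < P.Dy)
    (hL : 0 < c.Lgradf₁ + c.Lgradft₁ + (P.gtHi * c.Lgradgt + c.Lgt ^ 2))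
    : P.OrderLE 2 fun i => (P.αtilde c i.1)⁻¹ :=
  ((OrderLE.const (1 / 2)).mul (order_max_sqrt (c := c))).mono (by norm_num) |>.of_le
    fun i hi => le_of_eq (by
      rw [← two_div_αtilde (Ltilde_pos h₁ h₂ hDy hL hi.1 hi.2.1) hDy hi.1]
      congr 1
      ring)

theorem order_αtilde (h₁ : P.Assumption1 c) (h₂ : P.Assumption2 c) (hDy : 0 < P.Dy)
    (hL : 0 < c.Lgradf₁ + c.Lgradft₁ + (P.gtHi * c.Lgradgt + c.Lgt ^ 2))
    : P.OrderLE 0 fun i => P.αtilde c i.1 :=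
  (OrderLE.const 1).of_le fun i hi => by
    rw [abs_of_pos (αtilde_pos (Ltilde_pos h₁ h₂ hDy hL hi.1 hi.2.1) hDy hi.1), abs_one]
    exact min_le_left _ _

theorem order_δtilde (h₁ : P.Assumption1 c) (h₂ : P.Assumption2 c) (hDy : 0 < P.Dy)
    (hL : 0 < c.Lgradf₁ + c.Lgradft₁ + (P.gtHi * c.Lgradgt + c.Lgt ^ 2))
    : P.OrderLE 5 fun i => P.δtilde c i.1 := by
  have hα := order_αtilde_inv h₁ h₂ hDy hL
  have hα' := order_αtilde h₁ h₂ hDy hL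
  have hLt := order_Ltilde (P := P) (c := c)
  exact (((((OrderLE.const 2).add hα).mul (.const (P.Dx ^ 2 + P.Dy ^ 2))).mul hLt).add
    (((OrderLE.eps.mul (.const P.Dy⁻¹)).max ((hα'.mul hLt).mul (.const 4⁻¹))).mul
      (.const (P.Dy ^ 2)))).mono (by norm_num)

theorem order_Ctilde (h₁ : P.Assumption1 c) (h₂ : P.Assumption2 c) (hDy : 0 < P.Dy)
    (hL : 0 < c.Lgradf₁ + c.Lgradft₁ + (P.gtHi * c.Lgradgt + c.Lgt ^ 2))
    : P.OrderLE 25 fun i => P.Ctilde c i.1 := by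
  have hα := order_αtilde_inv h₁ h₂ hDy hL
  have hLt := order_Ltilde (P := P) (c := c)
  have hLi := order_Ltilde_inv h₁ h₂ hDy hL
  have hδ := order_δtilde h₁ h₂ hDy hL
  have hσ : P.OrderLE 0 fun i => i.1 / (2 * P.Dy) := OrderLE.eps.mul (.const (2 * P.Dy)⁻¹)
  -- the step length, at most `1 / (2 L̃) + D_y ε⁻¹`
  have hη : P.OrderLE 1 fun i => max (1 / (2 * P.Ltilde c i.1))
      (min (P.Dy * i.1⁻¹) (4 / (P.αtilde c i.1 * P.Ltilde c i.1))) := by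
    refine ((OrderLE.const (1 / 2)).mul hLi).add_le ((OrderLE.const P.Dy).mul OrderLE.inv)
      (by norm_num) (by norm_num) fun i hi => ?_
    have hLp := Ltilde_pos h₁ h₂ hDy hL hi.1 hi.2.1
    have hp : 0 < P.Dy * i.1⁻¹ := mul_pos hDy (inv_pos.2 hi.1)
    have e : 1 / (2 * P.Ltilde c i.1) = 1 / 2 * (P.Ltilde c i.1)⁻¹ := by field_simp
    rw [e, abs_of_nonneg ((by positivity : 0 ≤ 1 / 2 * (P.Ltilde c i.1)⁻¹).trans (le_max_left _ _)),
      abs_of_pos (by positivity : 0 < 1 / 2 * (P.Ltilde c i.1)⁻¹), abs_of_pos hp]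
    exact max_le (le_add_of_nonneg_right hp.le)
      ((min_le_left _ _).trans (le_add_of_nonneg_left (by positivity)))
  have hm : P.OrderLE 1 fun i => (min (P.Ltilde c i.1) (i.1 / (2 * P.Dy)))⁻¹ := by
    refine hLi.add_le ((OrderLE.const (2 * P.Dy)).mul OrderLE.inv) (by norm_num) (by norm_num)
      fun i hi => ?_
    have hLp := Ltilde_pos h₁ h₂ hDy hL hi.1 hi.2.1
    have hε := hi.1
    have hp : 0 < i.1 / (2 * P.Dy) := by positivity
    have e : 2 * P.Dy * i.1⁻¹ = (i.1 / (2 * P.Dy))⁻¹ := by rw [inv_div, div_eq_mul_inv]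
    rw [e, abs_of_pos (inv_pos.2 (lt_min hLp hp)), abs_of_pos (inv_pos.2 hLp),
      abs_of_pos (inv_pos.2 hp)]
    rcases min_choice (P.Ltilde c i.1) (i.1 / (2 * P.Dy)) with h | h <;> rw [h]
    · exact le_add_of_nonneg_right (inv_pos.2 hp).le
    · exact le_add_of_nonneg_left (inv_pos.2 hLp).le
  have hQ : P.OrderLE 7 fun i => (3 * P.Ltilde c i.1 + i.1 / (2 * P.Dy)) ^ 2 /
      min (P.Ltilde c i.1) (i.1 / (2 * P.Dy)) + 3 * P.Ltilde c i.1 + i.1 / (2 * P.Dy) :=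
    ((((((OrderLE.const 3).mul hLt).add hσ).pow 2).mul hm).add ((OrderLE.const 3).mul hLt)).add hσ
      |>.mono (by norm_num)
  have hB : P.OrderLE 3 fun i => P.fStar - P.fLow + 2 * i.1⁻¹ * (P.ftHi - P.ftLow) +
      (i.1 ^ 3)⁻¹ * P.gtHi ^ 2 + i.1 * P.Dy / 4 + P.Ltilde c i.1 * (P.Dx ^ 2 + P.Dy ^ 2) :=
    (((((OrderLE.const (P.fStar - P.fLow)).add (((OrderLE.const 2).mul .inv).mul
      (.const (P.ftHi - P.ftLow)))).add ((OrderLE.inv_pow 3).mul (.const (P.gtHi ^ 2)))).add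
      ((OrderLE.eps.mul (.const P.Dy)).mul (.const 4⁻¹))).add
      (hLt.mul (.const (P.Dx ^ 2 + P.Dy ^ 2)))).mono (by norm_num)
  refine (((((OrderLE.const 4).mul hη).mul ((hQ.pow 2).mul (OrderLE.inv_pow 5))).mul
    (hδ.add (((OrderLE.const 2).mul hα).mul hB))).mono (by norm_num)).of_le fun i hi => le_of_eq ?_
  rw [Ctilde, div_eq_mul_inv (4 * _), mul_inv, inv_inv]

theorem order_Ktilde (h₁ : P.Assumption1 c) :
    P.OrderLE 5 fun i => (P.Ktilde c i.1 i.2.1 i.2.2 : ℝ) := by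
  have hLt := order_Ltilde (P := P) (c := c)
  have hB : P.OrderLE 0 fun i => 1 + P.fR (pt i.2.1 i.2.2) - P.fLow + i.1 * P.Dy / 4 :=
    (((OrderLE.const 1).add (order_fR h₁)).sub (.const P.fLow)).add
      ((OrderLE.eps.mul (.const P.Dy)).mul (.const 4⁻¹))
  have h3 : P.OrderLE 5 fun i => 32 * i.1 ^ 3 *
      (1 + 4 * P.Dy ^ 2 * P.Ltilde c i.1 ^ 2 * (i.1 ^ 2)⁻¹) :=
    (((OrderLE.const 32).mul (OrderLE.pow_zero 3)).add
      ((OrderLE.const (128 * P.Dy ^ 2)).mul (OrderLE.eps_mul (k := 5) (hLt.pow 2)))).mono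
      (by norm_num) |>.of_le fun i hi => le_of_eq (by
        have := hi.1.ne'
        congr 1
        field_simp
        ring)
  exact OrderLE.natCeil (((((((OrderLE.const 32).mul hB).mul hLt).mul (.inv_pow 2)).add h3).sub
    (.const 1)).mono (by norm_num))

theorem exists_Ntilde_le (h₁ : P.Assumption1 c) (h₂ : P.Assumption2 c) (hDy : 0 < P.Dy)
    (hL : 0 < c.Lgradf₁ + c.Lgradft₁ + (P.gtHi * c.Lgradgt + c.Lgt ^ 2)) :
    ∃ C : ℝ, 0 ≤ C ∧ ∀ i ∈ P.admissible,
      P.Ntilde c i.1 i.2.1 i.2.2 ≤ C * ((i.1 ^ 7)⁻¹ * Real.log i.1⁻¹) := by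
  have hK := order_Ktilde (P := P) h₁
  have hK1 := hK.add (OrderLE.const 1)
  have hLt := order_Ltilde (P := P) (c := c)
  have hcost : P.OrderLE 0 fun i => (⌈96 * Real.sqrt 2 *
      (1 + (24 * P.Ltilde c i.1 + 4 * i.1 / P.Dy) * (P.Ltilde c i.1)⁻¹)⌉₊ : ℝ) + 2 := by
    have h3 : P.OrderLE 0 fun i =>
        1 + (24 * P.Ltilde c i.1 + 4 * i.1 / P.Dy) * (P.Ltilde c i.1)⁻¹ :=
      ((OrderLE.const 25).add (((OrderLE.const 4).mul (OrderLE.eps.mul (.const P.Dy⁻¹))).mul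
        (order_Ltilde_inv h₁ h₂ hDy hL))).of_le fun i hi => le_of_eq (by
          have := (Ltilde_pos h₁ h₂ hDy hL hi.1 hi.2.1).ne'
          congr 1
          field_simp
          ring)
    exact (OrderLE.natCeil ((OrderLE.const _).mul h3)).add (.const 2)
  have hlog : P.OrderLE 0 fun i => 1 / Real.log i.1⁻¹ :=
    (OrderLE.const 1).of_le fun i hi => by
      have hu := one_le_log_inv_of_admissible hi
      rw [abs_of_nonneg (by positivity), abs_one]
      exact (div_le_one (by linarith)).2 hu
  obtain ⟨C, h0, hC⟩ := ((hcost.mul (order_max_sqrt (P := P) (c := c))).mul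
    (((hK1.mul (order_Ctilde h₁ h₂ hDy hL).max_log).add (hK1.mul hlog)).add
      (((OrderLE.const 2).mul hK).mul hK1.max_log))).mono (k' := 7) (by norm_num)
  refine ⟨C, h0, fun i hi => ?_⟩
  have h3 := (le_abs_self _).trans (hC i hi)
  have hu0 : 0 < Real.log i.1⁻¹ := zero_lt_one.trans_le (one_le_log_inv_of_admissible hi)
  have h4 : 0 ≤ Real.log ((P.Ktilde c i.1 i.2.1 i.2.2 : ℝ) + 1) :=
    Real.log_nonneg (le_add_of_nonneg_left (Nat.cast_nonneg _))
  have e : P.Ntilde c i.1 i.2.1 i.2.2 = _ * Real.log i.1⁻¹ :=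
    (div_mul_cancel₀ _ hu0.ne').symm
  rw [e, ← mul_assoc, ← inv_pow]
  refine mul_le_mul_of_nonneg_right (le_trans (le_of_eq ?_) h3) hu0.le
  beta_reduce
  rw [Ntilde, max_eq_left h4]
  ring

theorem exists_valueGap_le (h₁ : P.Assumption1 c) (h₂ : P.Assumption2 c) (hDy : 0 < P.Dy)
    (hL : 0 < c.Lgradf₁ + c.Lgradft₁ + (P.gtHi * c.Lgradgt + c.Lgt ^ 2)) :
    ∃ C : ℝ, 0 ≤ C ∧ ∀ i ∈ P.admissible, P.valueGap c i.1 i.2.1 i.2.2 ≤ C * i.1 := by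
  have hLt := order_Ltilde (P := P) (c := c)
  have h3 : P.OrderLE 0 fun i => 1 + P.fR (pt i.2.1 i.2.2) - P.fLow +
      2 * i.1 ^ 5 * ((P.Ltilde c i.1)⁻¹ + 4 * P.Dy ^ 2 * P.Ltilde c i.1 * (i.1 ^ 2)⁻¹) +
        P.Dy * i.1 / 4 := by
    have h5 : P.OrderLE 0 fun i =>
        2 * i.1 ^ 5 * ((P.Ltilde c i.1)⁻¹ + 4 * P.Dy ^ 2 * P.Ltilde c i.1 * (i.1 ^ 2)⁻¹) :=
      (((OrderLE.const 2).mul ((OrderLE.pow_zero 5).mul (order_Ltilde_inv h₁ h₂ hDy hL))).add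
        ((OrderLE.const (8 * P.Dy ^ 2)).mul (hLt.eps_mul.eps_mul.eps_mul))).of_le
        fun i hi => le_of_eq (by
          have := hi.1.ne'
          congr 1
          field_simp
          ring)
    exact ((((OrderLE.const 1).add (order_fR h₁)).sub (.const P.fLow)).add h5).add
      (((OrderLE.const P.Dy).mul .eps).mul (.const 4⁻¹))
  have h4 : P.OrderLE 0 fun i => i.1 * (c.G ^ 2)⁻¹ * P.Dy ^ 2 * c.Lft *
      (i.1 ^ 2 + i.1 * c.Lf + c.Lft) / 2 :=
    ((((OrderLE.eps.mul (.const (c.G ^ 2)⁻¹)).mul (.const (P.Dy ^ 2))).mul (.const c.Lft)).mul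
      (((OrderLE.pow_zero 2).add (OrderLE.eps.mul (.const c.Lf))).add (.const c.Lft))).mul
      (.const 2⁻¹)
  obtain ⟨C, h0, hC⟩ := h3.max h4
  refine ⟨C, h0, fun i hi => ?_⟩
  have h5 := (le_abs_self _).trans (hC i hi)
  have hε := hi.1
  rw [max_self, _root_.pow_zero, mul_one] at h5
  rw [valueGap, mul_comm C]
  refine max_le ?_ ?_
  · exact mul_le_mul_of_nonneg_left ((le_max_left _ _).trans h5) hε.le
  · refine le_trans (le_of_eq ?_) (mul_le_mul_of_nonneg_left ((le_max_right _ _).trans h5) hε.le)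
    ring

end Problem

theorem mainTheorem2 {n m l : ℕ} (P : BilevelPenalty.Problem n m l) (c : BilevelPenalty.Moduli)
    (h₁ : P.Assumption1 c) (h₂ : P.Assumption2 c) (hDy : 0 < P.Dy)
    (hL : 0 < c.Lgradf₁ + c.Lgradft₁ + (P.gtHi * c.Lgradgt + c.Lgt ^ 2)) :
    -- the bounds below are of the stated orders, uniformly in the accuracy and the initial point
    (∃ κ : ℝ, ∀ ε : ℝ, 0 < ε → ε ≤ 1 / 4 → ∀ x₀ ∈ P.X, ∀ y₀ ∈ P.Y,
      P.Ntilde c ε x₀ y₀ ≤ κ * ((ε ^ 7)⁻¹ * Real.log ε⁻¹) ∧ P.valueGap c ε x₀ y₀ ≤ κ * ε) ∧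
    ∀ ε : ℝ, 0 < ε → ε ≤ 1 / 4 → ∀ x₀ ∈ P.X, ∀ y₀ ∈ P.Y,
      (∀ y ∈ P.Y, P.penalty (ε ^ 2)⁻¹ (BilevelPenalty.pt x₀ y₀) ≤
        P.penalty (ε ^ 2)⁻¹ (BilevelPenalty.pt x₀ y) + ε) →
      ∀ U : Set (BilevelPenalty.Pt n m), P.SmoothRegion c U →
      (∀ j : ℕ, ∀ q ∈ (P.penaltyRun c ε x₀ y₀ j).2, q.GradIn U) →
      ∃ (j : ℕ) (x : BilevelPenalty.Vec n) (y z : BilevelPenalty.Vec m),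
        (P.penaltyRun c ε x₀ y₀ j).1 = BilevelPenalty.Config.halted (BilevelPenalty.pt x y) z ∧
        -- numbers of oracle calls
        (BilevelPenalty.Query.numGradf₁ (P.penaltyRun c ε x₀ y₀ j).2 : ℝ) ≤ P.Ntilde c ε x₀ y₀ ∧
        (BilevelPenalty.Query.numGradft₁ (P.penaltyRun c ε x₀ y₀ j).2 : ℝ) ≤ P.Ntilde c ε x₀ y₀ ∧
        (BilevelPenalty.Query.numGradgt (P.penaltyRun c ε x₀ y₀ j).2 : ℝ) ≤ P.Ntilde c ε x₀ y₀ ∧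
        (BilevelPenalty.Query.numProxf₂ (P.penaltyRun c ε x₀ y₀ j).2 : ℝ) ≤ P.Ntilde c ε x₀ y₀ ∧
        (BilevelPenalty.Query.numProxft₂ (P.penaltyRun c ε x₀ y₀ j).2 : ℝ) ≤ P.Ntilde c ε x₀ y₀ ∧
        -- approximate KKT conditions
        ∃ lt lh : BilevelPenalty.Vec l,
          lt = (2 * (ε ^ 2)⁻¹) • BilevelPenalty.posPart (P.gt (BilevelPenalty.pt x z)) ∧
          lh = (2 * (ε ^ 3)⁻¹) • BilevelPenalty.posPart (P.gt (BilevelPenalty.pt x y)) ∧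
          Metric.infEDist 0 (P.statSetXY ε⁻¹ x y z lt lh) ≤ ENNReal.ofReal ε ∧
          Metric.infEDist 0 (P.statSetZ ε⁻¹ x z lt) ≤ ENNReal.ofReal ε ∧
          ‖BilevelPenalty.posPart (P.gt (BilevelPenalty.pt x z))‖ ≤
            ε ^ 2 * c.G⁻¹ * P.Dy * (ε ^ 2 + c.Lft) / 2 ∧
          |inner ℝ lt (P.gt (BilevelPenalty.pt x z))| ≤
            ε ^ 2 * (c.G ^ 2)⁻¹ * P.Dy ^ 2 * (ε ^ 2 + c.Lft) ^ 2 / 2 ∧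
          |P.ftR (BilevelPenalty.pt x y) - P.ftStar x| ≤ P.valueGap c ε x₀ y₀ ∧
          ‖BilevelPenalty.posPart (P.gt (BilevelPenalty.pt x y))‖ ≤
            ε ^ 2 * c.G⁻¹ * P.Dy * (ε ^ 2 + ε * c.Lf + c.Lft) / 2 ∧
          |inner ℝ lh (P.gt (BilevelPenalty.pt x y))| ≤
            ε * (c.G ^ 2)⁻¹ * P.Dy ^ 2 * (ε ^ 2 + ε * c.Lf + c.Lft) ^ 2 / 2 := by
  refine ⟨?_, fun ε hε hε1 x₀ hx₀ y₀ hy₀ hstart U hU hgood => ?_⟩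
  · obtain ⟨C, -, hC⟩ := BilevelPenalty.Problem.exists_Ntilde_le h₁ h₂ hDy hL
    obtain ⟨C', -, hC'⟩ := BilevelPenalty.Problem.exists_valueGap_le h₁ h₂ hDy hL
    refine ⟨max C C', fun ε hε hε1 x₀ hx₀ y₀ hy₀ => ?_⟩
    have hi : (ε, x₀, y₀) ∈ P.admissible := ⟨hε, hε1, hx₀, hy₀⟩
    have hlog := BilevelPenalty.Problem.one_le_log_inv_of_admissible hi
    refine ⟨(hC _ hi).trans (mul_le_mul_of_nonneg_right (le_max_left _ _) ?_),
      (hC' _ hi).trans (mul_le_mul_of_nonneg_right (le_max_right _ _) hε.le)⟩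
    exact mul_nonneg (by positivity) (zero_le_one.trans hlog)
  · have hLp := BilevelPenalty.Problem.Ltilde_pos h₁ h₂ hDy hL hε hε1
    obtain ⟨j, x, y, z, bx, bz, hj, n1, n2, n3, n4, n5, hbx, hbz, hex, hez, hval⟩ :=
      BilevelPenalty.Problem.penaltyRun_terminates h₁ h₂ hDy hε hε1 hLp hx₀ hy₀ hstart hU hgood
    obtain ⟨r1, r2, r3⟩ :=
      BilevelPenalty.Problem.feasibility_bounds h₁ h₂ hDy hε hbx hbz hex hez hval
    have hG := h₂.G_pos.ne'
    refine ⟨j, x, y, z, hj, n1, n2, n3, n4, n5, _, _, rfl, rfl,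
      BilevelPenalty.Problem.infEDist_statSetXY_le h₁ hε hbx hex,
      BilevelPenalty.Problem.infEDist_statSetZ_le h₁ hε hbx.1.1 hbz hez, r1, ?_, r2, r3, ?_⟩
    · refine (BilevelPenalty.Problem.inner_smul_posPart_le (by positivity) r1).trans (le_of_eq ?_)
      field_simp
    · refine (BilevelPenalty.Problem.inner_smul_posPart_le (by positivity) r3).trans (le_of_eq ?_)
      field_simp

end BilevelPenalty

end

theorem mainTheorem2 {n m l : ℕ} (P : BilevelPenalty.Problem n m l) (c : BilevelPenalty.Moduli)
    (h₁ : P.Assumption1 c) (h₂ : P.Assumption2 c) (hDy : 0 < P.Dy)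
    (hL : 0 < c.Lgradf₁ + c.Lgradft₁ + (P.gtHi * c.Lgradgt + c.Lgt ^ 2)) :
    -- the bounds below are of the stated orders, uniformly in the accuracy and the initial point
    (∃ κ : ℝ, ∀ ε : ℝ, 0 < ε → ε ≤ 1 / 4 → ∀ x₀ ∈ P.X, ∀ y₀ ∈ P.Y,
      P.Ntilde c ε x₀ y₀ ≤ κ * ((ε ^ 7)⁻¹ * Real.log ε⁻¹) ∧ P.valueGap c ε x₀ y₀ ≤ κ * ε) ∧
    ∀ ε : ℝ, 0 < ε → ε ≤ 1 / 4 → ∀ x₀ ∈ P.X, ∀ y₀ ∈ P.Y,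
      (∀ y ∈ P.Y, P.penalty (ε ^ 2)⁻¹ (BilevelPenalty.pt x₀ y₀) ≤
        P.penalty (ε ^ 2)⁻¹ (BilevelPenalty.pt x₀ y) + ε) →
      ∀ U : Set (BilevelPenalty.Pt n m), P.SmoothRegion c U →
      (∀ j : ℕ, ∀ q ∈ (P.penaltyRun c ε x₀ y₀ j).2, q.GradIn U) →
      ∃ (j : ℕ) (x : BilevelPenalty.Vec n) (y z : BilevelPenalty.Vec m),
        (P.penaltyRun c ε x₀ y₀ j).1 = BilevelPenalty.Config.halted (BilevelPenalty.pt x y) z ∧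
        -- numbers of oracle calls
        (BilevelPenalty.Query.numGradf₁ (P.penaltyRun c ε x₀ y₀ j).2 : ℝ) ≤ P.Ntilde c ε x₀ y₀ ∧
        (BilevelPenalty.Query.numGradft₁ (P.penaltyRun c ε x₀ y₀ j).2 : ℝ) ≤ P.Ntilde c ε x₀ y₀ ∧
        (BilevelPenalty.Query.numGradgt (P.penaltyRun c ε x₀ y₀ j).2 : ℝ) ≤ P.Ntilde c ε x₀ y₀ ∧
        (BilevelPenalty.Query.numProxf₂ (P.penaltyRun c ε x₀ y₀ j).2 : ℝ) ≤ P.Ntilde c ε x₀ y₀ ∧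
        (BilevelPenalty.Query.numProxft₂ (P.penaltyRun c ε x₀ y₀ j).2 : ℝ) ≤ P.Ntilde c ε x₀ y₀ ∧
        -- approximate KKT conditions
        ∃ lt lh : BilevelPenalty.Vec l,
          lt = (2 * (ε ^ 2)⁻¹) • BilevelPenalty.posPart (P.gt (BilevelPenalty.pt x z)) ∧
          lh = (2 * (ε ^ 3)⁻¹) • BilevelPenalty.posPart (P.gt (BilevelPenalty.pt x y)) ∧
          Metric.infEDist 0 (P.statSetXY ε⁻¹ x y z lt lh) ≤ ENNReal.ofReal ε ∧
          Metric.infEDist 0 (P.statSetZ ε⁻¹ x z lt) ≤ ENNReal.ofReal ε ∧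
          ‖BilevelPenalty.posPart (P.gt (BilevelPenalty.pt x z))‖ ≤
            ε ^ 2 * c.G⁻¹ * P.Dy * (ε ^ 2 + c.Lft) / 2 ∧
          |inner ℝ lt (P.gt (BilevelPenalty.pt x z))| ≤
            ε ^ 2 * (c.G ^ 2)⁻¹ * P.Dy ^ 2 * (ε ^ 2 + c.Lft) ^ 2 / 2 ∧
          |P.ftR (BilevelPenalty.pt x y) - P.ftStar x| ≤ P.valueGap c ε x₀ y₀ ∧
          ‖BilevelPenalty.posPart (P.gt (BilevelPenalty.pt x y))‖ ≤
            ε ^ 2 * c.G⁻¹ * P.Dy * (ε ^ 2 + ε * c.Lf + c.Lft) / 2 ∧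
          |inner ℝ lh (P.gt (BilevelPenalty.pt x y))| ≤
            ε * (c.G ^ 2)⁻¹ * P.Dy ^ 2 * (ε ^ 2 + ε * c.Lf + c.Lft) ^ 2 / 2 := by
  refine ⟨?_, fun ε hε hε1 x₀ hx₀ y₀ hy₀ hstart U hU hgood => ?_⟩
  · obtain ⟨C, -, hC⟩ := BilevelPenalty.Problem.exists_Ntilde_le h₁ h₂ hDy hL
    obtain ⟨C', -, hC'⟩ := BilevelPenalty.Problem.exists_valueGap_le h₁ h₂ hDy hL
    refine ⟨max C C', fun ε hε hε1 x₀ hx₀ y₀ hy₀ => ?_⟩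
    have hi : (ε, x₀, y₀) ∈ P.admissible := ⟨hε, hε1, hx₀, hy₀⟩
    have hlog := BilevelPenalty.Problem.one_le_log_inv_of_admissible hi
    refine ⟨(hC _ hi).trans (mul_le_mul_of_nonneg_right (le_max_left _ _) ?_),
      (hC' _ hi).trans (mul_le_mul_of_nonneg_right (le_max_right _ _) hε.le)⟩
    exact mul_nonneg (by positivity) (zero_le_one.trans hlog)
  · have hLp := BilevelPenalty.Problem.Ltilde_pos h₁ h₂ hDy hL hε hε1
    obtain ⟨j, x, y, z, bx, bz, hj, n1, n2, n3, n4, n5, hbx, hbz, hex, hez, hval⟩ :=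
      BilevelPenalty.Problem.penaltyRun_terminates h₁ h₂ hDy hε hε1 hLp hx₀ hy₀ hstart hU hgood
    obtain ⟨r1, r2, r3⟩ :=
      BilevelPenalty.Problem.feasibility_bounds h₁ h₂ hDy hε hbx hbz hex hez hval
    have hG := h₂.G_pos.ne'
    refine ⟨j, x, y, z, hj, n1, n2, n3, n4, n5, _, _, rfl, rfl,
      BilevelPenalty.Problem.infEDist_statSetXY_le h₁ hε hbx hex,
      BilevelPenalty.Problem.infEDist_statSetZ_le h₁ hε hbx.1.1 hbz hez, r1, ?_, r2, r3, ?_⟩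
    · refine (BilevelPenalty.Problem.inner_smul_posPart_le (by positivity) r1).trans (le_of_eq ?_)
      field_simp
    · refine (BilevelPenalty.Problem.inner_smul_posPart_le (by positivity) r3).trans (le_of_eq ?_)
      field_simp
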